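/- Let $\Phi$ be the root system of type $E_8$ and $W=W(E_8)$ its Weyl group, the group generated by the reflections $s_\alpha$ ($\alpha\in\Phi$). A \emph{discrete maximal torus} of $W$ is an abelian subgroup $M\le W$ of the largest possible order which, among the abelian subgroups of that order, has the largest number of direct factors isomorphic to $\mathbb Z_4$; its \emph{discrete Weyl group} is $W(M)=N_W(M)/M$. Call an $M$-orbit in $\Phi$ trivial if it is of the form $\{\beta,-\beta\}$. The \emph{extended Fano plane} (one-point extension of the Fano plane) is the incidence structure whose $8$ points are the seven points of the Fano plane and one further point $\infty$, and whose $14$ lines are the sets $\ell\cup\{\infty\}$, with $\ell$ a line of the Fano plane, and the complements of these sets in the set of the $8$ points. Theorem. Let $M$ be any discrete maximal torus of $W(E_8)$. Then $M\cong\mathbb Z_2^8$, and $M$ is generated by the reflections $s_\alpha$ that it contains. Moreover: (i) $|\Phi|=240$. Consider the incidence structure whose points are the reflections $s_\alpha$ contained in $M$ and whose lines are the non-trivial $M$-orbits in $\Phi$, where $s$ lies on the orbit $O$ if and only if $s$ moves some root of $O$. It has $8$ points and $14$ lines, each line contains $4$ points, each point lies on $7$ lines, and it is isomorphic to the extended Fano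 plane. (ii) $W(M)\cong 2^3{:}PSL(2,7)$, a semidirect product of an elementary abelian group of order $8$ with $PSL(2,7)$ in which $PSL(2,7)$ acts faithfully on the normal subgroup $2^3$. -/

import Mathlib

universe u

/-! ### Discrete maximal tori of a finite group -/

/-- `M` is an abelian subgroup of the (finite) group `G` of the largest possible order. -/
def IsMaximalOrderAbelian {G : Type u} [Group G] (M : Subgroup G) : Prop :=
  IsMulCommutative M ∧
    ∀ M' : Subgroup G, IsMulCommutative M' → Nat.card M' ≤ Nat.card M

/-- The group `A` has (at least) `k` direct factors isomorphic to the cyclic group of order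
four: it is a direct product of `k` copies of that group and of some group `B`. -/
def HasCyclicFourFactors (A : Type u) [Group A] (k : ℕ) : Prop :=
  ∃ (B : Type u) (_ : Group B), Nonempty (A ≃* (Fin k → Multiplicative (ZMod 4)) × B)

/-- A discrete maximal torus of `G`: an abelian subgroup of maximal order which, among these,
has the largest number of direct factors isomorphic to the cyclic group of order four. -/
def IsDiscreteMaximalTorus {G : Type u} [Group G] (M : Subgroup G) : Prop :=
  IsMaximalOrderAbelian M ∧
    ∀ M' : Subgroup G, IsMaximalOrderAbelian M' →
      ∀ k : ℕ, HasCyclicFourFactors M' k → HasCyclicFourFactors M k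

/-- The discrete Weyl group `N_G(M) / M`. -/
abbrev DiscreteWeylGroup {G : Type u} [Group G] (M : Subgroup G) : Type u :=
  ↥(Subgroup.normalizer (M : Set G)) ⧸ M.subgroupOf (Subgroup.normalizer (M : Set G))

/-! ### The Fano plane and its one-point extension -/

/-- The points of the Fano plane, i.e. of the projective plane over the field with two
elements: each one-dimensional subspace has exactly one non-zero vector. -/
abbrev FanoPoint : Type := {v : Fin 3 → ZMod 2 // v ≠ 0}

/-- The lines of the Fano plane, given by their equations `l ⬝ᵥ p = 0`. -/
abbrev FanoLine : Type := {l : Fin 3 → ZMod 2 // l ≠ 0}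

/-- The point `p` lies on the line `l` of the Fano plane. -/
def FanoIncident (p : FanoPoint) (l : FanoLine) : Prop := l.1 ⬝ᵥ p.1 = 0

/-- The points of the extended Fano plane: those of the Fano plane and one further point. -/
abbrev ExtendedFanoPoint : Type := Option FanoPoint

/-- The lines of the extended Fano plane: `Sum.inl l` is the line `l` of the Fano plane together
with the further point, `Sum.inr l` is the complement of `Sum.inl l` in the eight points. -/
abbrev ExtendedFanoLine : Type := FanoLine ⊕ FanoLine

/-- Incidence in the extended Fano plane. -/
def ExtendedFanoIncident : ExtendedFanoPoint → ExtendedFanoLine → Prop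
  | none, Sum.inl _ => True
  | some p, Sum.inl l => FanoIncident p l
  | none, Sum.inr _ => False
  | some p, Sum.inr l => ¬ FanoIncident p l

/-! ### The root system and the Weyl group of type `E₈` -/

namespace EEight

/-- The root lattice, in the coordinates given by the simple roots. -/
abbrev RootLattice : Type := Fin 8 → ℤ

/-- The invariant symmetric bilinear form, whose Gram matrix on the simple roots is the
Cartan matrix of type `E₈`. -/
def form : LinearMap.BilinForm ℤ RootLattice := Matrix.toBilin' CartanMatrix.E₈

/-- The roots: the vectors of square length two of the root lattice. -/
def roots : Set RootLattice := {α | form α α = 2}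

/-- The reflection `x ↦ x - (α, x) α` in a root `α`. -/
def reflection (α : RootLattice) (hα : α ∈ roots) : RootLattice ≃ₗ[ℤ] RootLattice :=
  Module.reflection (x := α) (f := form α) hα

/-- The Weyl group, generated by the reflections in the roots. -/
def weylGroup : Subgroup (RootLattice ≃ₗ[ℤ] RootLattice) :=
  Subgroup.closure {g | ∃ (α : RootLattice) (hα : α ∈ roots), g = reflection α hα}

/-- The points of the geometry of `M`: the reflections in roots that belong to `M`. -/
def points (M : Subgroup weylGroup) : Set weylGroup :=
  {s | s ∈ M ∧ ∃ (α : RootLattice) (hα : α ∈ roots),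
    (s : RootLattice ≃ₗ[ℤ] RootLattice) = reflection α hα}

/-- The lines of the geometry of `M`: the non-trivial `M`-orbits of roots, that is, those which
are not of the form `{β, -β}`. -/
def lines (M : Subgroup weylGroup) : Set (Set RootLattice) :=
  {O | (∃ α ∈ roots, O = MulAction.orbit M α) ∧ ∀ β ∈ roots, O ≠ {β, -β}}

/-- The reflection `s` is one of the reflections that the orbit `O` involves: it moves `O`. -/
def Involves (O : Set RootLattice) (s : weylGroup) : Prop := ∃ x ∈ O, s • x ≠ x

end EEight

/-! ### Roots of unity and constituents of rational representations of abelian groups -/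

section

/-! Write `L` for the root lattice. The reflections in eight mutually orthogonal roots (`frame`)
generate a subgroup `frameSubgroup` isomorphic to `2^8`. The geometry and the normalizer are
computed for this subgroup, and the result is carried over by conjugation, since every abelian
subgroup of maximal order is conjugate to it (`exists_conj_eq_frameSubgroup`).

Order. Adjoining `-1` keeps a subgroup abelian, so let `A` be abelian and contain `-1`. If a
subgroup `H` of `A` fixes a nonzero vector, then `|H| * 2 ^ dim Fix H ≤ 256`
(`card_mul_two_pow_le`): roots congruent modulo `2L` agree up to sign, so passing to the stabilizer
of a simple root costs at most a factor two for each dimension gained by the fixed space. If `|A| >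
256`, this bound forces kernels of suitable rational constituents to have an index `n` with `2 ^
φ(n) < n`, hence `n = 6`. Counting then shows that no involution has a fixed space of dimension at
least four, which fails for `t` or for `-t` (`card_le_of_card_mul_two_pow_le`).

Conjugacy. An abelian subgroup of maximal order thus has order 256. As a 2-group it fixes one of the
135 singular vectors of `L/2L`, on which the Weyl group is transitive. The vectors of square length
four above a singular vector are `±` eight orthogonal vectors, so a conjugate acts by signed
permutations of the vectors `quad`. Commutativity and order 256 allow only orbits of length one or
two up to sign; since `L` is even, length one does not occur and the action on each pair is
determined (`exists_partner`). All permutations of the `quad i` come from the Weyl group, so any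
pairing can be made standard.

Geometry. In the coordinates of the frame, the roots are `±frame i` and the half sums, with
arbitrary signs, of four frame roots on a word of weight four of the extended Hamming code. These
words are the 14 affine planes of `F₂³`, which are the lines of the extended Fano plane. Sign
changes preserve and fuse exactly the roots with the same absolute coordinates.

Discrete Weyl group. The normalizer permutes the frame up to sign and preserves planes, with kernel
`frameSubgroup`. Its image is all of `AGL(3, 2)`, which is generated by double transpositions
supported on planes (`affinePerm_le`). With a suitable labelling of the projective line over `F₇` by
`F₂³`, the group `PSL(2, 7)` acts by affine maps; being simple, it embeds in the linear part, and `8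
* 168 = 1344` shows that it complements the translations. -/

theorem dvd_of_totient_le_eight {m : ℕ} (hm : m ≠ 0) (h : m.totient ≤ 8) : m ∣ 5040 := by
  rw [Nat.dvd_iff_prime_pow_dvd_dvd]
  intro p k hp hk
  rcases Nat.eq_zero_or_pos k with rfl | hk0
  · simp
  have h1 : (p ^ k).totient ≤ 8 :=
    (Nat.le_of_dvd (Nat.totient_pos.2 (Nat.pos_of_ne_zero hm)) (Nat.totient_dvd_of_dvd hk)).trans h
  rw [Nat.totient_prime_pow hp hk0] at h1
  have h2 : p - 1 ≤ 8 := le_trans (Nat.le_mul_of_pos_left _ (pow_pos hp.pos _)) h1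
  have h3 : 2 ^ (k - 1) ≤ 8 :=
    le_trans (Nat.pow_le_pow_left hp.two_le _)
      (le_trans (Nat.le_mul_of_pos_right _ (Nat.sub_pos_of_lt hp.one_lt)) h1)
  have h4 : k - 1 < 4 := by
    by_contra! h5
    have := Nat.pow_le_pow_right (n := 2) (by norm_num) h5
    omega
  have h6 : p ≤ 9 := by omega
  have h7 : k ≤ 4 := by omega
  -- The prime powers that survive are the divisors of `16`, `9`, `5` and `7`, and `5040 = 16 * 9 *
  -- 5 * 7`.
  interval_cases p <;> first | (exfalso; revert hp; norm_num; done) | skip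
  all_goals interval_cases k <;> revert h1 <;> decide

/-- The arithmetic behind the order bound: `φ(6) = 2` and `2 ^ 2 < 6`, the only such exception in
this range. -/
theorem eq_six_of_two_pow_totient_lt {m : ℕ} (hm : m ≠ 0) (h : m.totient ≤ 8)
    (h2 : 2 ^ m.totient < m) : m = 6 := by
  have h3 : m ∈ Nat.divisors 5040 := Nat.mem_divisors.2 ⟨dvd_of_totient_le_eight hm h, by norm_num⟩
  have h4 : ∀ m ∈ Nat.divisors 5040, m.totient ≤ 8 → 2 ^ m.totient < m → m = 6 := by
    decide +kernel
  exact h4 m h3 h h2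

theorem Ideal.IsMaximal.exists_algHom_field.{v, w} {k : Type v} {R : Type w} [Field k] [CommRing R] [Algebra k R]
    {I : Ideal R} (hI : I.IsMaximal) :
    ∃ (F : Type w) (_ : Field F) (_ : Algebra k F) (π : R →ₐ[k] F),
      Function.Surjective π ∧ ∀ x, π x = 0 ↔ x ∈ I :=
  ⟨R ⧸ I, Ideal.Quotient.field I, Ideal.Quotient.algebra k, Ideal.Quotient.mkₐ k I,
    Ideal.Quotient.mkₐ_surjective k I, fun _ => Ideal.Quotient.eq_zero_iff_mem⟩

open Module in
-- A finite subgroup of the units of a field is cyclic. A generator is a primitive root of unity,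
-- and its minimal polynomial over `ℚ` is cyclotomic.
theorem totient_card_range_le_finrank {A F : Type*} [Group A] [Finite A] [Field F] [alg : Algebra ℚ F]
    [FiniteDimensional ℚ F] (g : A →* Fˣ) : (Nat.card g.range).totient ≤ finrank ℚ F := by
  have : Finite g.range := Finite.of_surjective _ g.rangeRestrict_surjective
  have hcy : IsCyclic g.range := isCyclic_subgroup_units g.range
  obtain ⟨ζ, hζ⟩ := hcy.exists_generator
  have hord : orderOf ζ = Nat.card g.range := orderOf_eq_card_of_forall_mem_zpowers hζ
  have hz : IsPrimitiveRoot ((ζ : Fˣ) : F) (Nat.card g.range) := by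
    rw [← hord]
    have := IsPrimitiveRoot.orderOf ((ζ : Fˣ) : F)
    rwa [orderOf_units, Subgroup.orderOf_coe] at this
  have : CharZero F := algebraRat.charZero _
  have h2 := Polynomial.cyclotomic_eq_minpoly_rat hz Nat.card_pos
  rw [← Polynomial.natDegree_cyclotomic (Nat.card g.range) ℚ, h2]
  rw [Subsingleton.elim (DivisionRing.toRatAlgebra : Algebra ℚ F) alg]
  exact minpoly.natDegree_le (A := ℚ) ((ζ : Fˣ) : F)

open Module in
-- An irreducible `S` is cyclic over the commutative group algebra, so it is a quotient by a maximal
-- ideal, that is, a field `F` with `[F : ℚ] = dim S`. The group acts through roots of unity of `F`,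
-- and `K` is the kernel of this action.
theorem exists_constituent {A V : Type*} [CommGroup A] [Finite A] [AddCommGroup V] [Module ℚ V]
    [FiniteDimensional ℚ V] (ρ : Representation ℚ A V) (U : Submodule ℚ V)
    (hU : ∀ a, ∀ u ∈ U, ρ a u ∈ U) (hne : U ≠ ⊥) :
    ∃ S ≤ U, S ≠ ⊥ ∧ (∀ a, ∀ u ∈ S, ρ a u ∈ S) ∧
      ∃ K : Subgroup A, (∀ a, a ∈ K ↔ ∀ u ∈ S, ρ a u = u) ∧ K.index.totient ≤ finrank ℚ S := by
  obtain ⟨S, ⟨hSU, hS0, hSi⟩, hmin⟩ := WellFounded.has_min (wellFounded_lt (α := Submodule ℚ V))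
    {S : Submodule ℚ V | S ≤ U ∧ S ≠ ⊥ ∧ ∀ a, ∀ u ∈ S, ρ a u ∈ S} ⟨U, le_rfl, hne, hU⟩
  refine ⟨S, hSU, hS0, hSi, ?_⟩
  obtain ⟨s, hs, hs0⟩ := S.ne_bot_iff.1 hS0
  let R := MonoidAlgebra ℚ A
  let f : R →ₐ[ℚ] (V →ₗ[ℚ] V) := ρ.asAlgebraHom
  have hof : ∀ a, f (MonoidAlgebra.of ℚ A a) = ρ a := ρ.asAlgebraHom_of
  have hfS : ∀ x : R, ∀ u ∈ S, f x u ∈ S := by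
    intro x u hu
    induction x using MonoidAlgebra.induction_on with
    | of a => rw [hof]; exact hSi a u hu
    | add x y hx hy => rw [map_add]; exact S.add_mem hx hy
    | smul r x hx => rw [map_smul]; exact S.smul_mem r hx
  have hcyc : ∀ v ∈ S, v ≠ 0 → ∀ u ∈ S, ∃ y : R, f y v = u := by
    intro v hv hv0
    let T : Submodule ℚ V := LinearMap.range ((LinearMap.applyₗ v).comp f.toLinearMap)
    have hTS : T ≤ S := by
      rintro _ ⟨y, rfl⟩
      exact hfS y v hv
    have hT : T = S := by
      by_contra hne
      refine hmin T ⟨hTS.trans hSU, ?_, ?_⟩ (lt_of_le_of_ne hTS hne)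
      · refine T.ne_bot_iff.2 ⟨v, ⟨1, ?_⟩, hv0⟩
        simp [f]
      · rintro a _ ⟨y, rfl⟩
        refine ⟨MonoidAlgebra.of ℚ A a * y, ?_⟩
        change f _ v = ρ a (f y v)
        rw [map_mul, hof, Module.End.mul_apply]
    intro u hu
    rw [← hT] at hu
    exact hu
  -- The annihilator of `s`; irreducibility makes it maximal. As the algebra is commutative and `s`
  -- generates `S`, an element that fixes `s` fixes all of `S`.
  let I : Ideal R :=
    { carrier := {x | f x s = 0}
      add_mem' := fun {x y} hx hy => by
        change f _ s = 0 at hx hy ⊢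
        rw [map_add, LinearMap.add_apply, hx, hy, add_zero]
      zero_mem' := by simp
      smul_mem' := fun c x hx => by
        change f _ s = 0 at hx ⊢
        rw [smul_eq_mul, map_mul, Module.End.mul_apply, hx, map_zero] }
  have hI : ∀ x : R, x ∈ I ↔ f x s = 0 := fun x => Iff.rfl
  have hmax : I.IsMaximal := by
    refine Ideal.isMaximal_iff.2 ⟨?_, ?_⟩
    · rw [hI]; simpa using hs0
    · intro J x hIJ hx hxJ
      obtain ⟨y, hy⟩ := hcyc (f x s) (hfS x s hs) hx s hs
      have h1 : y * x - 1 ∈ I := by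
        rw [hI, map_sub, map_mul, LinearMap.sub_apply, Module.End.mul_apply, hy]
        simp
      have h2 := J.sub_mem (J.mul_mem_left y hxJ) (hIJ h1)
      simpa using h2
  obtain ⟨F, _, _, π, hπ, hπI⟩ := hmax.exists_algHom_field (k := ℚ)
  let g : A →* F := (π : R →* F).comp (MonoidAlgebra.of ℚ A)
  have hg : ∀ a, g.toHomUnits a = 1 ↔ ρ a s = s := by
    intro a
    have h1 : g.toHomUnits a = 1 ↔ π (MonoidAlgebra.of ℚ A a - 1) = 0 := by
      rw [map_sub, map_one, sub_eq_zero, ← Units.val_inj]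
      rfl
    rw [h1, hπI, hI, map_sub, map_one, LinearMap.sub_apply, sub_eq_zero, hof]
    rfl
  refine ⟨g.toHomUnits.ker, ?_, ?_⟩
  · intro a
    rw [MonoidHom.mem_ker, hg]
    refine ⟨fun h u hu => ?_, fun h => h s hs⟩
    obtain ⟨y, rfl⟩ := hcyc s hs hs0 u hu
    rw [← hof] at h ⊢
    rw [← Module.End.mul_apply, ← map_mul, mul_comm, map_mul, Module.End.mul_apply, h]
  · rw [Subgroup.index_ker]
    have hR : Module.Finite ℚ R := inferInstanceAs (Module.Finite ℚ (MonoidAlgebra ℚ A))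
    have : Module.Finite ℚ F := Module.Finite.of_surjective π.toLinearMap hπ
    refine (totient_card_range_le_finrank _).trans ?_
    let l : R →ₗ[ℚ] V := (LinearMap.applyₗ s).comp f.toLinearMap
    -- The maps to `F` and to the orbit of `s` have the same kernel `I`, so their ranges have the
    -- same dimension.
    have hker : LinearMap.ker π.toLinearMap = LinearMap.ker l := by
      ext x
      exact hπI x
    have h1 := π.toLinearMap.finrank_range_add_finrank_ker
    have h2 := l.finrank_range_add_finrank_ker
    rw [hker, LinearMap.range_eq_top.2 hπ, finrank_top] at h1
    have h3 : finrank ℚ (LinearMap.range l) ≤ finrank ℚ S := by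
      refine Submodule.finrank_mono ?_
      rintro _ ⟨y, rfl⟩
      exact hfS y s hs
    omega

end

/-! ### The order bound for an abelian group acting on a rational space of dimension eight -/

section

open Module

namespace Representation

variable {A V : Type*} [CommGroup A] [AddCommGroup V] [Module ℚ V]

/-- The vectors fixed by a subgroup. -/
def fixedSubmodule (ρ : Representation ℚ A V) (H : Subgroup A) : Submodule ℚ V where
  carrier := {v | ∀ h ∈ H, ρ h v = v}
  add_mem' hv hw h hh := by rw [map_add, hv h hh, hw h hh]
  zero_mem' h _ := map_zero _
  smul_mem' c v hv h hh := by rw [map_smul, hv h hh]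

theorem mem_fixedSubmodule {ρ : Representation ℚ A V} {H : Subgroup A} {v : V} :
    v ∈ ρ.fixedSubmodule H ↔ ∀ h ∈ H, ρ h v = v := Iff.rfl

theorem fixedSubmodule_anti (ρ : Representation ℚ A V) {H K : Subgroup A} (h : H ≤ K) :
    ρ.fixedSubmodule K ≤ ρ.fixedSubmodule H := fun _ hv k hk => hv k (h hk)

/-- The vectors whose average over a subgroup vanishes. -/
noncomputable def averageKer [Finite A] (ρ : Representation ℚ A V) (H : Subgroup A) :
    Submodule ℚ V :=
  LinearMap.ker (∑ᶠ h : H, ρ h)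

theorem mem_averageKer [Finite A] [Fintype A] {ρ : Representation ℚ A V} {H : Subgroup A}
    [Fintype H] {v : V} : v ∈ ρ.averageKer H ↔ ∑ h : H, ρ h v = 0 := by
  rw [averageKer, LinearMap.mem_ker, finsum_eq_sum_of_fintype, LinearMap.sum_apply]

theorem disjoint_fixedSubmodule_averageKer [Finite A] (ρ : Representation ℚ A V)
    (H : Subgroup A) : Disjoint (ρ.fixedSubmodule H) (ρ.averageKer H) := by
  have := Fintype.ofFinite A
  have := Fintype.ofFinite H
  rw [Submodule.disjoint_def]
  intro v hv hw
  rw [mem_averageKer, Finset.sum_congr rfl (fun (h : H) _ => hv h h.2), Finset.sum_const,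
    Finset.card_univ, ← Nat.cast_smul_eq_nsmul ℚ, smul_eq_zero] at hw
  refine hw.resolve_left ?_
  exact_mod_cast Fintype.card_ne_zero

theorem apply_comm (ρ : Representation ℚ A V) (a b : A) (v : V) :
    ρ a (ρ b v) = ρ b (ρ a v) := by
  rw [← Module.End.mul_apply, ← map_mul, mul_comm, map_mul, Module.End.mul_apply]

theorem apply_mem_averageKer [Finite A] (ρ : Representation ℚ A V) (H : Subgroup A) (a : A)
    {v : V} (hv : v ∈ ρ.averageKer H) : ρ a v ∈ ρ.averageKer H := by
  have := Fintype.ofFinite A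
  have := Fintype.ofFinite H
  rw [mem_averageKer] at *
  simp_rw [fun h : H => ρ.apply_comm h a v]
  rw [← map_sum, hv, map_zero]

theorem sub_apply_mem_averageKer [Finite A] (ρ : Representation ℚ A V) {H : Subgroup A} {a : A}
    (ha : a ∈ H) (v : V) : v - ρ a v ∈ ρ.averageKer H := by
  have := Fintype.ofFinite A
  have := Fintype.ofFinite H
  rw [mem_averageKer]
  simp_rw [map_sub]
  rw [Finset.sum_sub_distrib, sub_eq_zero]
  refine (Fintype.sum_equiv (Equiv.mulRight (⟨a, ha⟩ : H)) _ _ fun h => ?_).symm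
  rw [← Module.End.mul_apply, ← map_mul]
  rfl

/-- The intersection of the two subgroups fixes both summands. -/
theorem finrank_fixedSubmodule_inf [FiniteDimensional ℚ V] (ρ : Representation ℚ A V)
    {K K' : Subgroup A} {S : Submodule ℚ V}
    (hd : Disjoint (ρ.fixedSubmodule K) S) (hK' : ∀ a, a ∈ K' ↔ ∀ u ∈ S, ρ a u = u) :
    finrank ℚ (ρ.fixedSubmodule K) + finrank ℚ S ≤
      finrank ℚ (ρ.fixedSubmodule (K' ⊓ K)) := by
  rw [← Submodule.finrank_sup_add_finrank_inf_eq, hd.eq_bot, finrank_bot, add_zero]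
  refine Submodule.finrank_mono (sup_le (ρ.fixedSubmodule_anti inf_le_right) ?_)
  exact fun v hv a ha => (hK' a).1 ha.1 v hv

theorem _root_.Subgroup.exists_dvd_index_card_eq_mul (K' K : Subgroup A) :
    ∃ a, a ∣ K'.index ∧ Nat.card K = a * Nat.card (K' ⊓ K : Subgroup A) := by
  refine ⟨K'.relIndex K, Subgroup.relIndex_dvd_index_of_normal K' K, ?_⟩
  rw [← (K'.subgroupOf K).card_mul_index, mul_comm, Subgroup.relIndex]
  congr 1
  rw [← Subgroup.subgroupOf_map_subtype, Subgroup.card_map_of_injective K.subtype_injective]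

theorem card_le_of_finrank (ρ : Representation ℚ A V)
    (hb : ∀ H : Subgroup A, ρ.fixedSubmodule H ≠ ⊥ →
      Nat.card H * 2 ^ finrank ℚ (ρ.fixedSubmodule H) ≤ 256)
    {K : Subgroup A} {j : ℕ} (hj : 0 < j)
    (hK : j ≤ finrank ℚ (ρ.fixedSubmodule K)) : Nat.card K * 2 ^ j ≤ 256 := by
  refine (Nat.mul_le_mul_left _ (Nat.pow_le_pow_right (by norm_num) hK)).trans (hb K ?_)
  intro h
  rw [h, finrank_bot] at hK
  omega

theorem card_eq_one_of_fixedSubmodule_eq_top (ρ : Representation ℚ A V)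
    (hinj : ∀ a, (∀ v, ρ a v = v) → a = 1) {K : Subgroup A} (hK : ρ.fixedSubmodule K = ⊤) :
    Nat.card K = 1 := by
  rw [Subgroup.card_eq_one, Subgroup.eq_bot_iff_forall]
  exact fun a ha => hinj a fun v => (hK ▸ Submodule.mem_top : v ∈ ρ.fixedSubmodule K) a ha

variable [Finite A] [FiniteDimensional ℚ V] (ρ : Representation ℚ A V)

/-- Take a constituent `S` of the part of `U` with vanishing average over `K`, and its kernel `K'`.
The bound for `K'` and `|A| > 256` give `2 ^ dim Fix K' < [A : K']`, while the totient of this index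
is at most `dim S ≤ dim Fix K'`. So the index is six, and both dimensions are squeezed to two. -/
theorem exists_subgroup_index_eq_six (hdim : finrank ℚ V = 8)
    (hb : ∀ H : Subgroup A, ρ.fixedSubmodule H ≠ ⊥ →
      Nat.card H * 2 ^ finrank ℚ (ρ.fixedSubmodule H) ≤ 256)
    (hA : 256 < Nat.card A) (K : Subgroup A) (U : Submodule ℚ V)
    (hU : ∀ a, ∀ u ∈ U, ρ a u ∈ U) (hKU : ∃ k ∈ K, ∃ u ∈ U, ρ k u ≠ u) :
    ∃ S ≤ U, finrank ℚ S = 2 ∧ Disjoint (ρ.fixedSubmodule K) S ∧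
      ∃ K' : Subgroup A, (∀ a, a ∈ K' ↔ ∀ u ∈ S, ρ a u = u) ∧ K'.index = 6 ∧
        finrank ℚ (ρ.fixedSubmodule K') = 2 := by
  obtain ⟨k, hk, u, hu, hku⟩ := hKU
  obtain ⟨S, hSU, hS0, -, K', hK', hφ⟩ := exists_constituent ρ (U ⊓ ρ.averageKer K)
    (fun a u hu => ⟨hU a u hu.1, ρ.apply_mem_averageKer K a hu.2⟩)
    ((Submodule.ne_bot_iff _).2 ⟨u - ρ k u, ⟨U.sub_mem hu (hU k u hu),
      ρ.sub_apply_mem_averageKer hk u⟩, sub_ne_zero.2 hku.symm⟩)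
  have hSf : S ≤ ρ.fixedSubmodule K' := fun v hv a ha => (hK' a).1 ha v hv
  have hne : ρ.fixedSubmodule K' ≠ ⊥ := fun h => hS0 (le_bot_iff.1 (h ▸ hSf))
  have h1 := hb K' hne
  have h2 := K'.card_mul_index
  have h3 := Submodule.finrank_mono hSf
  have h4 : finrank ℚ (ρ.fixedSubmodule K') ≤ 8 := hdim ▸ Submodule.finrank_le _
  have hK0 : 0 < Nat.card K' := Nat.card_pos
  have h5 : 2 ^ finrank ℚ (ρ.fixedSubmodule K') < K'.index := by
    refine lt_of_mul_lt_mul_left (a := Nat.card K') ?_ (Nat.zero_le _)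
    rw [h2]
    exact h1.trans_lt hA
  have h6 : K'.index = 6 := eq_six_of_two_pow_totient_lt h5.ne_bot (by omega)
    (lt_of_le_of_lt (Nat.pow_le_pow_right (by norm_num) (by omega)) h5)
  rw [h6] at h5 hφ
  have h7 : finrank ℚ (ρ.fixedSubmodule K') < 3 := by
    by_contra! h
    have := Nat.pow_le_pow_right (n := 2) (by norm_num) h
    omega
  have h8 : Nat.totient 6 = 2 := by decide
  exact ⟨S, hSU.trans inf_le_left, by omega,
    (ρ.disjoint_fixedSubmodule_averageKer K).mono_right (hSU.trans inf_le_right), K', hK', h6,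
    by omega⟩

variable (hdim : finrank ℚ V = 8) (hinj : ∀ a, (∀ v, ρ a v = v) → a = 1)
  (hb : ∀ H : Subgroup A, ρ.fixedSubmodule H ≠ ⊥ →
    Nat.card H * 2 ^ finrank ℚ (ρ.fixedSubmodule H) ≤ 256)
  (hA : 256 < Nat.card A)

include hdim hinj hb hA in
-- The descent step: intersecting with a kernel of index six divides the order by a divisor of six
-- and enlarges the fixed space by at least two dimensions.
theorem exists_card_eq_mul (K : Subgroup A) :
    ∃ a, a ∣ 6 ∧ ∃ K' : Subgroup A, Nat.card K = a * Nat.card K' ∧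
      (finrank ℚ (ρ.fixedSubmodule K) + 2 ≤ finrank ℚ (ρ.fixedSubmodule K') ∨
        Nat.card K' = 1) := by
  by_cases hK : ∃ k ∈ K, ∃ u ∈ (⊤ : Submodule ℚ V), ρ k u ≠ u
  · obtain ⟨S, -, hS, hd, K', hK', h6, -⟩ :=
      ρ.exists_subgroup_index_eq_six hdim hb hA K ⊤ (fun _ _ _ => Submodule.mem_top) hK
    obtain ⟨a, ha, h⟩ := K'.exists_dvd_index_card_eq_mul K
    exact ⟨a, h6 ▸ ha, K' ⊓ K, h, Or.inl (hS ▸ ρ.finrank_fixedSubmodule_inf hd hK')⟩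
  · push Not at hK
    refine ⟨1, one_dvd _, K, (one_mul _).symm, Or.inr ?_⟩
    exact ρ.card_eq_one_of_fixedSubmodule_eq_top hinj
      (eq_top_iff.2 fun v _ k hk => hK k hk v Submodule.mem_top)

include hdim hinj hb hA in
theorem card_dvd_six_of_finrank {K : Subgroup A} (hK : 6 ≤ finrank ℚ (ρ.fixedSubmodule K)) :
    Nat.card K ∣ 6 ∧ Nat.card K ≤ 4 := by
  obtain ⟨a, ha, K', h, h'⟩ := ρ.exists_card_eq_mul hdim hinj hb hA K
  have h1 : Nat.card K' = 1 := by
    refine h'.elim (fun h' => ρ.card_eq_one_of_fixedSubmodule_eq_top hinj ?_) id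
    refine Submodule.eq_top_of_finrank_eq (le_antisymm (Submodule.finrank_le _) ?_)
    omega
  have h2 := ρ.card_le_of_finrank hb (by norm_num) hK
  refine ⟨by rw [h, h1, mul_one]; exact ha, by omega⟩

include hdim hinj hb hA in
theorem card_eq_mul_of_finrank {K : Subgroup A} (hK : 4 ≤ finrank ℚ (ρ.fixedSubmodule K)) :
    Nat.card K ≤ 16 ∧ ∃ b c, b ∣ 6 ∧ c ∣ 6 ∧ c ≤ 4 ∧ Nat.card K = b * c := by
  refine ⟨by have := ρ.card_le_of_finrank hb (by norm_num) hK; omega, ?_⟩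
  obtain ⟨a, ha, K', h, h'⟩ := ρ.exists_card_eq_mul hdim hinj hb hA K
  have h1 : Nat.card K' ∣ 6 ∧ Nat.card K' ≤ 4 := by
    refine h'.elim (fun h' => ρ.card_dvd_six_of_finrank hdim hinj hb hA (by omega)) fun h1 => ?_
    rw [h1]
    decide
  exact ⟨a, _, ha, h1.1, h1.2, h⟩

include hdim hinj hb hA in
-- Intersect two kernels of index six, given by independent constituents inside `U`. Divisibility by
-- the descent and the size bounds together leave only the orders 54 and 9. What acts trivially on
-- `U` lies in both kernels.
theorem exists_card_eq_nine {z : A} (hz : ∀ v, ρ z v = -v) (U : Submodule ℚ V)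
    (hU : ∀ a, ∀ u ∈ U, ρ a u ∈ U) (hU4 : 4 ≤ finrank ℚ U) :
    ∃ K₁ K₂ : Subgroup A, Nat.card K₁ = 54 ∧ ρ.fixedSubmodule K₁ ≠ ⊥ ∧ Nat.card K₂ = 9 ∧
      ∀ a, (∀ u ∈ U, ρ a u = u) → a ∈ K₂ := by
  have : IsAddTorsionFree V := .of_module_rat _
  have hU0 : U ≠ ⊥ := by
    rintro rfl
    rw [finrank_bot] at hU4
    omega
  obtain ⟨u, hu, hu0⟩ := U.ne_bot_iff.1 hU0
  obtain ⟨S₁, hS₁U, -, -, K₁, hK₁, h6, hf₁⟩ :=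
    ρ.exists_subgroup_index_eq_six hdim hb hA ⊤ U hU
      ⟨z, Subgroup.mem_top _, u, hu, fun h => hu0 (self_eq_neg.1 ((hz u) ▸ h).symm)⟩
  have hne : ρ.fixedSubmodule K₁ ≠ ⊥ := by
    intro h
    rw [h, finrank_bot] at hf₁
    omega
  -- `K₁` fixes only a space of dimension two, too small to contain `U`.
  have hK : ∃ k ∈ K₁, ∃ u ∈ U, ρ k u ≠ u := by
    by_contra! h
    have : U ≤ ρ.fixedSubmodule K₁ := fun u hu k hk => h k hk u hu
    have := Submodule.finrank_mono this
    omega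
  obtain ⟨S₂, hS₂U, hS₂, hd, K', hK', h6', -⟩ :=
    ρ.exists_subgroup_index_eq_six hdim hb hA K₁ U hU hK
  obtain ⟨a, ha, h⟩ := K'.exists_dvd_index_card_eq_mul K₁
  have h4 := ρ.finrank_fixedSubmodule_inf hd hK'
  obtain ⟨h16, b, c, hb6, hc6, hc4, hbc⟩ :=
    ρ.card_eq_mul_of_finrank hdim hinj hb hA (K := K' ⊓ K₁) (by omega)
  have h64 := ρ.card_le_of_finrank hb (by norm_num) hf₁.ge
  have hcard := K₁.card_mul_index
  rw [h6'] at ha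
  rw [h6] at hcard
  -- `|K₁| = a * (b * c)` exceeds `256 / 6 > 42` and is at most `256 / 4 = 64`; the only solution is
  -- `6 * (3 * 3)`.
  have key : Nat.card K₁ = 54 ∧ Nat.card (K' ⊓ K₁ : Subgroup A) = 9 := by
    have ha' : a ∈ Nat.divisors 6 := Nat.mem_divisors.2 ⟨ha, by norm_num⟩
    have hb' : b ∈ Nat.divisors 6 := Nat.mem_divisors.2 ⟨hb6, by norm_num⟩
    have hc' : c ∈ Nat.divisors 6 := Nat.mem_divisors.2 ⟨hc6, by norm_num⟩
    have : ∀ a ∈ Nat.divisors 6, ∀ b ∈ Nat.divisors 6, ∀ c ∈ Nat.divisors 6, c ≤ 4 →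
        b * c ≤ 16 → a * (b * c) ≤ 64 → 42 < a * (b * c) → a * (b * c) = 54 ∧ b * c = 9 := by
      decide
    rw [h, hbc]
    rw [h, hbc] at h64 hcard
    exact this a ha' b hb' c hc' hc4 (hbc ▸ h16) (by omega) (by omega)
  exact ⟨K₁, K' ⊓ K₁, key.1, hne, key.2, fun a ha =>
    ⟨(hK' a).2 fun u hu => ha u (hS₂U hu), (hK₁ a).2 fun u hu => ha u (hS₁U hu)⟩⟩

include hdim hinj hb in
theorem card_le_of_card_mul_two_pow_le {z : A} (hz : ∀ v, ρ z v = -v) : Nat.card A ≤ 256 := by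
  by_contra! hA
  have : IsAddTorsionFree V := .of_module_rat _
  obtain ⟨K₁, -, hK₁, hne, -, -⟩ := ρ.exists_card_eq_nine hdim hinj hb hA hz ⊤
    (fun _ _ _ => Submodule.mem_top) (by rw [finrank_top]; omega)
  -- 54 is even, so there is an involution that fixes a nonzero vector and hence is not `-1`.
  obtain ⟨⟨t, htK⟩, ht⟩ := exists_prime_orderOf_dvd_card' (G := K₁) 2 (by rw [hK₁]; norm_num)
  rw [Subgroup.orderOf_mk] at ht
  have ht2 : ∀ v, ρ t (ρ t v) = v := by
    intro v
    rw [← Module.End.mul_apply, ← map_mul, ← sq, ← ht, pow_orderOf_eq_one, map_one]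
    rfl
  -- Otherwise the fixed space of `s` could serve as `U`, and the involution `s` would lie in a
  -- group of order nine.
  have key : ∀ s : A, s ^ 2 = 1 → s ≠ 1 → finrank ℚ (LinearMap.ker (ρ s - 1)) < 4 := by
    intro s hs hs1
    by_contra! h4
    obtain ⟨-, K₂, -, -, h9, hK₂⟩ := ρ.exists_card_eq_nine hdim hinj hb hA hz
      (LinearMap.ker (ρ s - 1)) (fun a u hu => by
        rw [LinearMap.mem_ker, LinearMap.sub_apply, sub_eq_zero] at *
        rw [apply_comm, hu]
        rfl) h4
    have hs2 : s ∈ K₂ := hK₂ s fun u hu => by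
      rwa [LinearMap.mem_ker, LinearMap.sub_apply, sub_eq_zero] at hu
    have h1 : orderOf s ∣ 9 := h9 ▸ K₂.orderOf_dvd_natCard hs2
    have h2 : orderOf s ∣ 2 := orderOf_dvd_of_pow_eq_one hs
    have h3 : orderOf s ∣ 1 := by
      have := Nat.dvd_gcd h1 h2
      simpa using this
    exact hs1 (orderOf_eq_one_iff.1 (Nat.dvd_one.1 h3))
  have hzz : z ^ 2 = 1 := hinj _ fun v => by
    rw [sq, map_mul, Module.End.mul_apply, hz, hz, neg_neg]
  have htt : t ^ 2 = 1 := ht ▸ pow_orderOf_eq_one t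
  have ht1 : t ≠ 1 := by
    rintro rfl
    simp at ht
  have hzt : z * t ≠ 1 := by
    intro h
    obtain ⟨v, hv, hv0⟩ := (Submodule.ne_bot_iff _).1 hne
    have h1 : ρ (z * t) v = v := by rw [h, map_one]; rfl
    rw [map_mul, Module.End.mul_apply, hv t htK, hz] at h1
    exact hv0 (neg_eq_self.1 h1)
  have h1 := key t htt ht1
  have h2 := key (z * t) (by rw [mul_pow, hzz, htt, one_mul]) hzt
  -- The space is the sum of the eigenspaces of `t` for `1` and `-1`, and the second one is the
  -- fixed space of `z * t`. Two spaces of dimension less than four cannot span dimension eight.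
  have h3 : LinearMap.ker (ρ t - 1) ⊔ LinearMap.ker (ρ (z * t) - 1) = ⊤ := by
    rw [eq_top_iff]
    intro v _
    have : v = (2⁻¹ : ℚ) • (v + ρ t v) + (2⁻¹ : ℚ) • (v - ρ t v) := by
      rw [← smul_add, add_add_sub_cancel, ← two_smul ℚ, smul_smul]
      norm_num
    rw [this]
    refine Submodule.add_mem_sup (Submodule.smul_mem _ _ ?_) (Submodule.smul_mem _ _ ?_)
    · rw [LinearMap.mem_ker, LinearMap.sub_apply, map_add, ht2, sub_eq_zero, add_comm]
      rfl
    · rw [LinearMap.mem_ker, LinearMap.sub_apply, map_mul, Module.End.mul_apply, map_sub, ht2, hz,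
        sub_eq_zero, neg_sub]
      rfl
  have h4 := Submodule.finrank_add_le_finrank_add_finrank (LinearMap.ker (ρ t - 1))
    (LinearMap.ker (ρ (z * t) - 1))
  rw [h3, finrank_top] at h4
  omega

end Representation

end

/-! ### The `E₈` lattice in the coordinates of an orthogonal frame of roots -/

section

open Module

namespace EEight

theorem form_apply (x y : RootLattice) : form x y =
    2 * (x 0 * y 0 + x 1 * y 1 + x 2 * y 2 + x 3 * y 3 + x 4 * y 4 + x 5 * y 5 + x 6 * y 6 +
      x 7 * y 7) - (x 0 * y 2 + x 2 * y 0) - (x 1 * y 3 + x 3 * y 1) - (x 2 * y 3 + x 3 * y 2) -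
      (x 3 * y 4 + x 4 * y 3) - (x 4 * y 5 + x 5 * y 4) - (x 5 * y 6 + x 6 * y 5) -
      (x 6 * y 7 + x 7 * y 6) := by
  simp only [form, Matrix.toBilin'_apply, Fin.sum_univ_eight, CartanMatrix.E₈]
  simp [Matrix.of_apply]
  ring

theorem form_comm (x y : RootLattice) : form x y = form y x := by
  rw [form_apply, form_apply]
  ring

theorem even_form_self (x : RootLattice) : Even (form x x) := by
  rw [form_apply, even_iff_two_dvd]
  exact ⟨x 0 * x 0 + x 1 * x 1 + x 2 * x 2 + x 3 * x 3 + x 4 * x 4 + x 5 * x 5 + x 6 * x 6 +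
      x 7 * x 7 - x 0 * x 2 - x 1 * x 3 - x 2 * x 3 - x 3 * x 4 - x 4 * x 5 - x 5 * x 6 -
      x 6 * x 7, by ring⟩

/-- Eight mutually orthogonal roots. -/
def frame : Fin 8 → RootLattice :=
  ![![0, 0, 0, 0, 0, 0, 0, 1], ![0, 0, 0, 0, 0, 1, 0, 0], ![0, 0, 0, 1, 0, 0, 0, 0],
    ![2, 2, 4, 5, 4, 3, 2, 1], ![1, 0, 0, 0, 0, 0, 0, 0], ![1, 2, 2, 4, 4, 3, 2, 1],
    ![1, 2, 2, 3, 2, 2, 2, 1], ![1, 2, 2, 3, 2, 1, 0, 0]]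

theorem form_frame_frame (i j : Fin 8) : form (frame i) (frame j) = if i = j then 2 else 0 := by
  rw [form_apply]
  revert i j
  decide

theorem frame_mem_roots (i : Fin 8) : frame i ∈ roots := by
  change form (frame i) (frame i) = 2
  rw [form_frame_frame, if_pos rfl]

theorem two_mul_form (x y : RootLattice) :
    2 * form x y = ∑ i, form x (frame i) * form y (frame i) := by
  simp only [Fin.sum_univ_eight, form_apply, frame]
  simp
  ring

theorem two_smul_eq_sum (x : RootLattice) : (2 : ℤ) • x = ∑ i, form x (frame i) • frame i := by
  simp only [Fin.sum_univ_eight, form_apply, frame]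
  ext j
  fin_cases j <;> simp <;> ring

theorem form_self_nonneg (x : RootLattice) : 0 ≤ form x x := by
  have h := two_mul_form x x
  have : 0 ≤ ∑ i, form x (frame i) * form x (frame i) :=
    Finset.sum_nonneg fun i _ => mul_self_nonneg _
  omega

theorem eq_of_form_frame_eq {x y : RootLattice} (h : ∀ i, form x (frame i) = form y (frame i)) :
    x = y := by
  have : (2 : ℤ) • x = (2 : ℤ) • y := by
    rw [two_smul_eq_sum, two_smul_eq_sum]
    simp_rw [h]
  exact smul_right_injective _ two_ne_zero this

theorem eq_zero_of_form_self_eq_zero {x : RootLattice} (hx : form x x = 0) : x = 0 := by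
  refine eq_of_form_frame_eq fun i => ?_
  have h := two_mul_form x x
  rw [hx, mul_zero, eq_comm, Finset.sum_eq_zero_iff_of_nonneg fun i _ => mul_self_nonneg _] at h
  simpa using h i (Finset.mem_univ i)

theorem two_le_form_self {x : RootLattice} (hx : x ≠ 0) : 2 ≤ form x x := by
  obtain ⟨k, hk⟩ := even_form_self x
  have h1 := form_self_nonneg x
  have h2 : form x x ≠ 0 := fun h => hx (eq_zero_of_form_self_eq_zero h)
  omega

/-- The square lengths of `x - y` and `x + y` add up to `4 * form x x ≤ 16`, while that of `x - y =
2z` is a multiple of eight. For roots only `x = ±y` remains; for square length four there is also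
the orthogonal case. -/
theorem eq_or_eq_neg_of_sub_eq_two_smul {x y z : RootLattice} (hxy : form x x = form y y)
    (hx : form x x ≤ 4) (h : x - y = (2 : ℤ) • z) :
    x = y ∨ x = -y ∨ form x x = 4 ∧ form x y = 0 := by
  by_cases hz : z = 0
  · left
    rwa [hz, smul_zero, sub_eq_zero] at h
  right
  have h1 := two_le_form_self hz
  have h2 : form (x - y) (x - y) = 4 * form z z := by
    rw [h, map_smul, map_smul, LinearMap.smul_apply, smul_eq_mul, smul_eq_mul]
    ring
  have h3 : form (x - y) (x - y) = 2 * form x x - 2 * form x y := by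
    rw [map_sub, map_sub, LinearMap.sub_apply, LinearMap.sub_apply, form_comm y x, ← hxy]
    ring
  have h4 : form (x + y) (x + y) = 2 * form x x + 2 * form x y := by
    rw [map_add, map_add, LinearMap.add_apply, LinearMap.add_apply, form_comm y x, ← hxy]
    ring
  have h5 := form_self_nonneg (x + y)
  have h6 : form (x + y) (x + y) = 0 → x = -y := fun h =>
    eq_neg_of_add_eq_zero_left (eq_zero_of_form_self_eq_zero h)
  obtain ⟨k, hk⟩ := even_form_self x
  obtain ⟨l, hl⟩ := even_form_self z
  by_cases h7 : form x x = 4 ∧ form x y = 0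
  · exact Or.inr h7
  · exact Or.inl (h6 (by omega))

theorem reflection_apply (α : RootLattice) (hα : α ∈ roots) (x : RootLattice) :
    reflection α hα x = x - form α x • α :=
  Module.reflection_apply x hα

theorem form_reflection {α : RootLattice} (hα : α ∈ roots) (x y : RootLattice) :
    form (reflection α hα x) (reflection α hα y) = form x y := by
  have h : form α α = 2 := hα
  simp only [reflection_apply, map_sub, map_smul, LinearMap.sub_apply, LinearMap.smul_apply,
    smul_eq_mul, h, form_comm x α]
  ring

theorem form_apply_apply (g : weylGroup) (x y : RootLattice) : form (g • x) (g • y) = form x y := by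
  obtain ⟨g, hg⟩ := g
  change form (g x) (g y) = form x y
  induction hg using Subgroup.closure_induction generalizing x y with
  | mem g hg =>
    obtain ⟨α, hα, rfl⟩ := hg
    exact form_reflection hα x y
  | one => rfl
  | mul a b _ _ ha hb => exact (ha _ _).trans (hb _ _)
  | inv a _ ha =>
    have := ha (a⁻¹ x) (a⁻¹ y)
    rw [← this]
    congr 2
    · exact a.apply_symm_apply x
    · exact a.apply_symm_apply y

theorem smul_mem_roots (g : weylGroup) {x : RootLattice} (hx : x ∈ roots) : g • x ∈ roots :=
  (form_apply_apply g x x).trans hx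

/-- The reflection in a root, as an element of the Weyl group. -/
def weylReflection (α : RootLattice) (hα : α ∈ roots) : weylGroup :=
  ⟨reflection α hα, Subgroup.subset_closure ⟨α, hα, rfl⟩⟩

theorem weylReflection_smul {α : RootLattice} (hα : α ∈ roots) (x : RootLattice) :
    weylReflection α hα • x = x - form α x • α :=
  reflection_apply α hα x

theorem weyl_ext {g h : weylGroup} (H : ∀ x : RootLattice, g • x = h • x) : g = h :=
  Subtype.ext (LinearEquiv.ext H)

theorem weyl_ext_frame {g h : weylGroup} (H : ∀ i, g • frame i = h • frame i) : g = h := by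
  refine weyl_ext fun x => smul_right_injective _ (two_ne_zero (α := ℤ)) ?_
  change (2 : ℤ) • g • x = (2 : ℤ) • h • x
  rw [← smul_comm g, ← smul_comm h, two_smul_eq_sum, Finset.smul_sum, Finset.smul_sum]
  refine Finset.sum_congr rfl fun i _ => ?_
  rw [smul_comm g, smul_comm h, H]

theorem form_smul_left (g : weylGroup) (x y : RootLattice) : form (g • x) y = form x (g⁻¹ • y) := by
  rw [← form_apply_apply g x, smul_inv_smul]

theorem finite_roots : roots.Finite := by
  have h : Set.Finite {c : Fin 8 → ℤ | ∀ i, c i ∈ Set.Icc (-2) 2} :=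
    Set.Finite.pi' fun _ => Set.finite_Icc _ _
  refine Set.Finite.of_finite_image (f := fun x i => form x (frame i)) (h.subset ?_)
    (fun x _ y _ hxy => eq_of_form_frame_eq (congrFun hxy))
  rintro _ ⟨x, hx, rfl⟩ i
  have h1 := two_mul_form x x
  rw [show form x x = 2 from hx] at h1
  have h2 : form x (frame i) * form x (frame i) ≤ _ :=
    Finset.single_le_sum (f := fun i => form x (frame i) * form x (frame i))
      (fun i _ => mul_self_nonneg _) (Finset.mem_univ i)
  exact ⟨by nlinarith, by nlinarith⟩

instance : Finite weylGroup := by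
  have := finite_roots.to_subtype
  refine Finite.of_injective
    (fun (g : weylGroup) (i : Fin 8) => (⟨g • frame i, smul_mem_roots g (frame_mem_roots i)⟩ : roots))
    fun g h hgh => weyl_ext_frame fun i => congrArg Subtype.val (congrFun hgh i)

end EEight

end

/-! ### Subgroups that fix a nonzero vector -/

section

open Module

namespace EEight

open scoped TensorProduct

theorem one_tmul_injective :
    Function.Injective (fun x : RootLattice => (1 : ℚ) ⊗ₜ[ℤ] x) := by
  have h := Module.Flat.rTensor_preserves_injective_linearMap (M := RootLattice)
    (Algebra.linearMap ℤ ℚ) (algebraMap ℤ ℚ).injective_int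
  intro x y hxy
  have h1 : (1 : ℤ) ⊗ₜ[ℤ] x = (1 : ℤ) ⊗ₜ[ℤ] y := by
    refine h ?_
    simpa using hxy
  simpa using congrArg (TensorProduct.lid ℤ RootLattice) h1

theorem exists_nsmul_eq_one_tmul (v : ℚ ⊗[ℤ] RootLattice) :
    ∃ n : ℕ, n ≠ 0 ∧ ∃ x : RootLattice, n • v = (1 : ℚ) ⊗ₜ[ℤ] x := by
  induction v using TensorProduct.induction_on with
  | zero => exact ⟨1, one_ne_zero, 0, by simp⟩
  | tmul q x =>
    refine ⟨q.den, q.den_nz, q.num • x, ?_⟩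
    rw [TensorProduct.tmul_smul, TensorProduct.smul_tmul', TensorProduct.smul_tmul', nsmul_eq_mul,
      Rat.den_mul_eq_num, zsmul_one]
  | add v w hv hw =>
    obtain ⟨m, hm, x, hx⟩ := hv
    obtain ⟨n, hn, y, hy⟩ := hw
    refine ⟨m * n, mul_ne_zero hm hn, n • x + m • y, ?_⟩
    rw [smul_add, TensorProduct.tmul_add, mul_comm, mul_smul, hx, mul_comm, mul_smul, hy,
      TensorProduct.tmul_smul, TensorProduct.tmul_smul]

variable {A : Type*} [CommGroup A]

/-- The rational representation attached to an action on the root lattice. -/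
noncomputable def rationalRep (φ : A →* weylGroup) : Representation ℚ A (ℚ ⊗[ℤ] RootLattice) :=
  ((Module.End.baseChangeHom ℤ ℚ RootLattice : Module.End ℤ RootLattice →* _).comp
    (DistribMulAction.toModuleEnd ℤ RootLattice)).comp φ

theorem rationalRep_tmul (φ : A →* weylGroup) (a : A) (q : ℚ) (x : RootLattice) :
    rationalRep φ a (q ⊗ₜ x) = q ⊗ₜ (φ a • x) := rfl

theorem finrank_rational : finrank ℚ (ℚ ⊗[ℤ] RootLattice) = 8 := by
  rw [Module.finrank_baseChange, Module.finrank_fintype_fun_eq_card, Fintype.card_fin]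

theorem one_tmul_mem_fixedSubmodule {φ : A →* weylGroup} {H : Subgroup A} {x : RootLattice} :
    (1 : ℚ) ⊗ₜ x ∈ (rationalRep φ).fixedSubmodule H ↔ ∀ h ∈ H, φ h • x = x := by
  rw [Representation.mem_fixedSubmodule]
  exact forall₂_congr fun h _ => one_tmul_injective.eq_iff

/-- The simple roots. -/
def simpleRoot (i : Fin 8) : RootLattice := Pi.single i 1

theorem simpleRoot_mem_roots (i : Fin 8) : simpleRoot i ∈ roots := by
  change form (simpleRoot i) (simpleRoot i) = 2
  rw [form_apply]
  revert i
  decide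

theorem eq_sum_smul_simpleRoot (x : RootLattice) : x = ∑ i, x i • simpleRoot i := by
  ext j
  simp [simpleRoot, Pi.single_apply]

theorem exists_form_simpleRoot_ne_zero {x : RootLattice} (hx : x ≠ 0) :
    ∃ i, form x (simpleRoot i) ≠ 0 := by
  by_contra! h
  refine hx (eq_zero_of_form_self_eq_zero ?_)
  have h1 : ∀ y, form x y = 0 := fun y => by
    rw [eq_sum_smul_simpleRoot y, map_sum]
    exact Finset.sum_eq_zero fun i _ => by rw [map_smul, h, smul_zero]
  exact h1 x

/-- The Dynkin diagram is connected. -/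
theorem forall_of_adjacent {P : Fin 8 → Prop} {i : Fin 8} (hi : P i)
    (h : ∀ i j, P i → form (simpleRoot i) (simpleRoot j) ≠ 0 → P j) (j : Fin 8) : P j := by
  have key : ∀ i j : Fin 8, form (simpleRoot i) (simpleRoot j) ≠ 0 → (P i ↔ P j) := fun i j hij =>
    ⟨fun hi => h i j hi hij, fun hj => h j i hj (by rwa [form_comm])⟩
  have h02 := key 0 2 (by rw [form_apply]; decide)
  have h13 := key 1 3 (by rw [form_apply]; decide)
  have h23 := key 2 3 (by rw [form_apply]; decide)
  have h34 := key 3 4 (by rw [form_apply]; decide)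
  have h45 := key 4 5 (by rw [form_apply]; decide)
  have h56 := key 5 6 (by rw [form_apply]; decide)
  have h67 := key 6 7 (by rw [form_apply]; decide)
  have to3 : ∀ i, P i ↔ P 3 := by
    intro i
    fin_cases i
    exacts [h02.trans h23, h13, h23, Iff.rfl, h34.symm, h45.symm.trans h34.symm,
      h56.symm.trans (h45.symm.trans h34.symm),
      h67.symm.trans (h56.symm.trans (h45.symm.trans h34.symm))]
  exact (to3 j).2 ((to3 i).1 hi)

/-- The orbit of `β` lies in a translate of `D` and injects into `D / 2D`: roots congruent modulo
`2L` agree up to sign, and the sign is detected by the invariant vector `z`. Hence the index of the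
stabilizer is at most `2 ^ rank D`. -/
theorem card_orbit_le {φ : A →* weylGroup} {H : Subgroup A} {z β : RootLattice} (hβ : β ∈ roots)
    (hz : ∀ h ∈ H, φ h • z = z) (hzβ : form z β ≠ 0) {D : Submodule ℤ RootLattice}
    (hD : ∀ h ∈ H, β - φ h • β ∈ D) {H' : Subgroup A}
    (hH' : ∀ h, h ∈ H' ↔ h ∈ H ∧ φ h • β = β) :
    Nat.card H ≤ 2 ^ finrank ℤ D * Nat.card H' := by
  have hle : H' ≤ H := fun h hh => ((hH' h).1 hh).1
  let b := Module.finBasis ℤ D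
  let q : H → Fin (finrank ℤ D) → ZMod 2 := fun h i => (b.repr ⟨β - φ h • β, hD h h.2⟩ i : ℤ)
  have hq : ∀ h h' : H, q h = q h' → φ h • β = φ h' • β := by
    intro h h' hh
    have h1 : ∀ i, ∃ c : ℤ, b.repr ⟨β - φ h • β, hD h h.2⟩ i -
        b.repr ⟨β - φ h' • β, hD h' h'.2⟩ i = 2 * c := by
      intro i
      have h2 := congrFun hh i
      have h3 := (ZMod.intCast_eq_intCast_iff_dvd_sub _ _ 2).1 h2.symm
      exact h3
    choose c hc using h1
    have h2 : (⟨β - φ h • β, hD h h.2⟩ : D) - ⟨β - φ h' • β, hD h' h'.2⟩ =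
        (2 : ℤ) • ∑ i, c i • b i := by
      refine b.repr.injective (Finsupp.ext fun i => ?_)
      simp [hc, Finsupp.single_apply]
    have h3 : φ h' • β - φ h • β = (2 : ℤ) • ((∑ i, c i • b i : D) : RootLattice) := by
      have := congrArg Subtype.val h2
      simp only [Submodule.coe_sub, Submodule.coe_smul] at this
      rw [← this]
      abel
    have hn : ∀ h : H, form (φ h • β) (φ h • β) = 2 := fun h => smul_mem_roots (φ h) hβ
    have hzh : ∀ h : H, form z (φ h • β) = form z β := by
      intro h
      conv_lhs => rw [← hz h h.2]
      exact form_apply_apply _ _ _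
    rcases eq_or_eq_neg_of_sub_eq_two_smul ((hn h').trans (hn h).symm)
      (by rw [hn]; norm_num) h3 with h4 | h4 | h4
    · exact h4.symm
    -- All images of `β` have the same nonzero product with `z`, so opposite images cannot occur.
    · exfalso
      have h5 := hzh h'
      rw [h4, map_neg, hzh] at h5
      omega
    · have := hn h'
      omega
  rw [← (H'.subgroupOf H).card_mul_index, mul_comm, Subgroup.index,
    ← Subgroup.card_map_of_injective H.subtype_injective, Subgroup.map_subgroupOf_eq_of_le hle]
  refine Nat.mul_le_mul_right _ ?_
  have hcard : Nat.card (Fin (finrank ℤ D) → ZMod 2) = 2 ^ finrank ℤ D := by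
    simp
  rw [← hcard]
  refine Nat.card_le_card_of_injective (fun c : H ⧸ H'.subgroupOf H => q c.out) ?_
  intro c c' hcc
  have h1 := hq _ _ hcc
  rw [← QuotientGroup.out_eq' c, ← QuotientGroup.out_eq' c', QuotientGroup.eq,
    Subgroup.mem_subgroupOf, hH']
  refine ⟨Subtype.property _, ?_⟩
  rw [Subgroup.coe_mul, Subgroup.coe_inv, map_mul, mul_smul, ← h1, map_inv, inv_smul_smul]

/-- If each simple root not orthogonal to a fixed vector were fixed, it would be a fixed vector
itself, and so on to its neighbours. The diagram being connected, the group would act trivially. -/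
theorem exists_simpleRoot_moved {φ : A →* weylGroup} {H : Subgroup A}
    (hfix : (rationalRep φ).fixedSubmodule H ≠ ⊥) (hmv : ∃ h ∈ H, φ h ≠ 1) :
    ∃ z i, (∀ h ∈ H, φ h • z = z) ∧ form z (simpleRoot i) ≠ 0 ∧
      ∃ h ∈ H, φ h • simpleRoot i ≠ simpleRoot i := by
  by_contra! hcon
  obtain ⟨v, hv, hv0⟩ := (Submodule.ne_bot_iff _).1 hfix
  obtain ⟨n, hn, x, hx⟩ := exists_nsmul_eq_one_tmul v
  -- Clearing denominators turns a fixed rational vector into a fixed lattice vector.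
  have hxf : ∀ h ∈ H, φ h • x = x := by
    rw [← one_tmul_mem_fixedSubmodule, ← hx]
    exact nsmul_mem hv n
  have hx0 : x ≠ 0 := by
    rintro rfl
    have : IsAddTorsionFree (ℚ ⊗[ℤ] RootLattice) := .of_module_rat _
    rw [TensorProduct.tmul_zero] at hx
    exact hv0 ((smul_eq_zero_iff_right hn).1 hx)
  obtain ⟨i, hi⟩ := exists_form_simpleRoot_ne_zero hx0
  have hall := forall_of_adjacent (P := fun i => ∀ h ∈ H, φ h • simpleRoot i = simpleRoot i)
    (hcon x i hxf hi) (fun i j hi hij => hcon _ j hi hij)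
  obtain ⟨h, hh, hne⟩ := hmv
  refine hne (weyl_ext fun y => ?_)
  rw [one_smul]
  conv_lhs => rw [eq_sum_smul_simpleRoot y]
  conv_rhs => rw [eq_sum_smul_simpleRoot y]
  rw [Finset.smul_sum]
  exact Finset.sum_congr rfl fun i _ => by rw [smul_comm, hall i h hh]

variable [Finite A]

/-- The differences `β - φ h • β` have average zero over `H`, so their span meets the fixed space of
`H` trivially; this gives the sum of dimensions. -/
theorem finrank_add_finrank_le {φ : A →* weylGroup} {H H' : Subgroup A} {β : RootLattice}
    (hH' : ∀ h, h ∈ H' ↔ h ∈ H ∧ φ h • β = β) :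
    finrank ℚ ((rationalRep φ).fixedSubmodule H) +
        finrank ℤ (Submodule.span ℤ {x | ∃ h ∈ H, x = β - φ h • β}) ≤
      finrank ℚ ((rationalRep φ).fixedSubmodule H') := by
  set D := Submodule.span ℤ {x | ∃ h ∈ H, x = β - φ h • β}
  let f : ℚ ⊗[ℤ] D →ₗ[ℚ] ℚ ⊗[ℤ] RootLattice := LinearMap.baseChange ℚ D.subtype
  have hf : Function.Injective f :=
    Module.Flat.lTensor_preserves_injective_linearMap (M := ℚ) D.subtype D.subtype_injective
  have hrange : ∀ S : Submodule ℚ (ℚ ⊗[ℤ] RootLattice),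
      (∀ h ∈ H, (1 : ℚ) ⊗ₜ (β - φ h • β) ∈ S) → LinearMap.range f ≤ S := by
    rintro S hS _ ⟨v, rfl⟩
    induction v using TensorProduct.induction_on with
    | zero => rw [map_zero]; exact S.zero_mem
    | add v w hv hw => rw [map_add]; exact S.add_mem hv hw
    | tmul q x =>
      have hx : ∀ x ∈ D, (1 : ℚ) ⊗ₜ x ∈ S := by
        intro x hx
        induction hx using Submodule.span_induction with
        | mem x hx => obtain ⟨h, hh, rfl⟩ := hx; exact hS h hh
        | zero => rw [TensorProduct.tmul_zero]; exact S.zero_mem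
        | add x y _ _ hx hy => rw [TensorProduct.tmul_add]; exact S.add_mem hx hy
        | smul c x _ hx =>
          rw [TensorProduct.tmul_smul, ← Int.cast_smul_eq_zsmul ℚ]
          exact S.smul_mem _ hx
      have : f (q ⊗ₜ x) = q • ((1 : ℚ) ⊗ₜ[ℤ] (x : RootLattice)) := by
        rw [TensorProduct.smul_tmul', smul_eq_mul, mul_one]
        rfl
      rw [this]
      exact S.smul_mem _ (hx x x.2)
  have h1 : finrank ℤ D = finrank ℚ (LinearMap.range f) := by
    rw [LinearMap.finrank_range_of_inj hf, Module.finrank_baseChange]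
  have h2 : Disjoint ((rationalRep φ).fixedSubmodule H) (LinearMap.range f) := by
    refine ((rationalRep φ).disjoint_fixedSubmodule_averageKer H).mono_right (hrange _ ?_)
    intro h hh
    rw [TensorProduct.tmul_sub, ← rationalRep_tmul]
    exact (rationalRep φ).sub_apply_mem_averageKer hh _
  rw [h1, ← Submodule.finrank_sup_add_finrank_inf_eq, h2.eq_bot, finrank_bot, add_zero]
  refine Submodule.finrank_mono (sup_le
    ((rationalRep φ).fixedSubmodule_anti fun h hh => ((hH' h).1 hh).1) (hrange _ fun h _ => ?_))
  rw [one_tmul_mem_fixedSubmodule]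
  intro k hk
  have hk' := ((hH' k).1 hk).2
  -- By commutativity the stabilizer of `β` in `H` fixes every image of `β` as well.
  rw [smul_sub, hk', ← mul_smul, ← map_mul, mul_comm, map_mul, mul_smul, hk']

/-- Induction on the order: on passing to the stabilizer of a moved simple root, the order drops by
at most `2 ^ r` and the fixed space grows by at least `r`. The descent ends with the trivial group,
where the value is at most `2 ^ 8`. -/
theorem card_mul_two_pow_le {φ : A →* weylGroup} (hφ : Function.Injective φ) (H : Subgroup A)
    (hfix : (rationalRep φ).fixedSubmodule H ≠ ⊥) :
    Nat.card H * 2 ^ finrank ℚ ((rationalRep φ).fixedSubmodule H) ≤ 256 := by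
  induction hn : Nat.card H using Nat.strong_induction_on generalizing H with
  | _ n ih =>
    subst hn
    by_cases hmv : ∃ h ∈ H, φ h ≠ 1
    · obtain ⟨z, i, hz, hzi, h₀, hh₀, hne⟩ := exists_simpleRoot_moved hfix hmv
      let H' : Subgroup A := H ⊓ (MulAction.stabilizer weylGroup (simpleRoot i)).comap φ
      have hH' : ∀ h, h ∈ H' ↔ h ∈ H ∧ φ h • simpleRoot i = simpleRoot i := fun h => Iff.rfl
      have h1 := card_orbit_le (simpleRoot_mem_roots i) hz hzi
        (D := Submodule.span ℤ {x | ∃ h ∈ H, x = simpleRoot i - φ h • simpleRoot i})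
        (fun h hh => Submodule.subset_span ⟨h, hh, rfl⟩) hH'
      have h2 := finrank_add_finrank_le hH'
      have hlt : H' < H := lt_of_le_of_ne inf_le_left fun h => hne ((hH' h₀).1 (h ▸ hh₀)).2
      have hfix' : (rationalRep φ).fixedSubmodule H' ≠ ⊥ := fun h => hfix
        (le_bot_iff.1 (h ▸ (rationalRep φ).fixedSubmodule_anti hlt.le))
      have h3 := ih _ (Set.Finite.card_lt_card (Set.toFinite _) hlt) H' hfix' rfl
      calc _ ≤ _ := Nat.mul_le_mul_right _ h1
        _ = Nat.card H' * 2 ^ (finrank ℚ ((rationalRep φ).fixedSubmodule H) + finrank ℤ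
            (Submodule.span ℤ {x | ∃ h ∈ H, x = simpleRoot i - φ h • simpleRoot i})) := by
          rw [pow_add]
          ring
        _ ≤ _ := Nat.mul_le_mul_left _ (Nat.pow_le_pow_right (by norm_num) h2)
        _ ≤ 256 := h3
    · push Not at hmv
      have h1 : Nat.card H = 1 := by
        rw [Subgroup.card_eq_one, Subgroup.eq_bot_iff_forall]
        exact fun h hh => hφ ((hmv h hh).trans (map_one φ).symm)
      have h2 : finrank ℚ ((rationalRep φ).fixedSubmodule H) ≤ 8 :=
        (Submodule.finrank_le _).trans finrank_rational.le
      rw [h1, one_mul]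
      exact (Nat.pow_le_pow_right (by norm_num) h2).trans (by norm_num)

/-- An abelian group of automorphisms of the lattice in the Weyl group that contains `-1` has
order at most `256`. -/
theorem card_le_of_commGroup {φ : A →* weylGroup} (hφ : Function.Injective φ) {z : A}
    (hz : ∀ x : RootLattice, φ z • x = -x) : Nat.card A ≤ 256 := by
  refine (rationalRep φ).card_le_of_card_mul_two_pow_le finrank_rational (fun a ha => ?_)
    (card_mul_two_pow_le hφ) (z := z) fun v => ?_
  · refine hφ (weyl_ext fun x => one_tmul_injective ?_)
    rw [map_one, one_smul]
    exact ha (1 ⊗ₜ x)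
  · induction v using TensorProduct.induction_on with
    | zero => rw [map_zero, neg_zero]
    | add v w hv hw => rw [map_add, hv, hw, neg_add]
    | tmul q x => rw [rationalRep_tmul, hz, TensorProduct.tmul_neg]

end EEight

end

/-! ### The elementary abelian group of sign changes of the frame, and the maximal order 256 -/

namespace EEight

theorem frame_ne_neg (i : Fin 8) : frame i ≠ -frame i := by
  intro h
  have h1 := form_frame_frame i i
  rw [if_pos rfl] at h1
  have h2 := congrArg (form (frame i)) h
  rw [map_neg] at h2
  omega

/-- The elements of the Weyl group that preserve each of the eight lines of the frame. -/
def frameSubgroup : Subgroup weylGroup where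
  carrier := {w | ∀ i, w • frame i = frame i ∨ w • frame i = -frame i}
  one_mem' _ := Or.inl (one_smul _ _)
  mul_mem' {a b} ha hb i := by
    rw [mul_smul]
    rcases hb i with h | h <;> rcases ha i with h' | h' <;> simp [h, h', smul_neg]
  inv_mem' {a} ha i := by
    rcases ha i with h | h
    · exact Or.inl (inv_smul_eq_iff.2 h.symm)
    · exact Or.inr (inv_smul_eq_iff.2 (by rw [smul_neg, h, neg_neg]))

/-- The reflections in the roots of the frame. -/
def frameReflection (i : Fin 8) : weylGroup := weylReflection (frame i) (frame_mem_roots i)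

theorem frameReflection_smul_frame (i j : Fin 8) :
    frameReflection i • frame j = if i = j then -frame j else frame j := by
  rw [frameReflection, weylReflection_smul, form_frame_frame]
  split_ifs with h
  · rw [h, two_smul]
    abel
  · rw [zero_smul, sub_zero]

theorem exists_mem_closure_smul_frame (s : Finset (Fin 8)) :
    ∃ w ∈ Subgroup.closure (Set.range frameReflection),
      ∀ i, w • frame i = if i ∈ s then -frame i else frame i := by
  induction s using Finset.induction_on with
  | empty => exact ⟨1, one_mem _, fun i => by simp⟩
  | insert a s ha ih =>
    obtain ⟨w, hw, h⟩ := ih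
    refine ⟨frameReflection a * w, mul_mem (Subgroup.subset_closure ⟨a, rfl⟩) hw, fun i => ?_⟩
    rw [mul_smul, h]
    by_cases hi : i = a
    · subst hi
      simp [ha, frameReflection_smul_frame]
    · by_cases his : i ∈ s <;> simp [his, hi, frameReflection_smul_frame, Ne.symm hi]

theorem frameReflection_mem (i : Fin 8) : frameReflection i ∈ frameSubgroup := by
  intro j
  rw [frameReflection_smul_frame]
  split_ifs <;> simp

theorem closure_range_frameReflection :
    Subgroup.closure (Set.range frameReflection) = frameSubgroup := by
  classical
  refine le_antisymm ((Subgroup.closure_le _).2 ?_) fun w hw => ?_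
  · rintro _ ⟨i, rfl⟩
    exact frameReflection_mem i
  · obtain ⟨w', hw', h⟩ := exists_mem_closure_smul_frame
      (Finset.univ.filter fun i => w • frame i = -frame i)
    have : w = w' := weyl_ext_frame fun i => by
      rw [h]
      rcases hw i with hi | hi
      · rw [if_neg, hi]
        simp [hi, frame_ne_neg]
      · rw [if_pos, hi]
        simp [hi]
    rwa [this]

/-- The signs by which an element of `frameSubgroup` acts on the frame. -/
noncomputable def frameSign : frameSubgroup →* (Fin 8 → Multiplicative (ZMod 2)) := by
  classical
  exact
  { toFun := fun w i => if w.1 • frame i = frame i then 1 else Multiplicative.ofAdd 1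
    map_one' := by
      ext i
      simp
    map_mul' := by
      rintro ⟨a, ha⟩ ⟨b, hb⟩
      funext i
      change (if (a * b) • frame i = frame i then (1 : Multiplicative (ZMod 2)) else _) =
        (if a • frame i = frame i then 1 else _) * if b • frame i = frame i then 1 else _
      have hne := (frame_ne_neg i).symm
      rcases ha i with h | h <;> rcases hb i with h' | h' <;>
        simp only [mul_smul, h, h', smul_neg, neg_neg, if_true, if_neg hne, one_mul, mul_one]
      rfl }

theorem frameSign_apply_eq_one {w : frameSubgroup} {i : Fin 8} :
    frameSign w i = 1 ↔ w.1 • frame i = frame i := by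
  classical
  change (if w.1 • frame i = frame i then (1 : Multiplicative (ZMod 2)) else _) = 1 ↔ _
  refine ite_eq_left_iff.trans ⟨fun h => ?_, fun h h' => absurd h h'⟩
  by_contra h'
  exact absurd (h h') (by decide)

theorem frameSign_bijective : Function.Bijective frameSign := by
  constructor
  · rw [injective_iff_map_eq_one]
    exact fun w hw => Subtype.ext (weyl_ext_frame fun i =>
      (frameSign_apply_eq_one.1 (congrFun hw i)).trans (one_smul _ _).symm)
  · intro ε
    obtain ⟨w, hw, h⟩ := exists_mem_closure_smul_frame (Finset.univ.filter fun i => ε i ≠ 1)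
    rw [closure_range_frameReflection] at hw
    refine ⟨⟨w, hw⟩, funext fun i => ?_⟩
    have key : ∀ a b : Multiplicative (ZMod 2), (a = 1 ↔ b = 1) → a = b := by decide
    refine key _ _ ?_
    rw [frameSign_apply_eq_one]
    change w • frame i = frame i ↔ _
    rw [h]
    by_cases hi : ε i = 1
    · simp [hi]
    · simp [hi, (frame_ne_neg i).symm]

theorem card_frameSubgroup : Nat.card frameSubgroup = 256 := by
  rw [Nat.card_congr (Equiv.ofBijective _ frameSign_bijective), Nat.card_eq_fintype_card,
    Fintype.card_fun]
  rfl

theorem isMulCommutative_frameSubgroup : IsMulCommutative frameSubgroup :=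
  ⟨⟨fun a b => frameSign_bijective.1 (by rw [map_mul, map_mul, mul_comm])⟩⟩

theorem exists_smul_eq_neg : ∃ z : weylGroup, ∀ x : RootLattice, z • x = -x := by
  obtain ⟨z, -, hz⟩ := exists_mem_closure_smul_frame Finset.univ
  refine ⟨z, fun x => smul_right_injective _ (two_ne_zero (α := ℤ)) ?_⟩
  change (2 : ℤ) • z • x = (2 : ℤ) • (-x)
  rw [smul_neg, ← smul_comm z, two_smul_eq_sum, Finset.smul_sum, ← Finset.sum_neg_distrib]
  refine Finset.sum_congr rfl fun i _ => ?_
  rw [smul_comm z, hz, if_pos (Finset.mem_univ i), smul_neg]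

theorem card_le_of_isMulCommutative (M : Subgroup weylGroup) (hM : IsMulCommutative M)
    {z : weylGroup} (hzM : z ∈ M) (hz : ∀ x : RootLattice, z • x = -x) : Nat.card M ≤ 256 := by
  let _ : CommGroup M := { (inferInstance : Group M) with mul_comm := hM.is_comm.comm }
  exact card_le_of_commGroup (φ := M.subtype) M.subtype_injective (z := ⟨z, hzM⟩) hz

/-- The bound is only known for groups containing `-1`, but adjoining this central element keeps the
group abelian. -/
theorem card_eq_of_isMaximalOrderAbelian {M : Subgroup weylGroup} (hM : IsMaximalOrderAbelian M) :
    Nat.card M = 256 := by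
  obtain ⟨hMc, hmax⟩ := hM
  refine le_antisymm ?_
    (card_frameSubgroup ▸ hmax frameSubgroup isMulCommutative_frameSubgroup)
  obtain ⟨z, hz⟩ := exists_smul_eq_neg
  have hzc : ∀ w : weylGroup, z * w = w * z := fun w => weyl_ext fun x => by
    rw [mul_smul, mul_smul, hz, hz, smul_neg]
  have hzz : z * z = 1 := weyl_ext fun x => by rw [mul_smul, hz, hz, neg_neg, one_smul]
  have hMM : ∀ a b, a ∈ M → b ∈ M → a * b = b * a := fun a b ha hb =>
    congrArg Subtype.val (hMc.is_comm.comm (⟨a, ha⟩ : M) ⟨b, hb⟩)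
  have hzl : ∀ a b, a * (z * b) = z * (a * b) := fun a b => by
    rw [← mul_assoc, ← hzc, mul_assoc]
  have hzzl : ∀ a, z * (z * a) = a := fun a => by rw [← mul_assoc, hzz, one_mul]
  let M' : Subgroup weylGroup :=
    { carrier := {w | w ∈ M ∨ z * w ∈ M}
      one_mem' := Or.inl M.one_mem
      mul_mem' := by
        rintro a b (ha | ha) (hb | hb)
        · exact Or.inl (mul_mem ha hb)
        · exact Or.inr (by rw [← hzl]; exact mul_mem ha hb)
        · exact Or.inr (by rw [← mul_assoc]; exact mul_mem ha hb)
        · refine Or.inl ?_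
          have := mul_mem ha hb
          rwa [hzl, mul_assoc, hzzl] at this
      inv_mem' := by
        rintro a (ha | ha)
        · exact Or.inl (inv_mem ha)
        · refine Or.inr ?_
          have := inv_mem ha
          rwa [mul_inv_rev, inv_eq_of_mul_eq_one_right hzz, ← hzc] at this }
  have hM' : IsMulCommutative M' := by
    refine ⟨⟨?_⟩⟩
    rintro ⟨a, ha⟩ ⟨b, hb⟩
    refine Subtype.ext ?_
    change a * b = b * a
    have key : ∀ a b, a ∈ M → z * b ∈ M → a * b = b * a := by
      intro a b ha hb
      have := hMM _ _ ha hb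
      rw [hzl, mul_assoc] at this
      exact mul_left_cancel this
    rcases ha with ha | ha <;> rcases hb with hb | hb
    · exact hMM a b ha hb
    · exact key a b ha hb
    · exact (key b a hb ha).symm
    · have := hMM _ _ ha hb
      rw [mul_assoc, mul_assoc, hzl, hzzl, hzl, hzzl] at this
      exact this
  have h1 := card_le_of_isMulCommutative M' hM' (z := z)
    (Or.inr (by rw [hzz]; exact M.one_mem)) hz
  exact (Subgroup.card_le_of_le fun w hw => Or.inl hw).trans h1

end EEight

/-! ### The roots in frame coordinates and the extended Hamming code -/

namespace EEight

/-- The labels of the roots of the frame: the vectors of the space over the field with two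
elements, in binary notation. -/
def label (i : Fin 8) : Fin 3 → ZMod 2 :=
  ![(i.val : ZMod 2), ((i.val / 2 : ℕ) : ZMod 2), ((i.val / 4 : ℕ) : ZMod 2)]

/-- The points of the frame on a line of the extended Fano plane. -/
def OnLine (i : Fin 8) : ExtendedFanoLine → Prop
  | Sum.inl l => l.1 ⬝ᵥ label i = 0
  | Sum.inr l => l.1 ⬝ᵥ label i ≠ 0

instance (i : Fin 8) : DecidablePred (OnLine i)
  | Sum.inl l => inferInstanceAs (Decidable (l.1 ⬝ᵥ label i = 0))
  | Sum.inr l => inferInstanceAs (Decidable (l.1 ⬝ᵥ label i ≠ 0))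

/-- Half of the sum of the roots of the frame on a line. -/
def lineRoot (ℓ : ExtendedFanoLine) : RootLattice :=
  fun k => (∑ i, if OnLine i ℓ then frame i k else 0) / 2

/-- This confirms that the division by two in `lineRoot` is exact, which depends on the numbering of
the frame. -/
theorem form_lineRoot (ℓ : ExtendedFanoLine) (i : Fin 8) :
    form (lineRoot ℓ) (frame i) = if OnLine i ℓ then 1 else 0 := by
  rw [form_apply]
  revert ℓ i
  decide +kernel

theorem lineRoot_mem_roots (ℓ : ExtendedFanoLine) : lineRoot ℓ ∈ roots := by
  have h := two_mul_form (lineRoot ℓ) (lineRoot ℓ)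
  simp only [form_lineRoot] at h
  have key : ∀ ℓ : ExtendedFanoLine, (∑ i : Fin 8, (if OnLine i ℓ then (1 : ℤ) else 0) *
      if OnLine i ℓ then 1 else 0) = 4 := by decide +kernel
  rw [key] at h
  change form _ _ = 2
  omega

/-- The sum is twice the product with `lineRoot ℓ`: the coordinates modulo two are orthogonal to the
code spanned by the lines. -/
theorem even_sum_form (x : RootLattice) (ℓ : ExtendedFanoLine) :
    Even (∑ i, if OnLine i ℓ then form x (frame i) else 0) := by
  have h := two_mul_form x (lineRoot ℓ)
  simp only [form_lineRoot, mul_ite, mul_one, mul_zero] at h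
  rw [← h]
  exact even_two_mul _

/-- The representatives of the orbits of the sign changes on the roots. -/
def shapeRoot : Fin 8 ⊕ ExtendedFanoLine → RootLattice
  | Sum.inl i => frame i
  | Sum.inr ℓ => lineRoot ℓ

/-- The coordinates of the representatives. -/
def shapeCoord : Fin 8 ⊕ ExtendedFanoLine → Fin 8 → ℕ
  | Sum.inl i, j => if i = j then 2 else 0
  | Sum.inr ℓ, j => if OnLine j ℓ then 1 else 0

theorem form_shapeRoot (s : Fin 8 ⊕ ExtendedFanoLine) (i : Fin 8) :
    form (shapeRoot s) (frame i) = shapeCoord s i := by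
  rcases s with j | ℓ
  · rw [shapeRoot, form_frame_frame, shapeCoord]
    split_ifs <;> rfl
  · rw [shapeRoot, form_lineRoot, shapeCoord]
    split_ifs <;> rfl

theorem shapeRoot_mem_roots (s : Fin 8 ⊕ ExtendedFanoLine) : shapeRoot s ∈ roots := by
  rcases s with j | ℓ
  · exact frame_mem_roots j
  · exact lineRoot_mem_roots ℓ

/-- Four as a sum of squares is one `2` or four `1`s. In the second case, the parity conditions say
that the support is orthogonal to the Hamming code, and self-duality makes it a line. The cases are
finite in number and are checked. -/
theorem exists_shape_of_sum_sq (n : Fin 8 → Fin 3) (h : ∑ i, (n i).val * (n i).val = 4)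
    (hc : ∀ l : FanoLine, (∑ i, if OnLine i (Sum.inl l) then (n i).val else 0) % 2 = 0) :
    ∃ s, ∀ i, (n i).val = shapeCoord s i := by
  have key : ∀ a b c d e f g h : Fin 3, a.val * a.val + b.val * b.val + c.val * c.val +
      d.val * d.val + e.val * e.val + f.val * f.val + g.val * g.val + h.val * h.val = 4 →
      (∀ l : FanoLine,
        (∑ i, if OnLine i (Sum.inl l) then (![a, b, c, d, e, f, g, h] i).val else 0) % 2 = 0) →
      ∃ s, ∀ i, (![a, b, c, d, e, f, g, h] i).val = shapeCoord s i := by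
    decide +kernel
  have hn : ![n 0, n 1, n 2, n 3, n 4, n 5, n 6, n 7] = n := by
    ext i
    fin_cases i <;> rfl
  have := key (n 0) (n 1) (n 2) (n 3) (n 4) (n 5) (n 6) (n 7)
  rw [hn] at this
  exact this (by rw [← h, Fin.sum_univ_eight]) hc

/-- A root has the coordinates of one of the representatives, up to signs. -/
theorem exists_natAbs_form_eq {α : RootLattice} (hα : α ∈ roots) :
    ∃ s, ∀ i, (form α (frame i)).natAbs = shapeCoord s i := by
  have h1 := two_mul_form α α
  rw [show form α α = 2 from hα] at h1
  have h2 : ∑ i, (form α (frame i)).natAbs * (form α (frame i)).natAbs = 4 := by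
    zify
    simp only [abs_mul_abs_self]
    omega
  have h3 : ∀ i, (form α (frame i)).natAbs < 3 := by
    intro i
    have h4 : (form α (frame i)).natAbs * (form α (frame i)).natAbs ≤ _ :=
      Finset.single_le_sum (f := fun i => (form α (frame i)).natAbs * (form α (frame i)).natAbs)
        (fun i _ => Nat.zero_le _) (Finset.mem_univ i)
    by_contra! h5
    have := Nat.mul_le_mul h5 h5
    omega
  refine exists_shape_of_sum_sq (fun i => ⟨(form α (frame i)).natAbs, h3 i⟩) h2 fun l => ?_
  have h6 := even_sum_form α (Sum.inl l)
  rw [← Nat.even_iff, ← Int.even_coe_nat]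
  push_cast
  refine (Int.even_sub.1 ?_).2 h6
  rw [← Finset.sum_sub_distrib]
  refine Finset.even_sum _ fun i _ => ?_
  split_ifs
  · exact Int.even_sub.2 even_abs
  · exact ⟨0, rfl⟩

theorem exists_smul_shapeRoot {α : RootLattice} {s : Fin 8 ⊕ ExtendedFanoLine}
    (h : ∀ i, (form α (frame i)).natAbs = shapeCoord s i) :
    ∃ w ∈ frameSubgroup, w • shapeRoot s = α := by
  obtain ⟨w, hw, hws⟩ := exists_mem_closure_smul_frame
    (Finset.univ.filter fun i => form α (frame i) < 0)
  rw [closure_range_frameReflection] at hw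
  refine ⟨w⁻¹, inv_mem hw, eq_of_form_frame_eq fun i => ?_⟩
  rw [form_smul_left, inv_inv, hws]
  have h1 := h i
  have h2 := form_shapeRoot s i
  by_cases hi : form α (frame i) < 0
  · rw [if_pos (by simpa using hi), map_neg, h2]
    omega
  · rw [if_neg (by simpa using hi), h2]
    omega

theorem natAbs_form_smul {w : weylGroup} (hw : w ∈ frameSubgroup) (x : RootLattice) (i : Fin 8) :
    (form (w • x) (frame i)).natAbs = (form x (frame i)).natAbs := by
  rw [form_smul_left]
  rcases inv_mem hw i with h | h <;> rw [h]
  rw [map_neg, Int.natAbs_neg]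

theorem shapeCoord_injective : Function.Injective shapeCoord := by
  decide +kernel

/-- A root is determined by its shape and the set of its negative coordinates. -/
noncomputable def signedRoot
    (p : Σ s : Fin 8 ⊕ ExtendedFanoLine, {t : Finset (Fin 8) // ∀ i ∈ t, shapeCoord s i ≠ 0}) :
    roots :=
  ⟨(exists_mem_closure_smul_frame p.2.1).choose⁻¹ • shapeRoot p.1,
    smul_mem_roots _ (shapeRoot_mem_roots p.1)⟩

theorem form_signedRoot
    (p : Σ s : Fin 8 ⊕ ExtendedFanoLine, {t : Finset (Fin 8) // ∀ i ∈ t, shapeCoord s i ≠ 0})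
    (i : Fin 8) : form (signedRoot p) (frame i) =
      if i ∈ p.2.1 then -(shapeCoord p.1 i : ℤ) else shapeCoord p.1 i := by
  rw [signedRoot, form_smul_left, inv_inv,
    (exists_mem_closure_smul_frame p.2.1).choose_spec.2]
  split_ifs
  · rw [map_neg, form_shapeRoot]
  · rw [form_shapeRoot]

theorem signedRoot_bijective : Function.Bijective signedRoot := by
  constructor
  · rintro ⟨s, t, ht⟩ ⟨s', t', ht'⟩ h
    have h1 : ∀ i, form (signedRoot ⟨s, t, ht⟩) (frame i) =
        form (signedRoot ⟨s', t', ht'⟩) (frame i) := by simp [h]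
    simp only [form_signedRoot] at h1
    obtain rfl : s = s' := by
      refine shapeCoord_injective (funext fun i => ?_)
      have := h1 i
      split_ifs at this <;> omega
    obtain rfl : t = t' := by
      ext i
      have h2 := h1 i
      have h3 := ht i
      have h4 := ht' i
      split_ifs at h2 with h5 h6 h6
      · simp [h5, h6]
      · exact absurd (by omega) (h3 h5)
      · exact absurd (by omega) (h4 h6)
      · simp [h5, h6]
    rfl
  · rintro ⟨α, hα⟩
    obtain ⟨s, hs⟩ := exists_natAbs_form_eq hα
    refine ⟨⟨s, Finset.univ.filter fun i => form α (frame i) < 0, fun i hi => ?_⟩, ?_⟩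
    · have := hs i
      simp only [Finset.mem_filter] at hi
      omega
    · refine Subtype.ext (eq_of_form_frame_eq fun i => ?_)
      rw [form_signedRoot]
      have := hs i
      simp only [Finset.mem_filter, Finset.mem_univ, true_and]
      split_ifs <;> omega

/-- Each shape contributes the sign choices on its support: `8 * 2 + 14 * 2 ^ 4 = 240`. -/
theorem ncard_roots : roots.ncard = 240 := by
  classical
  have h : ∀ s : Fin 8 ⊕ ExtendedFanoLine,
      Fintype.card {t : Finset (Fin 8) // ∀ i ∈ t, shapeCoord s i ≠ 0} =
        2 ^ (Finset.univ.filter fun i => shapeCoord s i ≠ 0).card := by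
    intro s
    rw [← Finset.card_powerset, Fintype.card_subtype]
    congr 1
    ext t
    simp [Finset.subset_iff]
  have key : ∑ s : Fin 8 ⊕ ExtendedFanoLine,
      2 ^ (Finset.univ.filter fun i => shapeCoord s i ≠ 0).card = 240 := by decide +kernel
  rw [← Nat.card_coe_set_eq, ← Nat.card_congr (Equiv.ofBijective _ signedRoot_bijective),
    Nat.card_eq_fintype_card, Fintype.card_sigma]
  simp_rw [h]
  exact key

end EEight

namespace EEight

/-! ### Reduction modulo two -/

/-- Reduction of the root lattice modulo two. -/
def reduce (x : RootLattice) : Fin 8 → ZMod 2 := fun i => (x i : ZMod 2)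

/-- A lift of a vector modulo two to the root lattice. -/
def liftVec (v : Fin 8 → ZMod 2) : RootLattice := fun i => ((v i).val : ℤ)

theorem reduce_liftVec (v : Fin 8 → ZMod 2) : reduce (liftVec v) = v := by
  ext i
  simp [reduce, liftVec]

theorem reduce_eq_reduce_iff {x y : RootLattice} :
    reduce x = reduce y ↔ ∃ z : RootLattice, x - y = (2 : ℤ) • z := by
  constructor
  · intro h
    have h1 : ∀ i, ∃ c, x i - y i = 2 * c := fun i =>
      (ZMod.intCast_eq_intCast_iff_dvd_sub _ _ 2).1 (congrFun h i).symm
    choose c hc using h1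
    exact ⟨c, funext hc⟩
  · rintro ⟨z, hz⟩
    ext i
    exact ((ZMod.intCast_eq_intCast_iff_dvd_sub _ _ 2).2 ⟨z i, congrFun hz i⟩).symm

theorem reduce_smul {g : weylGroup} {x y : RootLattice} (h : reduce x = reduce y) :
    reduce (g • x) = reduce (g • y) := by
  obtain ⟨z, hz⟩ := reduce_eq_reduce_iff.1 h
  exact reduce_eq_reduce_iff.2 ⟨g • z, by rw [← smul_sub, hz, smul_comm]⟩

/-- The quadratic form modulo two. -/
def quadMod (v : Fin 8 → ZMod 2) : ZMod 2 :=
  v 0 * v 0 + v 1 * v 1 + v 2 * v 2 + v 3 * v 3 + v 4 * v 4 + v 5 * v 5 + v 6 * v 6 + v 7 * v 7 -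
    v 0 * v 2 - v 1 * v 3 - v 2 * v 3 - v 3 * v 4 - v 4 * v 5 - v 5 * v 6 - v 6 * v 7

theorem quadMod_reduce {x : RootLattice} {k : ℤ} (h : form x x = 2 * k) :
    quadMod (reduce x) = k := by
  have h1 : k = x 0 * x 0 + x 1 * x 1 + x 2 * x 2 + x 3 * x 3 + x 4 * x 4 + x 5 * x 5 +
      x 6 * x 6 + x 7 * x 7 - x 0 * x 2 - x 1 * x 3 - x 2 * x 3 - x 3 * x 4 - x 4 * x 5 -
      x 5 * x 6 - x 6 * x 7 := by
    rw [form_apply] at h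
    linarith
  rw [h1]
  simp [quadMod, reduce]

theorem exists_form_self_eq (x : RootLattice) :
    ∃ k : ℤ, form x x = 2 * k ∧ quadMod (reduce x) = k := by
  obtain ⟨k, hk⟩ := even_form_self x
  exact ⟨k, by omega, quadMod_reduce (by omega)⟩

theorem quadMod_reduce_smul (g : weylGroup) (x : RootLattice) :
    quadMod (reduce (g • x)) = quadMod (reduce x) := by
  obtain ⟨k, hk, h⟩ := exists_form_self_eq x
  rw [h, quadMod_reduce ((form_apply_apply g x x).trans hk)]

/-- Every nonsingular vector modulo two lifts to a root. -/
theorem exists_root_reduce_eq {v : Fin 8 → ZMod 2} (hv : quadMod v = 1) :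
    ∃ α ∈ roots, reduce α = v := by
  classical
  let R : Finset RootLattice := finite_roots.toFinset
  have hR : R.card = 240 := by
    rw [← ncard_roots, Set.ncard_eq_toFinset_card _ finite_roots]
  -- Roots that agree modulo two differ by a sign, so at least 120 classes are hit; there are
  -- exactly 120 nonsingular vectors.
  have hfib : ∀ b ∈ R.image reduce, (R.filter fun a => reduce a = b).card ≤ 2 := by
    intro b hb
    obtain ⟨a, ha, rfl⟩ := Finset.mem_image.1 hb
    have ha' : form a a = 2 := finite_roots.mem_toFinset.1 ha
    refine (Finset.card_le_card (t := {a, -a}) fun c hc => ?_).trans Finset.card_le_two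
    obtain ⟨hc, hca⟩ := Finset.mem_filter.1 hc
    have hc' : form c c = 2 := finite_roots.mem_toFinset.1 hc
    obtain ⟨z, hz⟩ := reduce_eq_reduce_iff.1 hca
    rcases eq_or_eq_neg_of_sub_eq_two_smul (hc'.trans ha'.symm) (by omega) hz with h | h | h
    · simp [h]
    · simp [h]
    · omega
  have h1 := Finset.card_le_mul_card_image R 2 hfib
  have h2 : (Finset.univ.filter fun v => quadMod v = 1).card = 120 := by decide +kernel
  have h3 : R.image reduce ⊆ Finset.univ.filter fun v => quadMod v = 1 := by
    intro b hb
    obtain ⟨a, ha, rfl⟩ := Finset.mem_image.1 hb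
    have ha' : form a a = 2 := finite_roots.mem_toFinset.1 ha
    rw [Finset.mem_filter]
    exact ⟨Finset.mem_univ _, by simpa using quadMod_reduce (k := 1) ha'⟩
  have h4 := Finset.eq_of_subset_of_card_le h3 (by omega)
  have h5 : v ∈ R.image reduce := by
    rw [h4, Finset.mem_filter]
    exact ⟨Finset.mem_univ _, hv⟩
  obtain ⟨a, ha, h⟩ := Finset.mem_image.1 h5
  exact ⟨a, finite_roots.mem_toFinset.1 ha, h⟩

/-- The singular vectors modulo two. -/
abbrev SingularVector : Type := {v : Fin 8 → ZMod 2 // v ≠ 0 ∧ quadMod v = 0}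

instance : MulAction weylGroup SingularVector where
  smul g v := ⟨reduce (g • liftVec v.1), by
    intro h
    refine v.2.1 ?_
    rw [← reduce_liftVec v.1, ← inv_smul_smul g (liftVec v.1)]
    have : reduce (g • liftVec v.1) = reduce 0 := h
    rw [reduce_smul this, smul_zero]
    ext i
    simp [reduce], by rw [quadMod_reduce_smul, reduce_liftVec]; exact v.2.2⟩
  one_smul v := Subtype.ext (by
    change reduce ((1 : weylGroup) • liftVec v.1) = v.1
    rw [one_smul, reduce_liftVec])
  mul_smul g h v := Subtype.ext (by
    change reduce ((g * h) • liftVec v.1) = reduce (g • liftVec (reduce (h • liftVec v.1)))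
    rw [mul_smul]
    exact reduce_smul (reduce_liftVec _).symm)

theorem coe_smul_singularVector (g : weylGroup) (v : SingularVector) :
    (g • v).1 = reduce (g • liftVec v.1) := rfl

theorem not_two_dvd_card_singularVector : ¬ 2 ∣ Nat.card SingularVector := by
  have : Fintype.card SingularVector = 135 := by
    rw [Fintype.card_subtype]
    decide +kernel
  rw [Nat.card_eq_fintype_card, this]
  decide

/-- Since `v` and `w` are singular, `quadMod (v + w) = 1` says that they are not orthogonal modulo
two, and the reflection in a root above `v + w` takes `v` to `w`. -/
theorem exists_smul_eq_of_quadMod_add {v w : SingularVector} (h : quadMod (v.1 + w.1) = 1) :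
    ∃ g : weylGroup, g • v = w := by
  obtain ⟨α, hα, hαv⟩ := exists_root_reduce_eq h
  refine ⟨weylReflection α hα, Subtype.ext ?_⟩
  rw [coe_smul_singularVector, weylReflection_smul]
  have hadd : ∀ x y : RootLattice, reduce (x + y) = reduce x + reduce y := fun x y => by
    ext i
    simp [reduce]
  have hself : ∀ u : Fin 8 → ZMod 2, u + u = 0 := fun u => funext fun i =>
    CharTwo.add_self_eq_zero _
  have hw : reduce (α + liftVec v.1) = w.1 := by
    rw [hadd, reduce_liftVec, hαv, add_right_comm, hself, zero_add]
  obtain ⟨k, hk, hkv⟩ := exists_form_self_eq (liftVec v.1)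
  obtain ⟨l, hl, hlw⟩ := exists_form_self_eq (α + liftVec v.1)
  rw [reduce_liftVec, v.2.2] at hkv
  rw [hw, w.2.2] at hlw
  have h1 : form α (liftVec v.1) = l - k - 1 := by
    rw [map_add, map_add, LinearMap.add_apply, LinearMap.add_apply, hk,
      form_comm (liftVec v.1) α, show form α α = 2 from hα] at hl
    omega
  have h2 : reduce (liftVec v.1 - form α (liftVec v.1) • α) = reduce (α + liftVec v.1) := by
    rw [reduce_eq_reduce_iff, h1]
    obtain ⟨k', rfl⟩ : (2 : ℤ) ∣ k := (ZMod.intCast_zmod_eq_zero_iff_dvd k 2).1 hkv.symm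
    obtain ⟨l', rfl⟩ : (2 : ℤ) ∣ l := (ZMod.intCast_zmod_eq_zero_iff_dvd l 2).1 hlw.symm
    refine ⟨(k' - l') • α, ?_⟩
    ext i
    simp only [Pi.sub_apply, Pi.add_apply, Pi.smul_apply, smul_eq_mul]
    ring
  rw [h2, hw]

/-! ### A frame of vectors of square length four -/

/-- Eight mutually orthogonal vectors of square length four that agree modulo two. -/
def quad : Fin 8 → RootLattice :=
  ![frame 0 + frame 1, frame 0 - frame 1, frame 2 + frame 3, frame 2 - frame 3,
    frame 4 + frame 5, frame 4 - frame 5, frame 6 + frame 7, frame 6 - frame 7]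

theorem form_quad_quad (i j : Fin 8) : form (quad i) (quad j) = if i = j then 4 else 0 := by
  rw [form_apply]
  revert i j
  decide +kernel

theorem reduce_quad (i : Fin 8) : reduce (quad i) = reduce (quad 0) := by
  revert i
  decide +kernel

theorem four_smul_eq_sum (x : RootLattice) : (4 : ℤ) • x = ∑ i, form x (quad i) • quad i := by
  simp only [Fin.sum_univ_eight, form_apply, quad, frame]
  ext j
  fin_cases j <;> simp <;> ring

theorem weyl_ext_quad {g h : weylGroup} (H : ∀ i, g • quad i = h • quad i) : g = h := by
  refine weyl_ext fun x => smul_right_injective _ (four_ne_zero (α := ℤ)) ?_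
  change (4 : ℤ) • g • x = (4 : ℤ) • h • x
  rw [← smul_comm g, ← smul_comm h, four_smul_eq_sum, Finset.smul_sum, Finset.smul_sum]
  refine Finset.sum_congr rfl fun i _ => ?_
  rw [smul_comm g, smul_comm h, H]

/-- A further vector in this class would be orthogonal to all eight `quad i`, which span rationally,
and so would vanish. -/
theorem eq_or_eq_neg_quad {x : RootLattice} (hx : form x x = 4)
    (h : reduce x = reduce (quad 0)) : ∃ i, x = quad i ∨ x = -quad i := by
  by_contra! hcon
  have h1 : ∀ i, form x (quad i) = 0 := by
    intro i
    obtain ⟨z, hz⟩ := reduce_eq_reduce_iff.1 (h.trans (reduce_quad i).symm)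
    have h2 : form (quad i) (quad i) = 4 := by rw [form_quad_quad, if_pos rfl]
    rcases eq_or_eq_neg_of_sub_eq_two_smul (hx.trans h2.symm) hx.le hz with h | h | h
    · exact absurd h (hcon i).1
    · exact absurd h (hcon i).2
    · exact h.2
  have h2 := four_smul_eq_sum x
  simp only [h1, zero_smul, Finset.sum_const_zero] at h2
  have h3 : x = 0 := (smul_eq_zero_iff_right four_ne_zero).1 h2
  rw [h3, map_zero] at hx
  omega

theorem exists_smul_eq_reduce_quad (v : SingularVector) :
    ∃ g : weylGroup, (g • v).1 = reduce (quad 0) := by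
  have h0 : reduce (quad 0) ≠ 0 ∧ quadMod (reduce (quad 0)) = 0 := by decide +kernel
  -- At most two reflections are needed: orthogonal singular vectors have a common singular vector
  -- `w` orthogonal to neither.
  have key : ∀ v : Fin 8 → ZMod 2, v ≠ 0 → quadMod v = 0 → v = reduce (quad 0) ∨
      quadMod (v + reduce (quad 0)) = 1 ∨ ∃ w, w ≠ 0 ∧ quadMod w = 0 ∧ quadMod (v + w) = 1 ∧
        quadMod (w + reduce (quad 0)) = 1 := by decide +kernel
  rcases key v.1 v.2.1 v.2.2 with h | h | ⟨w, hw0, hw, h1, h2⟩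
  · exact ⟨1, by rw [one_smul, h]⟩
  · obtain ⟨g, hg⟩ := exists_smul_eq_of_quadMod_add (v := v) (w := ⟨_, h0⟩) h
    exact ⟨g, congrArg Subtype.val hg⟩
  · obtain ⟨g, hg⟩ := exists_smul_eq_of_quadMod_add (v := v) (w := ⟨w, hw0, hw⟩) h1
    obtain ⟨k, hk⟩ := exists_smul_eq_of_quadMod_add (v := ⟨w, hw0, hw⟩) (w := ⟨_, h0⟩) h2
    exact ⟨k * g, by rw [mul_smul, hg, hk]⟩

/-- A `2`-subgroup of the Weyl group preserves a conjugate of the frame `± quad i`. -/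
theorem exists_conj_smul_quad {M : Subgroup weylGroup} (hM : IsPGroup 2 M) :
    ∃ g : weylGroup, ∀ m ∈ M.map (MulAut.conj g).toMonoidHom, ∀ i,
      ∃ j, m • quad i = quad j ∨ m • quad i = -quad j := by
  -- There are 135 singular vectors, an odd number.
  obtain ⟨v, hv⟩ := hM.nonempty_fixed_point_of_prime_not_dvd_card SingularVector
    not_two_dvd_card_singularVector
  obtain ⟨g, hg⟩ := exists_smul_eq_reduce_quad v
  refine ⟨g, ?_⟩
  rintro _ ⟨m, hm, rfl⟩ i
  refine eq_or_eq_neg_quad ?_ ?_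
  · rw [form_apply_apply, form_quad_quad, if_pos rfl]
  · have h1 : (g * m * g⁻¹) • g • v = g • v := by
      rw [← mul_smul, inv_mul_cancel_right, mul_smul]
      exact congrArg _ (hv ⟨m, hm⟩)
    have h2 := congrArg Subtype.val h1
    rw [coe_smul_singularVector, hg] at h2
    change reduce ((g * m * g⁻¹) • quad i) = _
    rw [← h2]
    exact reduce_smul (by rw [reduce_liftVec, reduce_quad])

/-- Half of `quad x - quad y` has square length `(4 + 4) / 4 = 2`, and the reflection in this root
swaps the two vectors. -/
theorem exists_smul_quad_eq_perm (σ : Equiv.Perm (Fin 8)) :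
    ∃ g : weylGroup, ∀ i, g • quad i = quad (σ i) := by
  induction σ using Equiv.Perm.swap_induction_on with
  | one => exact ⟨1, fun i => by simp⟩
  | swap_mul f x y hxy ih =>
    obtain ⟨g, hg⟩ := ih
    obtain ⟨r, hr⟩ := reduce_eq_reduce_iff.1 ((reduce_quad x).trans (reduce_quad y).symm)
    have h1 : ∀ i, 2 * form r (quad i) = (if x = i then 4 else 0) - if y = i then 4 else 0 := by
      intro i
      have h2 := congrArg (fun u => form u (quad i)) hr
      simp only [map_sub, map_smul, LinearMap.sub_apply, LinearMap.smul_apply, smul_eq_mul,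
        form_quad_quad] at h2
      omega
    have hroot : r ∈ roots := by
      change form r r = 2
      have h2 := congrArg (form r) hr
      simp only [map_sub, map_smul, smul_eq_mul] at h2
      have hx := h1 x
      have hy := h1 y
      simp only [if_neg hxy, if_neg hxy.symm, if_true] at hx hy
      omega
    refine ⟨weylReflection r hroot * g, fun i => ?_⟩
    rw [mul_smul, hg, weylReflection_smul, Equiv.Perm.mul_apply]
    have h2 := h1 (f i)
    by_cases hx : x = f i
    · rw [← hx, Equiv.swap_apply_left]
      rw [← hx, if_pos rfl, if_neg hxy.symm] at h2
      rw [show form r (quad x) = 2 by omega, ← hr]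
      abel
    · by_cases hy : y = f i
      · rw [← hy, Equiv.swap_apply_right]
        rw [← hy, if_pos rfl, if_neg hxy] at h2
        rw [show form r (quad y) = -2 by omega, neg_smul, ← hr]
        abel
      · rw [Equiv.swap_apply_of_ne_of_ne (Ne.symm hx) (Ne.symm hy)]
        rw [if_neg hx, if_neg hy] at h2
        rw [show form r (quad (f i)) = 0 by omega, zero_smul, sub_zero]

end EEight

namespace EEight

/-! ### Commutative subgroups of order 256 that preserve the frame `± quad i` -/

theorem units_smul_quad_injective {ε δ : ℤˣ} {i j : Fin 8}
    (h : (ε : ℤ) • quad i = (δ : ℤ) • quad j) : ε = δ ∧ i = j := by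
  have h1 := congrArg (form (quad i)) h
  rw [map_smul, map_smul, form_quad_quad, form_quad_quad, if_pos rfl] at h1
  have hij : i = j := by
    by_contra hij
    rw [if_neg hij] at h1
    simp at h1
  refine ⟨Units.ext ?_, hij⟩
  rw [if_pos hij] at h1
  simp only [smul_eq_mul] at h1
  omega

theorem exists_odd_form_quad (i : Fin 8) : ∃ x : RootLattice, Odd (form x (quad i)) := by
  have : ∀ i, ∃ k, Odd (form (simpleRoot k) (quad i)) := by
    simp only [form_apply, simpleRoot]
    decide +kernel
  obtain ⟨k, hk⟩ := this i
  exact ⟨_, hk⟩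

theorem four_smul_smul (w : weylGroup) (x : RootLattice) :
    (4 : ℤ) • w • x = ∑ i, form x (quad i) • w • quad i := by
  rw [← smul_comm w, four_smul_eq_sum, Finset.smul_sum]
  exact Finset.sum_congr rfl fun i _ => smul_comm _ _ _

/-- For `x` with odd product `a` with `quad i`, the lattice vector `x - w • x` would have square
length `a ^ 2`, which is odd. -/
theorem not_single_sign_change {w : weylGroup} {i : Fin 8} (hi : w • quad i = -quad i)
    (hne : ∀ j ≠ i, w • quad j = quad j) : False := by
  obtain ⟨x, hx⟩ := exists_odd_form_quad i
  have h1 : (4 : ℤ) • (x - w • x) = (2 * form x (quad i)) • quad i := by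
    rw [smul_sub, four_smul_smul, four_smul_eq_sum, ← Finset.sum_sub_distrib,
      Finset.sum_eq_single i]
    · rw [hi, smul_neg, sub_neg_eq_add, two_mul, add_smul]
    · intro j _ hj
      rw [hne j hj, sub_self]
    · exact fun h => absurd (Finset.mem_univ i) h
  obtain ⟨k, hk⟩ := even_form_self (x - w • x)
  obtain ⟨l, hl⟩ := hx
  have h2 := congrArg (fun u => form u u) h1
  simp only [map_smul, LinearMap.smul_apply, smul_eq_mul, form_quad_quad, if_true] at h2
  rw [hk, hl] at h2
  have h3 : k + k = (2 * l + 1) * (2 * l + 1) := by linarith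
  have h4 : Odd ((2 * l + 1) * (2 * l + 1)) := (odd_two_mul_add_one l).mul (odd_two_mul_add_one l)
  rw [← h3, ← Int.not_even_iff_odd] at h4
  exact h4 ⟨k, rfl⟩

/-- Here the square length of `x - w • x` would be `(a ^ 2 + b ^ 2) / 2` with `a` odd. It would have
to be even, but `a ^ 2 + b ^ 2` is not divisible by four. -/
theorem not_single_rotation {w : weylGroup} {i j : Fin 8} (hij : i ≠ j) (hi : w • quad i = quad j)
    (hj : w • quad j = -quad i) (hne : ∀ k, k ≠ i → k ≠ j → w • quad k = quad k) : False := by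
  obtain ⟨x, hx⟩ := exists_odd_form_quad i
  set a := form x (quad i)
  set b := form x (quad j) with hb
  have h1 : (4 : ℤ) • (x - w • x) = (a + b) • quad i + (b - a) • quad j := by
    rw [smul_sub, four_smul_smul, four_smul_eq_sum, ← Finset.sum_sub_distrib,
      Fintype.sum_eq_add i j hij]
    · rw [hi, hj, smul_neg, add_smul, sub_smul]
      abel
    · rintro k ⟨hki, hkj⟩
      rw [hne k hki hkj, sub_self]
  obtain ⟨k, hk⟩ := even_form_self (x - w • x)
  have h2 := congrArg (fun u => form u u) h1
  simp only [map_smul, map_add, LinearMap.smul_apply, LinearMap.add_apply, smul_eq_mul,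
    form_quad_quad, if_true, if_neg hij, if_neg hij.symm] at h2
  rw [hk] at h2
  have h3 : a * a + b * b = 4 * k := by linarith
  obtain ⟨l, hl⟩ := hx
  rcases Int.even_or_odd' b with ⟨m, hm | hm⟩
  · rw [hl, hm] at h3
    have : 4 * (l * l + l + m * m - k) = -1 := by linarith
    omega
  · rw [hl, hm] at h3
    have : 4 * (l * l + l + m * m + m - k) = -2 := by linarith
    omega

section

variable {M : Subgroup weylGroup}

/-- The relation of lying in the same orbit, up to sign. -/
def quadSetoid (M : Subgroup weylGroup) : Setoid (Fin 8) where
  r i j := ∃ m ∈ M, ∃ ε : ℤˣ, m • quad i = (ε : ℤ) • quad j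
  iseqv :=
    { refl := fun i => ⟨1, M.one_mem, 1, by simp⟩
      symm := by
        rintro i j ⟨m, hm, ε, h⟩
        refine ⟨m⁻¹, inv_mem hm, ε, ?_⟩
        rw [inv_smul_eq_iff, smul_comm, h, smul_smul, ← Units.val_mul, Int.units_mul_self,
          Units.val_one, one_smul]
      trans := by
        rintro i j k ⟨m, hm, ε, h⟩ ⟨n, hn, δ, h'⟩
        refine ⟨n * m, mul_mem hn hm, ε * δ, ?_⟩
        rw [mul_smul, h, smul_comm, h', smul_smul, Units.val_mul] }

variable (hcomm : IsMulCommutative M) (hcard : Nat.card M = 256)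
  (hM : ∀ m ∈ M, ∀ i, ∃ j, m • quad i = quad j ∨ m • quad i = -quad j)

include hcomm in
-- In an abelian group, the image of one vector determines the images of its whole orbit.
theorem smul_quad_eq_of_rel {m n : weylGroup} (hm : m ∈ M) (hn : n ∈ M) {i j : Fin 8}
    (hij : quadSetoid M i j) (h : m • quad i = n • quad i) : m • quad j = n • quad j := by
  obtain ⟨k, hk, ε, hki⟩ := hij
  have hc : ∀ a ∈ M, a * k = k * a := fun a ha =>
    congrArg Subtype.val (hcomm.is_comm.comm (⟨a, ha⟩ : M) ⟨k, hk⟩)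
  have h1 : (ε : ℤ) • m • quad j = (ε : ℤ) • n • quad j := by
    rw [← smul_comm m, ← smul_comm n, ← hki, ← mul_smul, ← mul_smul, hc m hm, hc n hn, mul_smul,
      mul_smul, h]
  exact smul_right_injective _ ε.ne_zero h1

include hcomm hcard hM in
/-- The eight lines form orbits of length two, on which the group acts independently. -/
theorem exists_mem_smul_quad_out :
    (∀ ω : Quotient (quadSetoid M), Nat.card {j : Fin 8 // Quotient.mk _ j = ω} ≤ 2) ∧
    ∀ f : (ω : Quotient (quadSetoid M)) → ℤˣ × {j : Fin 8 // Quotient.mk _ j = ω},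
      ∃ m ∈ M, ∀ ω, m • quad ω.out = ((f ω).1 : ℤ) • quad (f ω).2 := by
  classical
  have hex : ∀ (m : M) (ω : Quotient (quadSetoid M)),
      ∃ p : ℤˣ × {j : Fin 8 // Quotient.mk _ j = ω},
        (m : weylGroup) • quad ω.out = (p.1 : ℤ) • quad p.2 := by
    intro m ω
    obtain ⟨j, hj⟩ := hM m m.2 ω.out
    obtain ⟨ε, hε⟩ : ∃ ε : ℤˣ, (m : weylGroup) • quad ω.out = (ε : ℤ) • quad j :=
      hj.elim (fun h => ⟨1, by simpa using h⟩) fun h => ⟨-1, by simpa using h⟩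
    have hjω : Quotient.mk (quadSetoid M) j = ω := by
      rw [← Quotient.out_eq ω]
      exact (Quotient.sound (s := quadSetoid M) ⟨m, m.2, ε, hε⟩).symm
    exact ⟨⟨ε, j, hjω⟩, hε⟩
  choose F hF using hex
  -- An element is determined by the signed images of one representative for each class. So for
  -- class sizes `c` one has `256 ≤ ∏ 2c ≤ ∏ 2 ^ c = 256`; equality gives `2c = 2 ^ c` in each
  -- class, and all choices of images occur.
  have hinj : Function.Injective F := by
    intro m n hmn
    refine Subtype.ext (weyl_ext_quad fun j => ?_)
    refine smul_quad_eq_of_rel hcomm m.2 n.2 (i := (Quotient.mk (quadSetoid M) j).out)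
      (Quotient.mk_out j) ?_
    rw [hF, hF, hmn]
  have hsum : ∑ ω : Quotient (quadSetoid M), Nat.card {j : Fin 8 // Quotient.mk _ j = ω} = 8 := by
    rw [← Nat.card_sigma, Nat.card_congr (Equiv.sigmaFiberEquiv (Quotient.mk (quadSetoid M)))]
    simp
  have hcardpi : Nat.card ((ω : Quotient (quadSetoid M)) →
      ℤˣ × {j : Fin 8 // Quotient.mk _ j = ω}) =
      ∏ ω : Quotient (quadSetoid M), 2 * Nat.card {j : Fin 8 // Quotient.mk _ j = ω} := by
    rw [Nat.card_pi]
    refine Finset.prod_congr rfl fun ω _ => ?_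
    rw [Nat.card_prod, Nat.card_eq_fintype_card (α := ℤˣ)]
    rfl
  have hpow : ∏ ω : Quotient (quadSetoid M), 2 ^ Nat.card {j : Fin 8 // Quotient.mk _ j = ω} =
      256 := by
    rw [Finset.prod_pow_eq_pow_sum, hsum]
    norm_num
  have hpos : ∀ ω : Quotient (quadSetoid M),
      0 < Nat.card {j : Fin 8 // Quotient.mk _ j = ω} := fun ω =>
    Nat.card_pos_iff.2 ⟨⟨⟨ω.out, ω.out_eq⟩⟩, inferInstance⟩
  have hle : ∀ n : ℕ, 2 * n ≤ 2 ^ n := by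
    intro n
    induction n with
    | zero => norm_num
    | succ n ih =>
      rcases n with - | n
      · norm_num
      · rw [pow_succ]
        omega
  have hge := Nat.card_le_card_of_injective F hinj
  rw [hcard, hcardpi] at hge
  have heq : ∀ ω : Quotient (quadSetoid M), 2 * Nat.card {j : Fin 8 // Quotient.mk _ j = ω} =
      2 ^ Nat.card {j : Fin 8 // Quotient.mk _ j = ω} := by
    by_contra! hcon
    obtain ⟨ω, hω⟩ := hcon
    have := Finset.prod_lt_prod (s := Finset.univ)
      (f := fun ω : Quotient (quadSetoid M) =>
        2 * Nat.card {j : Fin 8 // Quotient.mk _ j = ω})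
      (g := fun ω : Quotient (quadSetoid M) =>
        2 ^ Nat.card {j : Fin 8 // Quotient.mk _ j = ω})
      (fun ω _ => Nat.mul_pos two_pos (hpos ω)) (fun ω _ => hle _)
      ⟨ω, Finset.mem_univ ω, lt_of_le_of_ne (hle _) hω⟩
    omega
  refine ⟨fun ω => ?_, fun f => ?_⟩
  · have h1 := heq ω
    by_contra! h2
    obtain ⟨n, hn⟩ := Nat.exists_eq_add_of_le h2
    have h3 := hle (2 + n)
    rw [hn, show Nat.succ 2 + n = 1 + (2 + n) by omega, pow_add] at h1
    omega
  · have hbij := hinj.bijective_of_nat_card_le (by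
      rw [hcard, hcardpi, ← hpow]
      exact Finset.prod_le_prod' fun ω _ => hle _)
    obtain ⟨m, hm⟩ := hbij.2 f
    exact ⟨m, m.2, fun ω => by rw [hF, hm]⟩

include hcomm hcard hM in
-- A class of one element would allow a single sign change, so the classes are pairs. On each pair,
-- an element that exchanges the two lines must do so with equal signs, since unequal signs would
-- give a single rotation.
theorem exists_partner :
    ∃ p : Fin 8 → Fin 8, (∀ i, p i ≠ i) ∧ (∀ i, p (p i) = i) ∧ ∀ (i : Fin 8) (ε : ℤˣ),
      ∃ m ∈ M, m • quad i = (ε : ℤ) • quad (p i) ∧ m • quad (p i) = (ε : ℤ) • quad i ∧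
        ∀ k, k ≠ i → k ≠ p i → m • quad k = quad k := by
  classical
  obtain ⟨hle2, hsurj⟩ := exists_mem_smul_quad_out hcomm hcard hM
  have hmk : ∀ i j, Quotient.mk (quadSetoid M) i = Quotient.mk (quadSetoid M) j →
      quadSetoid M i j := fun i j h => Quotient.exact h
  -- any signed vector in the class of `i` is the image of `quad i` under an element that fixes
  -- the other classes
  have key : ∀ (i j : Fin 8) (ε : ℤˣ), Quotient.mk (quadSetoid M) j = Quotient.mk _ i →
      ∃ m ∈ M, m • quad i = (ε : ℤ) • quad j ∧
        ∀ k, Quotient.mk (quadSetoid M) k ≠ Quotient.mk _ i → m • quad k = quad k := by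
    intro i j ε hji
    obtain ⟨n, hn, δ, hni⟩ : quadSetoid M i (Quotient.mk (quadSetoid M) i).out :=
      (quadSetoid M).symm (Quotient.mk_out i)
    obtain ⟨m, hm, h⟩ := hsurj fun ω =>
      if h : ω = Quotient.mk _ i then ⟨ε, j, hji.trans h.symm⟩ else ⟨1, ω.out, ω.out_eq⟩
    obtain ⟨m', hm', h'⟩ := hsurj fun ω =>
      if h : ω = Quotient.mk _ i then ⟨1, i, h.symm⟩ else ⟨1, ω.out, ω.out_eq⟩
    -- The choices concern the representative of the class, not `i` itself; `m'` corrects for this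
    -- by taking the representative to `i`.
    refine ⟨m * m'⁻¹, mul_mem hm (inv_mem hm'), ?_, fun k hk => ?_⟩
    · have h1 := h (Quotient.mk _ i)
      have h2 := h' (Quotient.mk _ i)
      simp only [dif_pos, Units.val_one, one_smul] at h1 h2
      rw [← h1, mul_smul, ← h2, inv_smul_smul]
    · have h1 := h (Quotient.mk _ k)
      have h2 := h' (Quotient.mk _ k)
      simp only [dif_neg hk, Units.val_one, one_smul] at h1 h2
      have h3 := smul_quad_eq_of_rel hcomm hm hm' (Quotient.mk_out (s := quadSetoid M) k)
        (h1.trans h2.symm)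
      have h4 := smul_quad_eq_of_rel hcomm hm' M.one_mem (Quotient.mk_out (s := quadSetoid M) k)
        (h2.trans (one_smul _ _).symm)
      rw [one_smul] at h4
      rw [mul_smul, inv_smul_eq_iff.2 h4.symm, h3, h4]
  have hpart : ∀ i, ∃ j, j ≠ i ∧ Quotient.mk (quadSetoid M) j = Quotient.mk _ i := by
    intro i
    by_contra! hcon
    obtain ⟨m, -, h1, h2⟩ := key i i (-1) rfl
    exact not_single_sign_change (w := m) (i := i) (by simpa using h1)
      fun j hj => h2 j (hcon j hj)
  choose p hp hpq using hpart
  have hclass : ∀ i k, Quotient.mk (quadSetoid M) k = Quotient.mk _ i → k = i ∨ k = p i := by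
    intro i k hk
    by_contra! hcon
    have h1 := hle2 (Quotient.mk _ i)
    rw [Nat.card_eq_fintype_card, Fintype.card_subtype] at h1
    have h2 : ({k, i, p i} : Finset (Fin 8)).card = 3 :=
      Finset.card_eq_three.2 ⟨k, i, p i, hcon.1, hcon.2, (hp i).symm, rfl⟩
    have h3 := Finset.card_le_card (s := {k, i, p i})
      (t := Finset.univ.filter fun j => Quotient.mk (quadSetoid M) j = Quotient.mk _ i) (by
        intro j hj
        simp only [Finset.mem_insert, Finset.mem_singleton] at hj
        rw [Finset.mem_filter]
        rcases hj with rfl | rfl | rfl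
        exacts [⟨Finset.mem_univ _, hk⟩, ⟨Finset.mem_univ _, rfl⟩, ⟨Finset.mem_univ _, hpq i⟩])
    omega
  refine ⟨p, hp, fun i => ?_, fun i ε => ?_⟩
  · exact (hclass i _ ((hpq (p i)).trans (hpq i))).resolve_right (hp (p i))
  · obtain ⟨m, hm, h1, h2⟩ := key i (p i) ε (hpq i)
    have hfix : ∀ k, k ≠ i → k ≠ p i → m • quad k = quad k := fun k hk hk' =>
      h2 k fun h => (hclass i k h).elim hk hk'
    refine ⟨m, hm, h1, ?_, hfix⟩
    obtain ⟨j, hj⟩ := hM m hm (p i)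
    obtain ⟨δ, hδ⟩ : ∃ δ : ℤˣ, m • quad (p i) = (δ : ℤ) • quad j :=
      hj.elim (fun h => ⟨1, by simpa using h⟩) fun h => ⟨-1, by simpa using h⟩
    obtain rfl : j = i := by
      by_contra hji
      by_cases hjp : j = p i
      · rw [hjp] at hδ
        have h3 : m • quad i = m • ((ε * δ : ℤˣ) : ℤ) • quad (p i) := by
          rw [smul_comm, hδ, smul_smul, ← Units.val_mul, mul_assoc, Int.units_mul_self, mul_one, h1]
        have h4 := smul_left_cancel m h3
        have h5 := units_smul_quad_injective (ε := 1) (δ := ε * δ)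
          (by rw [Units.val_one, one_smul]; exact h4)
        exact hp i h5.2.symm
      · have h3 : m • quad (p i) = m • (δ : ℤ) • quad j := by
          rw [smul_comm, hfix j hji hjp, hδ]
        have h4 := smul_left_cancel m h3
        have h5 := units_smul_quad_injective (ε := 1) (δ := δ)
          (by rw [Units.val_one, one_smul]; exact h4)
        exact hjp h5.2.symm
    have hεδ : ε = δ := by
      by_contra hne
      rcases Int.units_eq_one_or ε with rfl | rfl <;> rcases Int.units_eq_one_or δ with rfl | rfl
      · exact hne rfl
      · exact not_single_rotation (hp j).symm (by simpa using h1) (by simpa using hδ) hfix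
      · exact not_single_rotation (hp j) (by simpa using hδ) (by simpa using h1)
          fun k hk hk' => hfix k hk' hk
      · exact hne rfl
    rw [hδ, hεδ]

end

/-- The standard pairing. -/
def partner : Fin 8 → Fin 8 := ![1, 0, 3, 2, 5, 4, 7, 6]

/-- Fixed-point-free involutions of eight points all have cycle type `2 ^ 4`, so they are conjugate.
-/
theorem exists_perm_conj_partner {p : Fin 8 → Fin 8} (hp : ∀ i, p i ≠ i) (hpp : ∀ i, p (p i) = i) :
    ∃ σ : Equiv.Perm (Fin 8), ∀ i, σ (p i) = partner (σ i) := by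
  have key : ∀ (q : Fin 8 → Fin 8) (hqq : Function.Involutive q), (∀ i, q i ≠ i) →
      hqq.toPerm.cycleType = Multiset.replicate 4 2 := by
    intro q hqq hq
    have hord : orderOf hqq.toPerm = 2 := by
      refine orderOf_eq_prime (Equiv.ext fun i => ?_) fun h => hq 0 ?_
      · rw [sq, Equiv.Perm.mul_apply]
        exact hqq i
      · exact congrArg (fun e => e 0) h
    obtain ⟨n, hn⟩ := Equiv.Perm.cycleType_prime_order (hord ▸ Nat.prime_two)
    rw [hord] at hn
    have h1 := hqq.toPerm.sum_cycleType
    have h2 : hqq.toPerm.support = Finset.univ := by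
      ext i
      simpa using hq i
    rw [hn, Multiset.sum_replicate, h2, Finset.card_univ, Fintype.card_fin, smul_eq_mul] at h1
    rw [hn, show n + 1 = 4 by omega]
  have hp0 : Function.Involutive partner := by
    intro i
    revert i
    decide
  have h1 := key p hpp hp
  have h2 := key partner hp0 (by decide)
  obtain ⟨σ, hσ⟩ := isConj_iff.1 (Equiv.Perm.isConj_iff_cycleType_eq.2 (h1.trans h2.symm))
  refine ⟨σ, fun i => ?_⟩
  have h3 := congrArg (fun e => e (σ i)) hσ
  have h4 : σ (Function.Involutive.toPerm p hpp i) = Function.Involutive.toPerm partner hp0 (σ i) := by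
    simpa using h3
  exact h4

theorem frameReflection_smul_quad (i j : Fin 8) :
    frameReflection i • quad j = if j = i ∨ j = partner i then
      (if i.val % 2 = 0 then -quad (partner j) else quad (partner j)) else quad j := by
  rw [frameReflection, weylReflection_smul]
  ext k
  simp only [form_apply, Pi.sub_apply, Pi.smul_apply]
  revert i j k
  decide +kernel

/-- Every abelian subgroup of maximal order is conjugate to `frameSubgroup`. -/
theorem exists_conj_eq_frameSubgroup {M : Subgroup weylGroup} (hM : IsMaximalOrderAbelian M) :
    ∃ g : weylGroup, M.map (MulAut.conj g).toMonoidHom = frameSubgroup := by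
  have hcard := card_eq_of_isMaximalOrderAbelian hM
  obtain ⟨g, hg⟩ := exists_conj_smul_quad (M := M) (IsPGroup.of_card (n := 8) (by rw [hcard]; rfl))
  have hconjcard : ∀ (h : weylGroup) (N : Subgroup weylGroup),
      Nat.card (N.map (MulAut.conj h).toMonoidHom) = Nat.card N := fun h N =>
    Subgroup.card_map_of_injective (MulAut.conj h).injective
  have hcomm : IsMulCommutative (M.map (MulAut.conj g).toMonoidHom) := by
    have := hM.1
    exact Subgroup.map_isMulCommutative _ _
  obtain ⟨p, hp, hpp, hMp⟩ := exists_partner hcomm ((hconjcard g M).trans hcard) hg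
  obtain ⟨σ, hσ⟩ := exists_perm_conj_partner hp hpp
  obtain ⟨h, hh⟩ := exists_smul_quad_eq_perm σ
  refine ⟨h * g, ?_⟩
  rw [map_mul]
  change M.map ((MulAut.conj h).toMonoidHom.comp (MulAut.conj g).toMonoidHom) = _
  rw [← Subgroup.map_map]
  refine (SetLike.coe_injective (Set.eq_of_subset_of_ncard_le ?_ ?_)).symm
  · change frameSubgroup ≤ _
    rw [← closure_range_frameReflection, Subgroup.closure_le]
    rintro _ ⟨i, rfl⟩
    -- The sign is the one with which `frameReflection i` exchanges the two `quad` vectors of its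
    -- pair.
    obtain ⟨m, hm, h1, h2, h3⟩ := hMp (σ.symm i) (if i.val % 2 = 0 then -1 else 1)
    refine ⟨m, hm, weyl_ext_quad fun j => ?_⟩
    change (h * m * h⁻¹) • quad j = _
    have hj : h⁻¹ • quad j = quad (σ.symm j) := by
      rw [inv_smul_eq_iff, hh, Equiv.apply_symm_apply]
    have hpi : σ (p (σ.symm i)) = partner i := by rw [hσ, Equiv.apply_symm_apply]
    rw [mul_smul, mul_smul, hj, frameReflection_smul_quad]
    by_cases hji : j = i
    · rw [hji, h1, if_pos (Or.inl rfl), smul_comm, hh, hpi]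
      split_ifs <;> simp
    · by_cases hjp : j = partner i
      · have hpj : partner j = i := by rw [hjp, ← hpi, ← hσ, hpp, Equiv.apply_symm_apply]
        have hj' : σ.symm j = p (σ.symm i) := by rw [hjp, ← hpi, Equiv.symm_apply_apply]
        rw [hj', h2, if_pos (Or.inr hjp), smul_comm, hh, Equiv.apply_symm_apply, hpj]
        split_ifs <;> simp
      · rw [if_neg (not_or.2 ⟨hji, hjp⟩), h3, hh, Equiv.apply_symm_apply]
        · exact fun h => hji (σ.symm.injective h)
        · exact fun h => hjp (by rw [← hpi, ← h, Equiv.apply_symm_apply])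
  -- The conjugate contains the generators of `frameSubgroup` and has the same order 256.
  · rw [← Nat.card_coe_set_eq, ← Nat.card_coe_set_eq]
    change Nat.card (Subgroup.map _ _ : Subgroup weylGroup) ≤ Nat.card frameSubgroup
    rw [hconjcard, hconjcard, hcard, card_frameSubgroup]

end EEight

/-! ### The geometry of the sign-change group -/

namespace EEight

theorem weylReflection_neg {α : RootLattice} (hα : α ∈ roots) (hα' : -α ∈ roots) :
    weylReflection (-α) hα' = weylReflection α hα :=
  weyl_ext fun x => by
    rw [weylReflection_smul, weylReflection_smul, map_neg, LinearMap.neg_apply, neg_smul_neg]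

/-! ### The points -/

theorem frameReflection_injective : Function.Injective frameReflection := by
  intro i j h
  by_contra hij
  have h1 := frameReflection_smul_frame i i
  rw [h, frameReflection_smul_frame, if_neg (Ne.symm hij), if_pos rfl] at h1
  exact frame_ne_neg i h1

/-- Some `frame i` is not orthogonal to `α`, so the reflection moves it and must negate it; hence
`frame i` is proportional to `α`. -/
theorem eq_frame_of_weylReflection_mem {α : RootLattice} (hα : α ∈ roots)
    (h : weylReflection α hα ∈ frameSubgroup) : ∃ i, α = frame i ∨ α = -frame i := by
  obtain ⟨i, hi⟩ : ∃ i, form α (frame i) ≠ 0 := by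
    by_contra! hcon
    have h0 : α = 0 := eq_of_form_frame_eq fun i => by rw [hcon, map_zero, LinearMap.zero_apply]
    have h1 : form α α = 2 := hα
    rw [h0, map_zero] at h1
    exact absurd h1 (by decide)
  have hne : α ≠ 0 := by
    rintro rfl
    exact hi (by rw [map_zero, LinearMap.zero_apply])
  refine ⟨i, ?_⟩
  have h1 : form α (frame i) • α = (2 : ℤ) • frame i := by
    rcases h i with h2 | h2 <;> rw [weylReflection_smul] at h2
    · exact absurd (sub_eq_self.1 h2) (smul_ne_zero hi hne)
    · rw [sub_eq_iff_eq_add, ← sub_eq_iff_eq_add', sub_neg_eq_add] at h2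
      rw [two_smul, h2]
  have h3 := congrArg (fun x => form x (frame i)) h1
  simp only [map_smul, LinearMap.smul_apply, smul_eq_mul, form_frame_frame, if_true] at h3
  have h4 : form α (frame i) = 2 ∨ form α (frame i) = -2 := by
    have : (form α (frame i) - 2) * (form α (frame i) + 2) = 0 := by linarith
    rcases mul_eq_zero.1 this with h | h
    · left; omega
    · right; omega
  rcases h4 with h4 | h4 <;> rw [h4] at h1
  · exact Or.inl (smul_right_injective _ two_ne_zero h1)
  · refine Or.inr (smul_right_injective _ (two_ne_zero (α := ℤ)) ?_)
    change (2 : ℤ) • α = (2 : ℤ) • -frame i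
    rw [smul_neg, ← h1, neg_smul, neg_neg]

theorem points_frameSubgroup : points frameSubgroup = Set.range frameReflection := by
  ext s
  constructor
  · rintro ⟨hs, α, hα, h⟩
    obtain rfl : s = weylReflection α hα := Subtype.ext h
    obtain ⟨i, rfl | rfl⟩ := eq_frame_of_weylReflection_mem hα hs
    · exact ⟨i, rfl⟩
    · exact ⟨i, (weylReflection_neg _ _).symm⟩
  · rintro ⟨i, rfl⟩
    exact ⟨frameReflection_mem i, frame i, frame_mem_roots i, rfl⟩

theorem closure_points_frameSubgroup : Subgroup.closure (points frameSubgroup) = frameSubgroup := by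
  rw [points_frameSubgroup, closure_range_frameReflection]

/-! ### The lines -/

theorem mem_orbit_shapeRoot {α : RootLattice} {s : Fin 8 ⊕ ExtendedFanoLine} :
    α ∈ MulAction.orbit frameSubgroup (shapeRoot s) ↔
      ∀ i, (form α (frame i)).natAbs = shapeCoord s i := by
  constructor
  · rintro ⟨w, rfl⟩ i
    change (form (w.1 • shapeRoot s) (frame i)).natAbs = _
    rw [natAbs_form_smul w.2, form_shapeRoot, Int.natAbs_natCast]
  · intro h
    obtain ⟨w, hw, h⟩ := exists_smul_shapeRoot h
    exact ⟨⟨w, hw⟩, h⟩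

theorem orbit_shapeRoot_injective :
    Function.Injective fun s => MulAction.orbit frameSubgroup (shapeRoot s) := by
  intro s t h
  have h1 : shapeRoot s ∈ MulAction.orbit frameSubgroup (shapeRoot t) :=
    (Set.ext_iff.1 h _).1 (MulAction.mem_orbit_self _)
  exact shapeCoord_injective (funext fun i => by
    rw [← mem_orbit_shapeRoot.1 h1, form_shapeRoot, Int.natAbs_natCast])

theorem exists_orbit_eq {α : RootLattice} (hα : α ∈ roots) :
    ∃ s, MulAction.orbit frameSubgroup α = MulAction.orbit frameSubgroup (shapeRoot s) := by
  obtain ⟨s, hs⟩ := exists_natAbs_form_eq hα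
  exact ⟨s, MulAction.orbit_eq_iff.2 (mem_orbit_shapeRoot.2 hs)⟩

theorem orbit_frame (i : Fin 8) :
    MulAction.orbit frameSubgroup (frame i) = {frame i, -frame i} := by
  ext α
  constructor
  · rintro ⟨w, rfl⟩
    exact w.2 i
  · rintro (rfl | rfl)
    · exact MulAction.mem_orbit_self _
    · refine ⟨⟨frameReflection i, frameReflection_mem i⟩, ?_⟩
      change frameReflection i • frame i = _
      rw [frameReflection_smul_frame, if_pos rfl]

theorem form_frameReflection_smul_lineRoot (i j : Fin 8) (ℓ : ExtendedFanoLine) :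
    form (frameReflection i • lineRoot ℓ) (frame j) =
      if OnLine j ℓ then (if i = j then -1 else 1) else 0 := by
  have h0 : (frameReflection i)⁻¹ • frame j = if i = j then -frame j else frame j := by
    rw [inv_smul_eq_iff]
    by_cases h : i = j <;> simp [h, frameReflection_smul_frame]
  rw [form_smul_left, h0]
  by_cases h : i = j <;> by_cases h' : OnLine j ℓ <;> simp [h, h', form_lineRoot]

/-- A line has two distinct points. Changing the sign at only one of them gives a root that is
neither the original nor its negative. -/
theorem orbit_lineRoot_ne (ℓ : ExtendedFanoLine) (β : RootLattice) :
    MulAction.orbit frameSubgroup (lineRoot ℓ) ≠ {β, -β} := by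
  intro h
  obtain ⟨i, j, hi, hj, hij⟩ : ∃ i j, OnLine i ℓ ∧ OnLine j ℓ ∧ i ≠ j := by
    clear h
    revert ℓ
    decide +kernel
  have h1 : lineRoot ℓ ∈ ({β, -β} : Set RootLattice) := h ▸ MulAction.mem_orbit_self _
  have h2 : frameReflection i • lineRoot ℓ ∈ ({β, -β} : Set RootLattice) :=
    h ▸ ⟨⟨frameReflection i, frameReflection_mem i⟩, rfl⟩
  have h3 := form_frameReflection_smul_lineRoot i i ℓ
  have h4 := form_frameReflection_smul_lineRoot i j ℓ
  have h5 := form_lineRoot ℓ i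
  have h6 := form_lineRoot ℓ j
  rw [if_pos hi] at h3 h5
  rw [if_pos hj] at h4 h6
  rw [if_pos rfl] at h3
  rw [if_neg hij] at h4
  rcases h1 with h1 | h1 <;> rcases h2 with h2 | h2 <;> rw [h1] at h5 h6 <;> rw [h2] at h3 h4
  · omega
  · rw [map_neg, LinearMap.neg_apply] at h4
    omega
  · rw [map_neg, LinearMap.neg_apply] at h6
    omega
  · omega

theorem lines_frameSubgroup :
    lines frameSubgroup = Set.range fun ℓ => MulAction.orbit frameSubgroup (lineRoot ℓ) := by
  ext O
  constructor
  · rintro ⟨⟨α, hα, rfl⟩, h⟩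
    obtain ⟨i | ℓ, hs⟩ := exists_orbit_eq hα
    · exact absurd (hs.trans (orbit_frame i)) (h _ (frame_mem_roots i))
    · exact ⟨ℓ, hs.symm⟩
  · rintro ⟨ℓ, rfl⟩
    exact ⟨⟨_, lineRoot_mem_roots ℓ, rfl⟩, fun β _ => orbit_lineRoot_ne ℓ β⟩

/-- A reflection moves exactly the vectors not orthogonal to its root, and the absolute coordinates
are constant on the orbit. -/
theorem involves_orbit_lineRoot (ℓ : ExtendedFanoLine) (i : Fin 8) :
    Involves (MulAction.orbit frameSubgroup (lineRoot ℓ)) (frameReflection i) ↔ OnLine i ℓ := by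
  have key : ∀ x ∈ MulAction.orbit frameSubgroup (lineRoot ℓ),
      frameReflection i • x ≠ x ↔ OnLine i ℓ := by
    intro x hx
    have h1 := (mem_orbit_shapeRoot (s := Sum.inr ℓ)).1 hx i
    have h2 : frame i ≠ 0 := fun h => frame_ne_neg i (by rw [h, neg_zero])
    rw [frameReflection, weylReflection_smul, Ne, sub_eq_self, smul_eq_zero, or_iff_left h2,
      form_comm, ← Int.natAbs_eq_zero, h1, shapeCoord]
    split_ifs with h3 <;> simp [h3]
  exact ⟨fun ⟨x, hx, h⟩ => (key x hx).1 h,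
    fun h => ⟨lineRoot ℓ, MulAction.mem_orbit_self _, (key _ (MulAction.mem_orbit_self _)).2 h⟩⟩

/-- The points of the extended Fano plane in terms of the frame. -/
def fanoPoint (i : Fin 8) : ExtendedFanoPoint :=
  if h : label i = 0 then none else some ⟨label i, h⟩

theorem fanoPoint_bijective : Function.Bijective fanoPoint := by
  decide +kernel

theorem onLine_iff (i : Fin 8) (ℓ : ExtendedFanoLine) :
    OnLine i ℓ ↔ ExtendedFanoIncident (fanoPoint i) ℓ := by
  unfold fanoPoint
  split_ifs with h <;> rcases ℓ with l | l <;>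
    simp [OnLine, ExtendedFanoIncident, FanoIncident, h]

theorem exists_geometry_equiv_frameSubgroup :
    ∃ (e : points frameSubgroup ≃ ExtendedFanoPoint) (f : lines frameSubgroup ≃ ExtendedFanoLine),
      ∀ (s : points frameSubgroup) (O : lines frameSubgroup),
        Involves O.1 s.1 ↔ ExtendedFanoIncident (e s) (f O) := by
  let e' := (Equiv.ofInjective _ frameReflection_injective).trans
    (Equiv.setCongr points_frameSubgroup.symm)
  let f' := (Equiv.ofInjective (fun ℓ => MulAction.orbit frameSubgroup (lineRoot ℓ))
    (fun ℓ ℓ' h => Sum.inr_injective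
      (orbit_shapeRoot_injective (a₁ := Sum.inr ℓ) (a₂ := Sum.inr ℓ') h))).trans
      (Equiv.setCongr lines_frameSubgroup.symm)
  refine ⟨e'.symm.trans (Equiv.ofBijective _ fanoPoint_bijective), f'.symm, fun s O => ?_⟩
  obtain ⟨i, rfl⟩ := e'.surjective s
  obtain ⟨ℓ, rfl⟩ := f'.surjective O
  have h1 : (e'.symm.trans (Equiv.ofBijective _ fanoPoint_bijective)) (e' i) = fanoPoint i := by
    rw [Equiv.trans_apply, e'.symm_apply_apply, Equiv.ofBijective_apply]
  rw [f'.symm_apply_apply, h1, ← onLine_iff]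
  exact involves_orbit_lineRoot ℓ i

/-! ### Counting in a geometry isomorphic to the extended Fano plane -/

instance : DecidableRel ExtendedFanoIncident
  | none, Sum.inl _ => isTrue trivial
  | some p, Sum.inl l => inferInstanceAs (Decidable (l.1 ⬝ᵥ p.1 = 0))
  | none, Sum.inr _ => isFalse id
  | some p, Sum.inr l => inferInstanceAs (Decidable (¬ l.1 ⬝ᵥ p.1 = 0))

theorem ncard_sep_eq {α β : Type*} {A : Set α} (e : A ≃ β) {p : α → Prop} {q : β → Prop}
    (h : ∀ a : A, p a ↔ q (e a)) : {a ∈ A | p a}.ncard = Nat.card {b // q b} := by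
  rw [← Nat.card_coe_set_eq]
  refine Nat.card_congr ((Equiv.subtypeSubtypeEquivSubtypeInter (fun a => a ∈ A) p).symm.trans
    (e.subtypeEquiv h))

theorem ncards_of_geometry_equiv {M : Subgroup weylGroup} (e : points M ≃ ExtendedFanoPoint)
    (f : lines M ≃ ExtendedFanoLine)
    (h : ∀ (s : points M) (O : lines M), Involves O.1 s.1 ↔ ExtendedFanoIncident (e s) (f O)) :
    (points M).ncard = 8 ∧ (lines M).ncard = 14 ∧
      (∀ O ∈ lines M, {s ∈ points M | Involves O s}.ncard = 4) ∧
      ∀ s ∈ points M, {O ∈ lines M | Involves O s}.ncard = 7 := by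
  refine ⟨?_, ?_, fun O hO => ?_, fun s hs => ?_⟩
  · rw [← Nat.card_coe_set_eq, Nat.card_congr e, Nat.card_eq_fintype_card]
    decide +kernel
  · rw [← Nat.card_coe_set_eq, Nat.card_congr f, Nat.card_eq_fintype_card]
    decide +kernel
  · rw [ncard_sep_eq e (q := fun p => ExtendedFanoIncident p (f ⟨O, hO⟩)) fun s => h s ⟨O, hO⟩,
      Nat.card_eq_fintype_card]
    generalize f ⟨O, hO⟩ = ℓ
    revert ℓ
    decide +kernel
  · rw [ncard_sep_eq f (q := fun ℓ => ExtendedFanoIncident (e ⟨s, hs⟩) ℓ) fun O => h ⟨s, hs⟩ O,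
      Nat.card_eq_fintype_card]
    generalize e ⟨s, hs⟩ = p
    revert p
    decide +kernel

end EEight

section

open Equiv (swap)

/-! ### The affine group of the space of dimension three over the field with two elements -/

/-- The affine permutations of the space of dimension three over the field with two elements. -/
def affinePerm : Subgroup (Equiv.Perm (Fin 3 → ZMod 2)) where
  carrier := {σ | ∀ x y z, σ (x + y + z) = σ x + σ y + σ z}
  one_mem' _ _ _ := rfl
  mul_mem' {σ τ} hσ hτ x y z := by
    rw [Equiv.Perm.mul_apply, hτ, hσ]
    rfl
  inv_mem' {σ} hσ x y z := by
    have h : ∀ v, σ (σ⁻¹ v) = v := σ.apply_symm_apply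
    rw [Equiv.Perm.inv_eq_iff_eq, hσ, h, h, h]

/-- To fix one more point `k`, multiply by a double transposition that takes `σ k` to `k`; `hP`
supplies a second pair completing the plane away from the points already fixed. -/
theorem exists_mul_fix {H : Subgroup (Equiv.Perm (Fin 3 → ZMod 2))}
    (hH : ∀ x y z, x ≠ y → x ≠ z → y ≠ z → swap x y * swap z (x + y + z) ∈ H)
    {P : Finset (Fin 3 → ZMod 2)} {k : Fin 3 → ZMod 2} (hk : k ∉ P)
    (hP : ∀ b, b ∉ P → b ≠ k → ∃ z, b ≠ z ∧ k ≠ z ∧ z ∉ P ∧ b + k + z ∉ P ∧ k ≠ b + k + z)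
    {σ : Equiv.Perm (Fin 3 → ZMod 2)} (hσ : ∀ p ∈ P, σ p = p) :
    ∃ h ∈ H, ∀ p ∈ insert k P, (h * σ) p = p := by
  have hb : σ k ∉ P := fun h => hk (by rwa [← σ.injective (hσ _ h)])
  by_cases hbk : σ k = k
  · refine ⟨1, one_mem _, fun p hp => ?_⟩
    rw [one_mul]
    rcases Finset.mem_insert.1 hp with rfl | hp
    exacts [hbk, hσ p hp]
  · obtain ⟨z, h1, h2, h3, h4, h5⟩ := hP _ hb hbk
    refine ⟨_, hH _ _ _ hbk h1 h2, fun p hp => ?_⟩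
    have hne : ∀ {p q}, p ∈ P → q ∉ P → p ≠ q := fun hp hq h => hq (h ▸ hp)
    rw [Equiv.Perm.mul_apply, Equiv.Perm.mul_apply]
    rcases Finset.mem_insert.1 hp with rfl | hp
    · rw [Equiv.swap_apply_of_ne_of_ne (a := z) h1, Equiv.swap_apply_left]
      intro h
      have key : ∀ b k z : Fin 3 → ZMod 2, b = b + k + z → k = z := by decide +kernel
      exact h2 (key _ _ _ h)
    · rw [hσ p hp, Equiv.swap_apply_of_ne_of_ne (hne hp h3) (hne hp h4),
        Equiv.swap_apply_of_ne_of_ne (hne hp hb) (hne hp hk)]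

set_option synthInstance.maxSize 1000 in
set_option synthInstance.maxHeartbeats 400000 in
/-- The affine group is generated by the double transpositions of planes. -/
theorem affinePerm_le {H : Subgroup (Equiv.Perm (Fin 3 → ZMod 2))}
    (hH : ∀ x y z, x ≠ y → x ≠ z → y ≠ z → swap x y * swap z (x + y + z) ∈ H)
    (hHA : H ≤ affinePerm) : affinePerm ≤ H := by
  intro σ hσ
  obtain ⟨h1, hh1, hf1⟩ := exists_mul_fix hH (P := ∅) (k := 0) (by decide) (by decide +kernel)
    (σ := σ) (by simp)
  obtain ⟨h2, hh2, hf2⟩ := exists_mul_fix hH (k := ![1, 0, 0]) (by decide) (by decide +kernel) hf1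
  obtain ⟨h3, hh3, hf3⟩ := exists_mul_fix hH (k := ![0, 1, 0]) (by decide) (by decide +kernel) hf2
  have hA3 : h3 * (h2 * (h1 * σ)) ∈ affinePerm :=
    mul_mem (hHA hh3) (mul_mem (hHA hh2) (mul_mem (hHA hh1) hσ))
  -- The fourth point of the plane through the three fixed ones is fixed because the map is affine,
  -- so the next double transposition has to avoid it too.
  obtain ⟨h4, hh4, hf4⟩ := exists_mul_fix hH (P := {![0, 1, 0], ![1, 0, 0], 0, ![1, 1, 0]})
    (k := ![0, 0, 1]) (by decide) (by decide +kernel) (σ := h3 * (h2 * (h1 * σ))) (by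
      intro p hp
      simp only [Finset.mem_insert, Finset.mem_singleton] at hp
      rcases hp with rfl | rfl | rfl | rfl
      · exact hf3 _ (by decide)
      · exact hf3 _ (by decide)
      · exact hf3 _ (by decide)
      · have := hA3 ![0, 1, 0] ![1, 0, 0] 0
        rw [hf3 ![0, 1, 0] (by decide), hf3 ![1, 0, 0] (by decide), hf3 0 (by decide)] at this
        rwa [show (![1, 1, 0] : Fin 3 → ZMod 2) = ![0, 1, 0] + ![1, 0, 0] + 0 by decide])
  have hA4 := mul_mem (hHA hh4) hA3
  have h : h4 * (h3 * (h2 * (h1 * σ))) = 1 := by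
    refine Equiv.ext fun v => ?_
    obtain ⟨x, y, z, hx, hy, hz, rfl⟩ : ∃ x y z, x ∈ insert ![0, 0, 1]
        ({![0, 1, 0], ![1, 0, 0], 0, ![1, 1, 0]} : Finset (Fin 3 → ZMod 2)) ∧
        y ∈ insert ![0, 0, 1]
        ({![0, 1, 0], ![1, 0, 0], 0, ![1, 1, 0]} : Finset (Fin 3 → ZMod 2)) ∧
        z ∈ insert ![0, 0, 1]
        ({![0, 1, 0], ![1, 0, 0], 0, ![1, 1, 0]} : Finset (Fin 3 → ZMod 2)) ∧ v = x + y + z := by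
      clear * -
      revert v
      decide +kernel
    rw [hA4, hf4 x hx, hf4 y hy, hf4 z hz]
    rfl
  have h' := mul_mem hh4 (mul_mem hh3 (mul_mem hh2 hh1))
  have h'' : h4 * (h3 * (h2 * h1)) * σ = 1 := by simpa only [mul_assoc] using h
  rw [eq_inv_of_mul_eq_one_right h'']
  exact inv_mem h'

namespace EEight

/-! ### The normalizer of `frameSubgroup` permutes the frame -/

theorem frame_eq_or_eq_neg {i j : Fin 8} (h : frame i = frame j ∨ frame i = -frame j) : i = j := by
  by_contra hij
  have h1 := form_frame_frame i j
  rw [if_neg hij] at h1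
  have h2 := form_frame_frame j j
  rw [if_pos rfl] at h2
  rcases h with h | h
  · rw [h] at h1
    omega
  · rw [h, map_neg, LinearMap.neg_apply] at h1
    omega

theorem weylReflection_smul_eq_conj (w : weylGroup) {α : RootLattice} (hα : α ∈ roots) :
    weylReflection (w • α) (smul_mem_roots w hα) = w * weylReflection α hα * w⁻¹ :=
  weyl_ext fun x => by
    rw [mul_smul, mul_smul, weylReflection_smul, weylReflection_smul, smul_sub, smul_inv_smul,
      smul_comm w, form_smul_left]

/-- Conjugation by `w` takes the reflection in `frame i` to the reflection in `w • frame i`, and the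
reflections in `frameSubgroup` are known. -/
theorem exists_smul_frame_eq {w : weylGroup}
    (hw : w ∈ Subgroup.normalizer (frameSubgroup : Set weylGroup)) (i : Fin 8) :
    ∃ j, w • frame i = frame j ∨ w • frame i = -frame j := by
  refine eq_frame_of_weylReflection_mem (smul_mem_roots w (frame_mem_roots i)) ?_
  rw [weylReflection_smul_eq_conj w (frame_mem_roots i)]
  exact (Subgroup.mem_normalizer_iff.1 hw _).1 (frameReflection_mem i)

/-- The permutation of the frame induced by an element of the normalizer, up to signs. -/
noncomputable def framePerm :
    Subgroup.normalizer (frameSubgroup : Set weylGroup) →* Equiv.Perm (Fin 8) :=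
  MonoidHom.toHomPerm
    { toFun := fun w i => (exists_smul_frame_eq w.2 i).choose
      map_one' := funext fun i => by
        have h := (exists_smul_frame_eq (one_mem _) i).choose_spec
        simp only [one_smul] at h
        exact (frame_eq_or_eq_neg h).symm
      map_mul' := fun a b => funext fun i => by
        have h1 := (exists_smul_frame_eq b.2 i).choose_spec
        have h2 := (exists_smul_frame_eq a.2 (exists_smul_frame_eq b.2 i).choose).choose_spec
        have h3 := (exists_smul_frame_eq (a * b).2 i).choose_spec
        refine frame_eq_or_eq_neg ?_
        change _ = frame (exists_smul_frame_eq a.2 (exists_smul_frame_eq b.2 i).choose).choose ∨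
          _ = -frame (exists_smul_frame_eq a.2 (exists_smul_frame_eq b.2 i).choose).choose
        change (a.1 * b.1) • frame i = _ ∨ (a.1 * b.1) • frame i = _ at h3
        rw [mul_smul] at h3
        generalize (exists_smul_frame_eq a.2 (exists_smul_frame_eq b.2 i).choose).choose = k at *
        generalize (exists_smul_frame_eq b.2 i).choose = j at *
        generalize (exists_smul_frame_eq (a * b).2 i).choose = l at *
        rcases h1 with h1 | h1 <;> rw [h1] at h3 <;> rcases h2 with h2 | h2
        · rw [h2] at h3
          exact h3.imp Eq.symm fun h => by rw [h, neg_neg]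
        · rw [h2] at h3
          exact h3.symm.imp (fun h => (neg_injective h).symm) Eq.symm
        · rw [smul_neg, h2] at h3
          exact h3.symm.imp (fun h => (neg_injective h).symm) Eq.symm
        · rw [smul_neg, h2, neg_neg] at h3
          exact h3.imp Eq.symm fun h => by rw [h, neg_neg] }

theorem smul_frame_eq_framePerm (w : Subgroup.normalizer (frameSubgroup : Set weylGroup))
    (i : Fin 8) :
    w.1 • frame i = frame (framePerm w i) ∨ w.1 • frame i = -frame (framePerm w i) :=
  (exists_smul_frame_eq w.2 i).choose_spec

theorem framePerm_eq {w : Subgroup.normalizer (frameSubgroup : Set weylGroup)} {i j : Fin 8}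
    (h : w.1 • frame i = frame j ∨ w.1 • frame i = -frame j) : framePerm w i = j := by
  refine frame_eq_or_eq_neg ?_
  rcases smul_frame_eq_framePerm w i with h1 | h1 <;> rw [h1] at h
  · exact h
  · rcases h with h | h
    · exact Or.inr (by rw [← h, neg_neg])
    · exact Or.inl (neg_injective h)

theorem ker_framePerm : framePerm.ker =
    frameSubgroup.subgroupOf (Subgroup.normalizer (frameSubgroup : Set weylGroup)) := by
  ext w
  rw [MonoidHom.mem_ker, Subgroup.mem_subgroupOf]
  constructor
  · intro h i
    simpa [h] using smul_frame_eq_framePerm w i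
  · intro h
    exact Equiv.ext fun i => framePerm_eq (h i)

theorem natAbs_form_smul_framePerm (w : Subgroup.normalizer (frameSubgroup : Set weylGroup))
    (x : RootLattice) (i : Fin 8) :
    (form (w.1 • x) (frame (framePerm w i))).natAbs = (form x (frame i)).natAbs := by
  rw [← form_apply_apply w.1 x]
  rcases smul_frame_eq_framePerm w i with h | h <;> rw [h]
  rw [map_neg, Int.natAbs_neg]

/-- The image of a line root is again a root, and its absolute coordinates are permuted with the
frame; so the image of a line is the support of a root of the second kind. -/
theorem exists_line_framePerm (w : Subgroup.normalizer (frameSubgroup : Set weylGroup))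
    (ℓ : ExtendedFanoLine) : ∃ ℓ', ∀ i, OnLine (framePerm w i) ℓ' ↔ OnLine i ℓ := by
  have h : ∀ i, (form (w.1 • lineRoot ℓ) (frame (framePerm w i))).natAbs =
      if OnLine i ℓ then 1 else 0 := fun i => by
    rw [natAbs_form_smul_framePerm, form_lineRoot]
    split_ifs <;> rfl
  obtain ⟨j | ℓ', hs⟩ := exists_natAbs_form_eq (smul_mem_roots w.1 (lineRoot_mem_roots ℓ))
  · have h1 := h ((framePerm w).symm j)
    rw [Equiv.apply_symm_apply, hs, shapeCoord, if_pos rfl] at h1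
    split_ifs at h1
    omega
  · refine ⟨ℓ', fun i => ?_⟩
    have h1 := h i
    rw [hs, shapeCoord] at h1
    split_ifs at h1 <;> simp_all

/-- The labelling of the frame by the space over the field with two elements. -/
noncomputable def labelEquiv : Fin 8 ≃ (Fin 3 → ZMod 2) :=
  Equiv.ofBijective label (by decide +kernel)

theorem exists_line {a b c d : Fin 8} (hab : a ≠ b) (hac : a ≠ c) (hbc : b ≠ c)
    (h : label d = label a + label b + label c) :
    ∃ ℓ, ∀ i, OnLine i ℓ ↔ i = a ∨ i = b ∨ i = c ∨ i = d := by
  revert a b c d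
  decide +kernel

set_option synthInstance.maxSize 1000 in
set_option synthInstance.maxHeartbeats 400000 in
theorem label_eq_of_onLine (ℓ : ExtendedFanoLine) {a b c d : Fin 8} (hab : a ≠ b) (hac : a ≠ c)
    (hbc : b ≠ c) (had : a ≠ d) (hbd : b ≠ d) (hcd : c ≠ d) (ha : OnLine a ℓ) (hb : OnLine b ℓ)
    (hc : OnLine c ℓ) (hd : OnLine d ℓ) : label d = label a + label b + label c := by
  have key : ∀ ℓ, ∀ a, OnLine a ℓ → ∀ b, OnLine b ℓ → a ≠ b → ∀ c, OnLine c ℓ → a ≠ c → b ≠ c →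
      ∀ d, OnLine d ℓ → a ≠ d → b ≠ d → c ≠ d → label d = label a + label b + label c := by
    decide +kernel
  exact key ℓ a ha b hb hab c hc hac hbc d hd had hbd hcd

theorem ne_of_label_eq {a b c d : Fin 8} (hab : a ≠ b) (hac : a ≠ c) (hbc : b ≠ c)
    (h : label d = label a + label b + label c) : a ≠ d ∧ b ≠ d ∧ c ≠ d := by
  revert a b c d
  decide +kernel

/-- Planes go to planes. Four distinct labels form a plane exactly when they sum to zero, so this is
the affine condition; coinciding labels are trivial. -/
theorem label_framePerm (w : Subgroup.normalizer (frameSubgroup : Set weylGroup))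
    {a b c d : Fin 8} (h : label d = label a + label b + label c) :
    label (framePerm w d) =
      label (framePerm w a) + label (framePerm w b) + label (framePerm w c) := by
  have hV : ∀ x y : Fin 3 → ZMod 2, x + x + y = y ∧ x + y + x = y ∧ y + x + x = y := by
    decide +kernel
  have hl : Function.Injective label := labelEquiv.injective
  by_cases hab : a = b
  · subst hab
    rw [(hV _ _).1] at h
    rw [(hV _ _).1, hl h]
  by_cases hac : a = c
  · subst hac
    rw [(hV _ _).2.1] at h
    rw [(hV _ _).2.1, hl h]
  by_cases hbc : b = c
  · subst hbc
    rw [(hV _ _).2.2] at h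
    rw [(hV _ _).2.2, hl h]
  obtain ⟨ℓ, hℓ⟩ := exists_line hab hac hbc h
  obtain ⟨had, hbd, hcd⟩ := ne_of_label_eq hab hac hbc h
  obtain ⟨ℓ', hℓ'⟩ := exists_line_framePerm w ℓ
  have hne : ∀ {i j}, i ≠ j → framePerm w i ≠ framePerm w j := fun h h' =>
    h ((framePerm w).injective h')
  refine label_eq_of_onLine ℓ' (hne hab) (hne hac) (hne hbc) (hne had) (hne hbd) (hne hcd)
    ?_ ?_ ?_ ?_ <;> rw [hℓ', hℓ] <;> simp

/-- The action of the normalizer on the labels of the frame. -/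
noncomputable def labelPerm :
    Subgroup.normalizer (frameSubgroup : Set weylGroup) →* Equiv.Perm (Fin 3 → ZMod 2) :=
  labelEquiv.permCongrHom.toMonoidHom.comp framePerm

theorem labelPerm_label (w : Subgroup.normalizer (frameSubgroup : Set weylGroup)) (i : Fin 8) :
    labelPerm w (label i) = label (framePerm w i) := by
  change labelEquiv (framePerm w (labelEquiv.symm (labelEquiv i))) = _
  rw [Equiv.symm_apply_apply]
  rfl

theorem labelPerm_mem_affinePerm (w : Subgroup.normalizer (frameSubgroup : Set weylGroup)) :
    labelPerm w ∈ affinePerm := by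
  intro x y z
  obtain ⟨a, rfl⟩ := labelEquiv.surjective x
  obtain ⟨b, rfl⟩ := labelEquiv.surjective y
  obtain ⟨c, rfl⟩ := labelEquiv.surjective z
  obtain ⟨d, hd⟩ := labelEquiv.surjective (labelEquiv a + labelEquiv b + labelEquiv c)
  change labelPerm w (label a + label b + label c) =
    labelPerm w (label a) + labelPerm w (label b) + labelPerm w (label c)
  have hd' : label d = label a + label b + label c := hd
  rw [← hd']
  simp only [labelPerm_label]
  exact label_framePerm w hd'

theorem mem_normalizer_of_smul_frame {w : weylGroup} {σ : Equiv.Perm (Fin 8)}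
    (h : ∀ i, w • frame i = frame (σ i)) :
    w ∈ Subgroup.normalizer (frameSubgroup : Set weylGroup) := by
  have h' : ∀ i, w⁻¹ • frame i = frame (σ.symm i) := fun i => by
    rw [inv_smul_eq_iff, h, Equiv.apply_symm_apply]
  refine Subgroup.mem_normalizer_iff.2 fun g => ⟨fun hg i => ?_, fun hg i => ?_⟩
  · rw [mul_smul, mul_smul, h']
    rcases hg (σ.symm i) with h1 | h1 <;> rw [h1]
    · exact Or.inl (by rw [h, Equiv.apply_symm_apply])
    · exact Or.inr (by rw [smul_neg, h, Equiv.apply_symm_apply])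
  · have h1 := hg (σ i)
    rw [mul_smul, mul_smul, h', Equiv.symm_apply_apply, ← h, ← smul_neg] at h1
    exact h1.imp (smul_left_cancel w) (smul_left_cancel w)

/-- The double transpositions of planes are induced by the Weyl group. -/
theorem exists_smul_frame_eq_swap {a b c d : Fin 8} (hab : a ≠ b) (hac : a ≠ c) (hbc : b ≠ c)
    (h : label d = label a + label b + label c) :
    ∃ w : weylGroup, ∀ i, w • frame i = frame ((swap a b * swap c d) i) := by
  obtain ⟨had, hbd, hcd⟩ := ne_of_label_eq hab hac hbc h
  obtain ⟨ℓ, hℓ⟩ := exists_line hab hac hbc h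
  -- Writing the frame roots by their indices, `u = (a - b - c + d) / 2` and `v = (a - b + c - d) /
  -- 2` are orthogonal roots with `u + v = a - b` and `u - v = d - c`; the product of their
  -- reflections is the double transposition.
  obtain ⟨u, hu⟩ : ∃ u : RootLattice, u = frameReflection b • frameReflection c • lineRoot ℓ :=
    ⟨_, rfl⟩
  obtain ⟨v, hv⟩ : ∃ v : RootLattice, v = frameReflection b • frameReflection d • lineRoot ℓ :=
    ⟨_, rfl⟩
  have hur : u ∈ roots := hu ▸ smul_mem_roots _ (smul_mem_roots _ (lineRoot_mem_roots ℓ))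
  have hvr : v ∈ roots := hv ▸ smul_mem_roots _ (smul_mem_roots _ (lineRoot_mem_roots ℓ))
  have hline : (2 : ℤ) • lineRoot ℓ = frame a + frame b + frame c + frame d := by
    refine eq_of_form_frame_eq fun i => ?_
    simp only [map_smul, map_add, LinearMap.smul_apply, LinearMap.add_apply, form_lineRoot,
      form_frame_frame, hℓ]
    by_cases h1 : i = a <;> by_cases h2 : i = b <;> by_cases h3 : i = c <;>
      by_cases h4 : i = d <;> simp_all [eq_comm]
  have hfl : ∀ i, form (frame i) (lineRoot ℓ) = if OnLine i ℓ then 1 else 0 := fun i => by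
    rw [form_comm, form_lineRoot]
  have hue : u = lineRoot ℓ - frame b - frame c := by
    simp only [hu, frameReflection, weylReflection_smul, map_sub, map_smul, smul_eq_mul, hfl,
      form_frame_frame, hℓ, hbc]
    simp
    abel
  have hve : v = lineRoot ℓ - frame b - frame d := by
    simp only [hv, frameReflection, weylReflection_smul, map_sub, map_smul, smul_eq_mul, hfl,
      form_frame_frame, hℓ, hbd]
    simp
    abel
  have hll : form (lineRoot ℓ) (lineRoot ℓ) = 2 := lineRoot_mem_roots ℓ
  have huv : form u v = 0 := by
    simp only [hue, hve, map_sub, LinearMap.sub_apply, hll, form_lineRoot, hfl, form_frame_frame,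
      hℓ]
    simp [hbc.symm, hbd, hcd]
  have hun : ∀ i, form u (frame i) = (if i = a ∨ i = b ∨ i = c ∨ i = d then 1 else 0) -
      (if b = i then 2 else 0) - if c = i then 2 else 0 := fun i => by
    simp only [hue, map_sub, LinearMap.sub_apply, form_lineRoot, form_frame_frame, hℓ]
  have hvn : ∀ i, form v (frame i) = (if i = a ∨ i = b ∨ i = c ∨ i = d then 1 else 0) -
      (if b = i then 2 else 0) - if d = i then 2 else 0 := fun i => by
    simp only [hve, map_sub, LinearMap.sub_apply, form_lineRoot, form_frame_frame, hℓ]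
  have hline' : lineRoot ℓ + lineRoot ℓ = frame a + frame b + frame c + frame d := by
    rw [← hline, two_smul]
  refine ⟨weylReflection u hur * weylReflection v hvr, fun i => ?_⟩
  rw [mul_smul, weylReflection_smul, weylReflection_smul, map_sub, map_smul, huv, smul_zero,
    sub_zero, hun, hvn, Equiv.Perm.mul_apply]
  have hpt : ∀ k, lineRoot ℓ k + lineRoot ℓ k = frame a k + frame b k + frame c k + frame d k :=
    fun k => congrFun hline' k
  by_cases h1 : i = a
  · subst h1
    rw [Equiv.swap_apply_of_ne_of_ne hac had, Equiv.swap_apply_left]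
    simp only [true_or, if_true, hab.symm, hac.symm, had.symm, if_false]
    ext k
    have := hpt k
    simp only [hue, hve, Pi.sub_apply, Pi.smul_apply, smul_eq_mul]
    omega
  by_cases h2 : i = b
  · subst h2
    rw [Equiv.swap_apply_of_ne_of_ne hbc hbd, Equiv.swap_apply_right]
    simp only [true_or, or_true, if_true, hbc.symm, hbd.symm, if_false]
    ext k
    have := hpt k
    simp only [hue, hve, Pi.sub_apply, Pi.smul_apply, smul_eq_mul]
    omega
  by_cases h3 : i = c
  · subst h3
    rw [Equiv.swap_apply_left, Equiv.swap_apply_of_ne_of_ne had.symm hbd.symm]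
    simp only [true_or, or_true, if_true, hbc, hcd.symm, if_false]
    ext k
    simp only [hue, hve, Pi.sub_apply, Pi.smul_apply, smul_eq_mul]
    omega
  by_cases h4 : i = d
  · subst h4
    rw [Equiv.swap_apply_right, Equiv.swap_apply_of_ne_of_ne hac.symm hbc.symm]
    simp only [or_true, if_true, hbd, hcd, if_false]
    ext k
    simp only [hue, hve, Pi.sub_apply, Pi.smul_apply, smul_eq_mul]
    omega
  · rw [Equiv.swap_apply_of_ne_of_ne h3 h4, Equiv.swap_apply_of_ne_of_ne h1 h2]
    simp [h1, h2, h3, h4, Ne.symm h2, Ne.symm h3, Ne.symm h4]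

theorem swap_mul_swap_mem_range_labelPerm (x y z : Fin 3 → ZMod 2) (hxy : x ≠ y) (hxz : x ≠ z)
    (hyz : y ≠ z) : swap x y * swap z (x + y + z) ∈ labelPerm.range := by
  obtain ⟨a, rfl⟩ := labelEquiv.surjective x
  obtain ⟨b, rfl⟩ := labelEquiv.surjective y
  obtain ⟨c, rfl⟩ := labelEquiv.surjective z
  obtain ⟨d, hd⟩ := labelEquiv.surjective (labelEquiv a + labelEquiv b + labelEquiv c)
  obtain ⟨w, hw⟩ := exists_smul_frame_eq_swap (fun h => hxy (congrArg _ h))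
    (fun h => hxz (congrArg _ h)) (fun h => hyz (congrArg _ h)) hd
  refine ⟨⟨w, mem_normalizer_of_smul_frame hw⟩, Equiv.ext fun v => ?_⟩
  obtain ⟨i, rfl⟩ := labelEquiv.surjective v
  refine (labelPerm_label _ i).trans ?_
  rw [framePerm_eq (Or.inl (hw i)), ← hd]
  change labelEquiv _ = _
  rw [Equiv.Perm.mul_apply, Equiv.Perm.mul_apply, labelEquiv.injective.swap_apply,
    labelEquiv.injective.swap_apply]

theorem range_labelPerm : labelPerm.range = affinePerm := by
  have h : labelPerm.range ≤ affinePerm := by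
    rintro _ ⟨w, rfl⟩
    exact labelPerm_mem_affinePerm w
  exact le_antisymm h (affinePerm_le swap_mul_swap_mem_range_labelPerm h)

/-- The discrete Weyl group of `frameSubgroup` is the affine group. -/
theorem nonempty_discreteWeylGroup_equiv :
    Nonempty (DiscreteWeylGroup frameSubgroup ≃* affinePerm) := by
  have hker : labelPerm.ker =
      frameSubgroup.subgroupOf (Subgroup.normalizer (frameSubgroup : Set weylGroup)) := by
    rw [← ker_framePerm]
    exact MonoidHom.ker_mulEquiv_comp framePerm labelEquiv.permCongrHom
  exact ⟨(QuotientGroup.quotientMulEquivOfEq hker.symm).trans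
    ((QuotientGroup.quotientKerEquivRange labelPerm).trans
      (MulEquiv.subgroupCongr range_labelPerm))⟩

end EEight

end

section

open Matrix
open scoped MatrixGroups

/-! ### The projective line over the field with seven elements as an affine space -/

theorem fact_prime_seven : Fact (Nat.Prime 7) := ⟨by norm_num⟩

attribute [local instance] fact_prime_seven

/-- The projective line over the field with seven elements, labelled by the space of dimension
three over the field with two elements: the powers of a generator of the multiplicative group of
the field with eight elements label the finite points. -/
def projectiveLabel : OnePoint (ZMod 7) ≃ (Fin 3 → ZMod 2) where
  toFun x := Option.elim x 0
    ![![1, 0, 0], ![0, 1, 0], ![0, 0, 1], ![1, 1, 0], ![0, 1, 1], ![1, 1, 1], ![1, 0, 1]]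
  invFun v := ![none, some (0 : ZMod 7), some 1, some 3, some 2, some 6, some 4, some 5]
    (Fin.ofNat 8 ((v 0).val + 2 * (v 1).val + 4 * (v 2).val))
  left_inv := by
    have key : ∀ x : Option (ZMod 7), (![none, some 0, some 1, some 3, some 2, some 6, some 4,
        some 5] : Fin 8 → Option (ZMod 7)) ((fun v : Fin 3 → ZMod 2 =>
          Fin.ofNat 8 ((v 0).val + 2 * (v 1).val + 4 * (v 2).val)) (Option.elim x 0
            ![![1, 0, 0], ![0, 1, 0], ![0, 0, 1], ![1, 1, 0], ![0, 1, 1], ![1, 1, 1],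
              ![1, 0, 1]])) = x := by
      decide +kernel
    exact key
  right_inv v := by
    revert v
    decide +kernel

/-- The Möbius transformation with the given coefficients; the inverse of a nonzero element
is its fifth power. -/
def moebius (a b c d : ZMod 7) : Option (ZMod 7) → Option (ZMod 7)
  | none => if c = 0 then none else some (a * c ^ 5)
  | some k => if c * k + d = 0 then none else some ((a * k + b) * (c * k + d) ^ 5)

/-- Finite points are labelled by powers of a generator of the field with eight elements, so a
translation of `F₇` becomes multiplication by a power and is even linear. -/
theorem moebius_upper_affine (c : ZMod 7) (x y z : Fin 3 → ZMod 2) :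
    projectiveLabel (moebius 1 c 0 1 (projectiveLabel.symm (x + y + z))) =
      projectiveLabel (moebius 1 c 0 1 (projectiveLabel.symm x)) +
      projectiveLabel (moebius 1 c 0 1 (projectiveLabel.symm y)) +
      projectiveLabel (moebius 1 c 0 1 (projectiveLabel.symm z)) := by
  revert c x y z
  decide +kernel

/-- For nonzero `c` these maps move `∞`, which has label zero, so they are affine but not linear. -/
theorem moebius_lower_affine (c : ZMod 7) (x y z : Fin 3 → ZMod 2) :
    projectiveLabel (moebius 1 0 c 1 (projectiveLabel.symm (x + y + z))) =
      projectiveLabel (moebius 1 0 c 1 (projectiveLabel.symm x)) +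
      projectiveLabel (moebius 1 0 c 1 (projectiveLabel.symm y)) +
      projectiveLabel (moebius 1 0 c 1 (projectiveLabel.symm z)) := by
  revert c x y z
  decide +kernel

theorem toGL_smul_eq_moebius (g : SL(2, ZMod 7)) (x : OnePoint (ZMod 7)) :
    Matrix.SpecialLinearGroup.toGL g • x = moebius (g 0 0) (g 0 1) (g 1 0) (g 1 1) x := by
  have hinv : ∀ a : ZMod 7, a ≠ 0 → a⁻¹ = a ^ 5 := fun a ha =>
    (eq_inv_of_mul_eq_one_left ((by decide : ∀ a : ZMod 7, a ≠ 0 → a ^ 5 * a = 1) a ha)).symm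
  induction x using OnePoint.rec with
  | infty =>
    rw [OnePoint.smul_infty_eq_ite]
    by_cases h : g 1 0 = 0
    · exact (if_pos h).trans (if_pos h).symm
    · refine (if_neg h).trans (Eq.trans ?_ (if_neg h).symm)
      exact congrArg some (show g 0 0 / g 1 0 = g 0 0 * g 1 0 ^ 5 by
        rw [div_eq_mul_inv, hinv _ h])
  | coe k =>
    rw [OnePoint.smul_some_eq_ite]
    by_cases h : g 1 0 * k + g 1 1 = 0
    · exact (if_pos h).trans (if_pos h).symm
    · refine (if_neg h).trans (Eq.trans ?_ (if_neg h).symm)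
      exact congrArg some (show (g 0 0 * k + g 0 1) / (g 1 0 * k + g 1 1) = (g 0 0 * k + g 0 1) * (g 1 0 * k + g 1 1) ^ 5 by
        rw [div_eq_mul_inv, hinv _ h])

/-- The action of `SL(2, 7)` on the labels of the projective line. -/
noncomputable def slPerm : SL(2, ZMod 7) →* Equiv.Perm (Fin 3 → ZMod 2) :=
  projectiveLabel.permCongrHom.toMonoidHom.comp
    ((MulAction.toPermHom (GL (Fin 2) (ZMod 7)) (OnePoint (ZMod 7))).comp
      Matrix.SpecialLinearGroup.toGL)

theorem slPerm_apply (g : SL(2, ZMod 7)) (v : Fin 3 → ZMod 2) : slPerm g v =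
    projectiveLabel (moebius (g 0 0) (g 0 1) (g 1 0) (g 1 1) (projectiveLabel.symm v)) :=
  congrArg projectiveLabel (toGL_smul_eq_moebius g _)

theorem slPerm_mem_affinePerm (g : SL(2, ZMod 7)) : slPerm g ∈ affinePerm := by
  induction g using SL2.transvection_induction with
  | htransvec i j h c =>
    intro x y z
    simp only [slPerm_apply]
    fin_cases i <;> fin_cases j
    · exact absurd rfl h
    · simpa [SpecialLinearGroup.transvection_coe] using moebius_upper_affine c x y z
    · simpa [SpecialLinearGroup.transvection_coe] using moebius_lower_affine c x y z
    · exact absurd rfl h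
  | hmul A B hA hB =>
    rw [map_mul]
    exact mul_mem hA hB

theorem slPerm_eq_one {g : SL(2, ZMod 7)} (hg : g ∈ Subgroup.center SL(2, ZMod 7)) :
    slPerm g = 1 := by
  obtain ⟨r, hr, h⟩ := Matrix.SpecialLinearGroup.mem_center_iff.1 hg
  refine Equiv.ext fun v => ?_
  have key : ∀ r : ZMod 7, r ^ 2 = 1 → ∀ v, projectiveLabel (moebius r 0 0 r
      (projectiveLabel.symm v)) = v := by
    decide +kernel
  have h' : ∀ i j, g i j = Matrix.scalar (Fin 2) r i j := fun i j => by rw [h]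
  simp only [slPerm_apply, h']
  simpa using key r (by simpa using hr) v

/-- The action of `PSL(2, 7)` on the labels of the projective line. -/
noncomputable def pslAffine : Matrix.ProjectiveSpecialLinearGroup (Fin 2) (ZMod 7) →* affinePerm :=
  QuotientGroup.lift _ (slPerm.codRestrict affinePerm slPerm_mem_affinePerm) fun _ hg =>
    Subtype.ext (slPerm_eq_one hg)

/-! ### The affine group as a semidirect product -/

/-- The translations. -/
def translation : (Fin 3 → Multiplicative (ZMod 2)) →* affinePerm where
  toFun t := ⟨Equiv.addLeft fun i => (t i).toAdd, fun x y z => by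
    have key : ∀ t x y z : ZMod 2, t + (x + y + z) = t + x + (t + y) + (t + z) := by decide
    exact funext fun i => key _ _ _ _⟩
  map_one' := Subtype.ext (Equiv.ext fun v => zero_add v)
  map_mul' s t := Subtype.ext (Equiv.ext fun v => add_assoc _ _ v)

theorem translation_apply (t : Fin 3 → Multiplicative (ZMod 2)) (v : Fin 3 → ZMod 2) (i : Fin 3) :
    (translation t).1 v i = (t i).toAdd + v i := rfl

theorem translation_injective : Function.Injective translation := fun s t h => funext fun i => by
  have := congrFun (congrArg (fun σ : affinePerm => σ.1 0) h) i
  simpa [translation_apply] using this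

theorem range_translation_normal : translation.range.Normal := by
  refine ⟨?_⟩
  rintro _ ⟨t, rfl⟩ σ
  refine ⟨fun i => Multiplicative.ofAdd ((σ.1 fun i => (t i).toAdd) i + σ.1 0 i),
    Subtype.ext (Equiv.ext fun v => ?_)⟩
  change _ = σ.1 ((fun i => (t i).toAdd) + σ.1.symm v)
  have h := σ.2 (fun i => (t i).toAdd) (σ.1.symm v) 0
  rw [add_zero, Equiv.apply_symm_apply] at h
  rw [h]
  funext i
  rw [translation_apply]
  exact add_right_comm _ _ _

/-- The action of the affine group on the translations by conjugation. -/
noncomputable def linearPart : affinePerm →* MulAut (Fin 3 → Multiplicative (ZMod 2)) :=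
  have := range_translation_normal
  (MulAut.congr (MonoidHom.ofInjective translation_injective).symm).toMonoidHom.comp
    MulAut.conjNormal

theorem translation_linearPart (σ : affinePerm) (t : Fin 3 → Multiplicative (ZMod 2)) :
    translation (linearPart σ t) = σ * translation t * σ⁻¹ := by
  have := range_translation_normal
  have h : MonoidHom.ofInjective translation_injective (linearPart σ t) =
      MulAut.conjNormal σ (MonoidHom.ofInjective translation_injective t) :=
    MulEquiv.apply_symm_apply _ _
  have h1 := congrArg Subtype.val h
  rwa [MulAut.conjNormal_apply] at h1

theorem linearPart_translation (t : Fin 3 → Multiplicative (ZMod 2)) :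
    linearPart (translation t) = 1 :=
  MulEquiv.ext fun s => translation_injective (by
    rw [translation_linearPart, ← map_inv, ← map_mul, ← map_mul, mul_right_comm, mul_inv_cancel,
      one_mul]
    rfl)

/-- `PSL(2, 7)` is simple, so it is enough to exhibit one element whose linear part is nontrivial.
-/
theorem linearPart_pslAffine_injective :
    Function.Injective (linearPart.comp pslAffine) := by
  have : IsSimpleGroup (Matrix.ProjectiveSpecialLinearGroup (Fin 2) (ZMod 7)) :=
    Matrix.ProjectiveSpecialLinearGroup.rank_two_simple (by rw [Nat.card_zmod]; norm_num)
  rw [← MonoidHom.ker_eq_bot_iff]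
  refine (MonoidHom.normal_ker _).eq_bot_or_eq_top.resolve_right fun h => ?_
  -- This is `k ↦ k + 1`: it fixes the label zero and takes `![1, 0, 0]` to `![0, 1, 0]`, so it does
  -- not commute with translation by `![1, 0, 0]`.
  set g : SL(2, ZMod 7) := SpecialLinearGroup.transvection (zero_ne_one (α := Fin 2)) 1 with hg
  have h1 : linearPart (pslAffine (QuotientGroup.mk g)) = 1 := by
    change QuotientGroup.mk g ∈ (linearPart.comp pslAffine).ker
    rw [h]
    trivial
  have h2 := translation_linearPart (pslAffine (QuotientGroup.mk g))
    fun i => Multiplicative.ofAdd (![1, 0, 0] i)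
  rw [h1, eq_mul_inv_iff_mul_eq] at h2
  have h3 := congrArg (fun σ : affinePerm => σ.1 0) h2
  change ![1, 0, 0] + slPerm g 0 = slPerm g (![1, 0, 0] + 0) at h3
  rw [slPerm_apply, slPerm_apply] at h3
  have h4 : g 0 0 = 1 ∧ g 0 1 = 1 ∧ g 1 0 = 0 ∧ g 1 1 = 1 := by
    simp [hg, SpecialLinearGroup.transvection_coe]
  rw [h4.1, h4.2.1, h4.2.2.1, h4.2.2.2] at h3
  revert h3
  decide +kernel

/-- An affine map is determined by its values at four affinely independent points, for which there
are `8 * 7 * 6 * 4` possibilities: the fourth value avoids the plane of the first three. -/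
theorem card_affinePerm_le : Nat.card affinePerm ≤ 1344 := by
  let S := {p : ((Fin 3 → ZMod 2) × (Fin 3 → ZMod 2)) × ((Fin 3 → ZMod 2) × (Fin 3 → ZMod 2)) //
    p.1.1 ≠ p.1.2 ∧ p.1.1 ≠ p.2.1 ∧ p.1.2 ≠ p.2.1 ∧ p.2.2 ≠ p.1.1 ∧ p.2.2 ≠ p.1.2 ∧
      p.2.2 ≠ p.2.1 ∧ p.2.2 ≠ p.1.1 + p.1.2 + p.2.1}
  have hS : Fintype.card S = 1344 := by decide +kernel
  let F : affinePerm → S := fun σ =>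
    ⟨((σ.1 0, σ.1 ![1, 0, 0]), (σ.1 ![0, 1, 0], σ.1 ![0, 0, 1])), by
      dsimp only
      rw [← σ.2]
      refine ⟨?_, ?_, ?_, ?_, ?_, ?_, ?_⟩ <;> exact σ.1.injective.ne (by decide)⟩
  have hF : Function.Injective F := by
    intro σ τ h
    have h0 : σ.1 0 = τ.1 0 := congrArg (fun s : S => s.1.1.1) h
    have h1 : σ.1 ![1, 0, 0] = τ.1 ![1, 0, 0] := congrArg (fun s : S => s.1.1.2) h
    have h2 : σ.1 ![0, 1, 0] = τ.1 ![0, 1, 0] := congrArg (fun s : S => s.1.2.1) h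
    have h3 : σ.1 ![0, 0, 1] = τ.1 ![0, 0, 1] := congrArg (fun s : S => s.1.2.2) h
    have key : ∀ {x y z}, σ.1 x = τ.1 x → σ.1 y = τ.1 y → σ.1 z = τ.1 z →
        σ.1 (x + y + z) = τ.1 (x + y + z) := fun hx hy hz => by rw [σ.2, τ.2, hx, hy, hz]
    have h4 := key h0 h1 h2
    refine Subtype.ext (Equiv.ext fun v => ?_)
    have hv : v = 0 + 0 + 0 ∨ v = 0 + 0 + ![1, 0, 0] ∨ v = 0 + 0 + ![0, 1, 0] ∨
        v = 0 + 0 + ![0, 0, 1] ∨ v = 0 + ![1, 0, 0] + ![0, 1, 0] ∨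
        v = 0 + ![1, 0, 0] + ![0, 0, 1] ∨ v = 0 + ![0, 1, 0] + ![0, 0, 1] ∨
        v = 0 + (0 + ![1, 0, 0] + ![0, 1, 0]) + ![0, 0, 1] := by
      clear * -
      revert v
      decide +kernel
    rcases hv with rfl | rfl | rfl | rfl | rfl | rfl | rfl | rfl
    exacts [key h0 h0 h0, key h0 h0 h1, key h0 h0 h2, key h0 h0 h3, key h0 h1 h2, key h0 h1 h3,
      key h0 h2 h3, key h0 h4 h3]
  calc Nat.card affinePerm ≤ Nat.card S := Nat.card_le_card_of_injective F hF
    _ = 1344 := by rw [Nat.card_eq_fintype_card, hS]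

theorem card_psl_two_seven :
    168 ≤ Nat.card (Matrix.ProjectiveSpecialLinearGroup (Fin 2) (ZMod 7)) := by
  have h1 := Subgroup.card_eq_card_quotient_mul_card_subgroup (Subgroup.center SL(2, ZMod 7))
  have h2 : Nat.card SL(2, ZMod 7) = 336 := by
    let e : SL(2, ZMod 7) ≃ {p : (ZMod 7 × ZMod 7) × (ZMod 7 × ZMod 7) //
        p.1.1 * p.2.2 - p.1.2 * p.2.1 = 1} :=
      { toFun := fun g => ⟨((g 0 0, g 0 1), (g 1 0, g 1 1)), by
          rw [← Matrix.det_fin_two, g.2]⟩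
        invFun := fun p => ⟨!![p.1.1.1, p.1.1.2; p.1.2.1, p.1.2.2], by
          rw [Matrix.det_fin_two_of, p.2]⟩
        left_inv := fun g => by
          ext i j
          fin_cases i <;> fin_cases j <;> rfl
        right_inv := fun p => rfl }
    rw [Nat.card_congr e, Nat.card_eq_fintype_card]
    decide +kernel
  -- The centre consists of scalars whose square is one; hence the quotient has order at least `336
  -- / 2`.
  have h3 : Nat.card (Subgroup.center SL(2, ZMod 7)) ≤ 2 := by
    rw [Nat.card_congr (Matrix.SpecialLinearGroup.center_equiv_rootsOfUnity (n := Fin 2)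
      (R := ZMod 7)).toEquiv]
    have : NeZero (max (Fintype.card (Fin 2)) 1) := ⟨by simp⟩
    exact (card_rootsOfUnity _ _).trans (by simp)
  rw [h2] at h1
  change 168 ≤ Nat.card (SL(2, ZMod 7) ⧸ Subgroup.center SL(2, ZMod 7))
  nlinarith

/-- The affine group is the semidirect product of the translations and `PSL(2, 7)`. -/
theorem exists_affinePerm_equiv :
    ∃ φ : Matrix.ProjectiveSpecialLinearGroup (Fin 2) (ZMod 7) →*
        MulAut (Fin 3 → Multiplicative (ZMod 2)),
      Function.Injective φ ∧
      Nonempty (affinePerm ≃* (Fin 3 → Multiplicative (ZMod 2)) ⋊[φ]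
          Matrix.ProjectiveSpecialLinearGroup (Fin 2) (ZMod 7)) := by
  refine ⟨linearPart.comp pslAffine, linearPart_pslAffine_injective, ?_⟩
  let F : (Fin 3 → Multiplicative (ZMod 2)) ⋊[linearPart.comp pslAffine]
      Matrix.ProjectiveSpecialLinearGroup (Fin 2) (ZMod 7) →* affinePerm :=
    SemidirectProduct.lift translation pslAffine fun g => MonoidHom.ext fun t =>
      translation_linearPart (pslAffine g) t
  have hF : Function.Injective F := by
    rw [injective_iff_map_eq_one]
    rintro ⟨t, g⟩ h
    have h1 : translation t * pslAffine g = 1 := h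
    -- Translations have trivial linear part, so injectivity on `PSL(2, 7)` separates the two
    -- factors.
    have h2 : (linearPart.comp pslAffine) g = 1 := by
      have h3 := congrArg linearPart h1
      rwa [map_mul, linearPart_translation, one_mul, map_one] at h3
    have hg : g = 1 := linearPart_pslAffine_injective (h2.trans (map_one _).symm)
    subst hg
    rw [map_one, mul_one] at h1
    have ht : t = 1 := translation_injective (h1.trans (map_one _).symm)
    subst ht
    rfl
  refine ⟨(MulEquiv.ofBijective F (hF.bijective_of_nat_card_le ?_)).symm⟩
  -- Surjectivity is by order: `1344 = 8 * 168`.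
  refine card_affinePerm_le.trans ?_
  rw [SemidirectProduct.card, Nat.card_eq_fintype_card (α := Fin 3 → Multiplicative (ZMod 2))]
  have h8 : Fintype.card (Fin 3 → Multiplicative (ZMod 2)) = 8 := by decide
  rw [h8]
  have := card_psl_two_seven
  omega

end

namespace EEight

/-! ### Transport along conjugation -/

section Conj

variable {M N : Subgroup weylGroup} {g : weylGroup}

theorem mem_conj_iff (h : M.map (MulAut.conj g).toMonoidHom = N) {w : weylGroup} :
    g * w * g⁻¹ ∈ N ↔ w ∈ M := by
  rw [← h]
  exact Subgroup.mem_map_iff_mem (MulAut.conj g).injective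

theorem mem_points_conj_iff (h : M.map (MulAut.conj g).toMonoidHom = N) {w : weylGroup} :
    g * w * g⁻¹ ∈ points N ↔ w ∈ points M := by
  refine and_congr (mem_conj_iff h) ⟨?_, ?_⟩
  · rintro ⟨α, hα, hw⟩
    obtain hw' : g * w * g⁻¹ = weylReflection α hα := Subtype.ext hw
    refine ⟨_, smul_mem_roots g⁻¹ hα, ?_⟩
    rw [show w = weylReflection (g⁻¹ • α) (smul_mem_roots g⁻¹ hα) by
      rw [weylReflection_smul_eq_conj _ hα, ← hw']
      group]
    rfl
  · rintro ⟨α, hα, hw⟩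
    obtain hw' : w = weylReflection α hα := Subtype.ext hw
    refine ⟨_, smul_mem_roots g hα, ?_⟩
    rw [hw', ← weylReflection_smul_eq_conj _ hα]
    rfl

theorem image_orbit (h : M.map (MulAut.conj g).toMonoidHom = N) (α : RootLattice) :
    (g • ·) '' MulAction.orbit M α = MulAction.orbit N (g • α) := by
  ext x
  constructor
  · rintro ⟨_, ⟨w, rfl⟩, rfl⟩
    refine ⟨⟨g * w.1 * g⁻¹, (mem_conj_iff h).2 w.2⟩, ?_⟩
    change (g * w.1 * g⁻¹) • g • α = g • w.1 • α
    rw [mul_smul, inv_smul_smul, mul_smul]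
  · rintro ⟨⟨w, hw⟩, rfl⟩
    have hw' : g⁻¹ * w * g ∈ M := by
      rw [← mem_conj_iff h]
      convert hw using 1
      group
    refine ⟨_, ⟨⟨_, hw'⟩, rfl⟩, ?_⟩
    change g • (g⁻¹ * w * g) • α = w • g • α
    rw [mul_smul, mul_smul, smul_inv_smul]

theorem image_mem_lines (h : M.map (MulAut.conj g).toMonoidHom = N) {O : Set RootLattice}
    (hO : O ∈ lines M) : (g • ·) '' O ∈ lines N := by
  obtain ⟨⟨α, hα, rfl⟩, hne⟩ := hO
  refine ⟨⟨g • α, smul_mem_roots g hα, image_orbit h α⟩, fun β hβ heq => ?_⟩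
  refine hne _ (smul_mem_roots g⁻¹ hβ) ((MulAction.injective g).image_injective ?_)
  change (g • ·) '' _ = (g • ·) '' _
  rw [heq, Set.image_pair, smul_neg, smul_inv_smul]

theorem image_mem_lines_iff (h : M.map (MulAut.conj g).toMonoidHom = N) {O : Set RootLattice} :
    (g • ·) '' O ∈ lines N ↔ O ∈ lines M := by
  refine ⟨fun hO => ?_, image_mem_lines h⟩
  have h' : N.map (MulAut.conj g⁻¹).toMonoidHom = M := by
    ext w
    rw [← h]
    constructor
    · rintro ⟨_, ⟨w, hw, rfl⟩, rfl⟩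
      change g⁻¹ * (g * w * g⁻¹) * g⁻¹⁻¹ ∈ M
      rwa [show g⁻¹ * (g * w * g⁻¹) * g⁻¹⁻¹ = w by group]
    · intro hw
      refine ⟨_, ⟨w, hw, rfl⟩, ?_⟩
      change g⁻¹ * (g * w * g⁻¹) * g⁻¹⁻¹ = w
      group
  have h2 := image_mem_lines h' hO
  rw [Set.image_image] at h2
  simpa using h2

theorem involves_conj_iff {O : Set RootLattice} {s : weylGroup} :
    Involves ((g • ·) '' O) (g * s * g⁻¹) ↔ Involves O s := by
  have key : ∀ x : RootLattice, (g * s * g⁻¹) • g • x = g • x ↔ s • x = x := fun x => by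
    rw [mul_smul, inv_smul_smul, mul_smul, smul_left_cancel_iff]
  constructor
  · rintro ⟨_, ⟨x, hx, rfl⟩, hs⟩
    exact ⟨x, hx, fun h => hs ((key x).2 h)⟩
  · rintro ⟨x, hx, hs⟩
    exact ⟨_, ⟨x, hx, rfl⟩, fun h => hs ((key x).1 h)⟩

theorem exists_geometry_equiv_conj (h : M.map (MulAut.conj g).toMonoidHom = N) :
    ∃ (e : points M ≃ points N) (f : lines M ≃ lines N),
      ∀ s O, Involves (f O).1 (e s).1 ↔ Involves O.1 s.1 := by
  let e : points M ≃ points N := (MulAut.conj g).toEquiv.subtypeEquiv fun w =>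
    (mem_points_conj_iff h).symm
  let f : lines M ≃ lines N := (Equiv.Set.congr (MulAction.toPerm g)).subtypeEquiv fun O =>
    (image_mem_lines_iff h).symm
  exact ⟨e, f, fun s O => involves_conj_iff⟩

theorem closure_points_conj (h : M.map (MulAut.conj g).toMonoidHom = N)
    (hN : Subgroup.closure (points N) = N) : Subgroup.closure (points M) = M := by
  have himage : (MulAut.conj g).toMonoidHom '' points M = points N := by
    ext w
    constructor
    · rintro ⟨w, hw, rfl⟩
      exact (mem_points_conj_iff h).2 hw
    · intro hw
      refine ⟨g⁻¹ * w * g, ?_, ?_⟩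
      · rw [← mem_points_conj_iff h]
        convert hw using 1
        group
      · change g * (g⁻¹ * w * g) * g⁻¹ = w
        group
  refine Subgroup.map_injective (f := (MulAut.conj g).toMonoidHom) (MulAut.conj g).injective ?_
  rw [MonoidHom.map_closure, himage, hN, h]

theorem nonempty_discreteWeylGroup_equiv_conj (h : M.map (MulAut.conj g).toMonoidHom = N) :
    Nonempty (DiscreteWeylGroup M ≃* DiscreteWeylGroup N) := by
  have hnorm : ∀ w, w ∈ Subgroup.normalizer (M : Set weylGroup) ↔
      MulAut.conj g w ∈ Subgroup.normalizer (N : Set weylGroup) := by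
    intro w
    rw [Subgroup.mem_normalizer_iff, Subgroup.mem_normalizer_iff]
    refine Iff.trans ?_ (MulAut.conj g).surjective.forall.symm
    refine forall_congr' fun v => ?_
    rw [← map_inv, ← map_mul, ← map_mul]
    exact (iff_congr (mem_conj_iff h) (mem_conj_iff h)).symm
  let E : Subgroup.normalizer (M : Set weylGroup) ≃* Subgroup.normalizer (N : Set weylGroup) :=
    { (MulAut.conj g).toEquiv.subtypeEquiv hnorm with
      map_mul' := fun a b => Subtype.ext (map_mul (MulAut.conj g) a.1 b.1) }
  refine ⟨QuotientGroup.congr _ _ E ?_⟩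
  ext w
  rw [Subgroup.mem_subgroupOf]
  constructor
  · rintro ⟨v, hv, rfl⟩
    exact (mem_conj_iff h).2 hv
  · intro hw
    obtain ⟨v, rfl⟩ := E.surjective w
    exact ⟨v, (mem_conj_iff h).1 hw, rfl⟩

end Conj

end EEight

theorem mainTheorem8 (M : Subgroup EEight.weylGroup) (hM : IsDiscreteMaximalTorus M) :
    -- `M` is elementary abelian of order `2 ^ 8`, generated by the reflections it contains
    Nonempty (M ≃* (Fin 8 → Multiplicative (ZMod 2))) ∧
    Subgroup.closure (EEight.points M) = M ∧
    -- the numbers of roots, points and lines, of points on a line and lines through a point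
    EEight.roots.ncard = 240 ∧
    (EEight.points M).ncard = 8 ∧
    (EEight.lines M).ncard = 14 ∧
    (∀ O ∈ EEight.lines M, {s ∈ EEight.points M | EEight.Involves O s}.ncard = 4) ∧
    (∀ s ∈ EEight.points M, {O ∈ EEight.lines M | EEight.Involves O s}.ncard = 7) ∧
    -- the geometry is the one-point extension of the Fano plane
    (∃ (e : EEight.points M ≃ ExtendedFanoPoint) (f : EEight.lines M ≃ ExtendedFanoLine),
      ∀ (s : EEight.points M) (O : EEight.lines M),
        EEight.Involves O.1 s.1 ↔ ExtendedFanoIncident (e s) (f O)) ∧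
    -- the discrete Weyl group is `2 ^ 3 : PSL(2, 7)`, the action being faithful
    (∃ φ : Matrix.ProjectiveSpecialLinearGroup (Fin 2) (ZMod 7) →*
        MulAut (Fin 3 → Multiplicative (ZMod 2)),
      Function.Injective φ ∧
      Nonempty (DiscreteWeylGroup M ≃*
        (Fin 3 → Multiplicative (ZMod 2)) ⋊[φ]
          Matrix.ProjectiveSpecialLinearGroup (Fin 2) (ZMod 7))) := by
  obtain ⟨g, hg⟩ := EEight.exists_conj_eq_frameSubgroup hM.1
  obtain ⟨e₀, f₀, h₀⟩ := EEight.exists_geometry_equiv_frameSubgroup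
  obtain ⟨e₁, f₁, h₁⟩ := EEight.exists_geometry_equiv_conj hg
  have hgeom : ∀ s O, EEight.Involves O.1 s.1 ↔
      ExtendedFanoIncident ((e₁.trans e₀) s) ((f₁.trans f₀) O) := fun s O =>
    (h₁ s O).symm.trans (h₀ _ _)
  obtain ⟨h8, h14, h4, h7⟩ := EEight.ncards_of_geometry_equiv _ _ hgeom
  obtain ⟨φ, hφ, ⟨E⟩⟩ := exists_affinePerm_equiv
  obtain ⟨E₀⟩ := EEight.nonempty_discreteWeylGroup_equiv
  obtain ⟨E₁⟩ := EEight.nonempty_discreteWeylGroup_equiv_conj hg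
  refine ⟨⟨?_⟩, EEight.closure_points_conj hg EEight.closure_points_frameSubgroup,
    EEight.ncard_roots, h8, h14, h4, h7, ⟨_, _, hgeom⟩, φ, hφ, ⟨(E₁.trans E₀).trans E⟩⟩
  exact (M.equivMapOfInjective _ (MulAut.conj g).injective).trans
    ((MulEquiv.subgroupCongr hg).trans (MulEquiv.ofBijective _ EEight.frameSign_bijective))
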